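/- Let $T$ be a compact (Hausdorff) abelian group with discrete dual group $\hat T$, and let $\mathbb C[T]=\mathbb C\hat T$ be the Hopf $*$-algebra of regular functions on $T$, i.e. the group algebra of $\hat T$ (each $a\in\hat T$ is group-like and $a^*=a^{-1}$). Let $H$ be a Hopf $*$-algebra over $\mathbb C$ with coproduct $\Delta(x)=x_{(1)}\otimes x_{(2)}$, counit $\varepsilon$ and antipode $S$, let $\pi\colon H\to\mathbb C[T]$ be a homomorphism of Hopf $*$-algebras, and let $\beta\colon\hat T\times\hat T\to\mathbb T$ be a bicharacter, i.e. a map into the unit circle that is multiplicative in each variable. The algebra $H$ is bigraded by $\hat T$: $H=\bigoplus_{a,b\in\hat T}H_{a,b}$, where $$H_{a,b}=\{x\in H:\ (\pi\otimes\iota)\Delta(x)=a\otimes x,\ (\iota\otimes\pi)\Delta(x)=x\otimes b\}.$$ For $x\in H_{a,c}$ write $\Delta(x)=\sum_{b}x_{(1)}^{a,b}\otimes x_{(2)}^{b,c}$ for the decomposition with $b$-th term in $H_{a,b}\otimes H_{b,c}$. Let $\mathrm{ad}(x)=x_{(2)}\otimes S(x_{(1)})x_{(3)}$ and $\mathrm{ad}_\pi=(\iota\otimes\pi)\mathrm{ad}\colon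 H\to H\otimes\mathbb C[T]$; thus $\mathrm{ad}_\pi(x)=x\otimes a^{-1}b$ for $x\in H_{a,b}$. A closed subgroup $T_0\subset T$, with restriction map $q\colon\mathbb C[T]\to\mathbb C[T_0]$, is called $H$-cocentral if $(\iota\otimes q\pi)\,\mathrm{ad}(x)=x\otimes1$ for all $x\in H$. In this case $\mathrm{ad}_\pi(H)\subset H\otimes\mathbb C[T/T_0]$, where $\mathbb C[T/T_0]=\mathbb C\,\widehat{T/T_0}$ is viewed as a subalgebra of $\mathbb C[T]$ through $\widehat{T/T_0}\subset\hat T$. The transmutation $H_\beta$ is the coalgebra $H$ with the coaction $\mathrm{ad}_\pi$ of $\mathbb C[T/T_0]$ and with the new product $$x\cdot_\beta y=\beta(a^{-1}b,c^{-1})\,xy,\qquad x\in H_{a,b},\ y\in H_{c,d}.$$ Its bosonization $\mathbb C[T/T_0]\#H_\beta$ is the vector space $\mathbb C[T/T_0]\otimes H$ with unit $1\#1$, counit $\varepsilon\otimes\varepsilon$, and product and coproduct $$(a\#x)(a'\#y)=\beta(b^{-1}c,a')\,aa'\#(x\cdot_\beta y),\qquad \Delta(a\#x)=\sum_{d\in\hat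 T}(a\#x_{(1)}^{b,d})\otimes(ab^{-1}d\#x_{(2)}^{d,c})$$ for $a,a'\in\widehat{T/T_0}$, $x\in H_{b,c}$, $y\in H$. The bialgebra $\mathbb C[T/T_0]\ltimes H$ (the bosonization of $H$ with its original product, over $\mathbb C[T/T_0]$ with the trivial bicharacter) is the same vector space $\mathbb C[T/T_0]\otimes H$ with the tensor product algebra structure and with the same coproduct and counit. For every $H$-cocentral closed subgroup $T_0\subset T$, there is a $\mathbb C$-linear monoidal equivalence between the monoidal category of right comodules of $\mathbb C[T/T_0]\#H_\beta$ and the monoidal category of right comodules of $\mathbb C[T/T_0]\ltimes H$. -/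

import Mathlib

universe u v w

namespace Transmutation

open TensorProduct CategoryTheory Coalgebra

noncomputable section

section

/-- `δ : M → M ⊗ C` makes `M` a right comodule over the coalgebra `C`. -/
structure IsCoaction {C : Type v} [AddCommGroup C] [Module ℂ C] [Coalgebra ℂ C]
    {M : Type w} [AddCommGroup M] [Module ℂ M] (δ : M →ₗ[ℂ] M ⊗[ℂ] C) : Prop where
  coassoc : (TensorProduct.assoc ℂ M C C).toLinearMap ∘ₗ δ.rTensor C ∘ₗ δ
    = (comul : C →ₗ[ℂ] C ⊗[ℂ] C).lTensor M ∘ₗ δ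
  counit : (TensorProduct.rid ℂ M).toLinearMap ∘ₗ (counit : C →ₗ[ℂ] ℂ).lTensor M ∘ₗ δ
    = LinearMap.id

/-- The codiagonal coaction `m ⊗ n ↦ m⁽¹⁾ ⊗ n⁽¹⁾ ⊗ m⁽²⁾ n⁽²⁾`. -/
def tensorCoaction {B : Type v} [Ring B] [Algebra ℂ B]
    {M : Type*} [AddCommGroup M] [Module ℂ M] {N : Type*} [AddCommGroup N] [Module ℂ N]
    (δM : M →ₗ[ℂ] M ⊗[ℂ] B) (δN : N →ₗ[ℂ] N ⊗[ℂ] B) :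
    M ⊗[ℂ] N →ₗ[ℂ] (M ⊗[ℂ] N) ⊗[ℂ] B :=
  (LinearMap.mul' ℂ B).lTensor (M ⊗[ℂ] N)
    ∘ₗ (TensorProduct.tensorTensorTensorComm ℂ M B N B).toLinearMap
    ∘ₗ TensorProduct.map δM δN

/-- Right comodules over a bialgebra `B`, with underlying vector space in `Type w`. -/
structure ComodCat (B : Type v) [Ring B] [Bialgebra ℂ B] where
  carrier : Type w
  [addCommGroup : AddCommGroup carrier]
  [module : Module ℂ carrier]
  coact : carrier →ₗ[ℂ] carrier ⊗[ℂ] B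
  isCoaction : IsCoaction coact

attribute [instance] ComodCat.addCommGroup ComodCat.module

namespace ComodCat

variable {B : Type v} [Ring B] [Bialgebra ℂ B]

/-- Morphisms of comodules: colinear maps. -/
@[ext]
structure Hom (M N : ComodCat.{v, w} B) where
  lin : M.carrier →ₗ[ℂ] N.carrier
  comm : N.coact ∘ₗ lin = lin.rTensor B ∘ₗ M.coact

instance : Category (ComodCat.{v, w} B) where
  Hom M N := Hom M N
  id M := ⟨LinearMap.id, by simp⟩
  comp f g := ⟨g.lin ∘ₗ f.lin, by
    rw [← LinearMap.comp_assoc, g.comm, LinearMap.comp_assoc, f.comm, ← LinearMap.comp_assoc,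
      LinearMap.rTensor_comp]⟩

@[ext]
theorem hom_ext {M N : ComodCat.{v, w} B} {f g : M ⟶ N} (h : Hom.lin f = Hom.lin g) : f = g :=
  Hom.ext h

@[simp]
theorem id_lin (M : ComodCat.{v, w} B) : Hom.lin (𝟙 M) = LinearMap.id := rfl

@[simp]
theorem comp_lin {M N P : ComodCat.{v, w} B} (f : M ⟶ N) (g : N ⟶ P) :
    Hom.lin (f ≫ g) = Hom.lin g ∘ₗ Hom.lin f := rfl

section Linear

variable {M N : ComodCat.{v, w} B}

instance : Zero (M ⟶ N) := ⟨⟨0, by simp⟩⟩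

instance : Add (M ⟶ N) := ⟨fun f g => ⟨Hom.lin f + Hom.lin g, by
  rw [LinearMap.comp_add, f.comm, g.comm, LinearMap.rTensor_add, LinearMap.add_comp]⟩⟩

instance : Neg (M ⟶ N) := ⟨fun f => ⟨-Hom.lin f, by
  rw [LinearMap.comp_neg, f.comm, LinearMap.rTensor_neg, LinearMap.neg_comp]⟩⟩

instance : SMul ℂ (M ⟶ N) := ⟨fun c f => ⟨c • Hom.lin f, by
  rw [LinearMap.comp_smul, f.comm, LinearMap.rTensor_smul, LinearMap.smul_comp]⟩⟩

theorem add_lin (f g : M ⟶ N) : Hom.lin (f + g) = Hom.lin f + Hom.lin g := rfl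

theorem smul_lin (c : ℂ) (f : M ⟶ N) : Hom.lin (c • f) = c • Hom.lin f := rfl

instance : AddCommGroup (M ⟶ N) where
  add_assoc _ _ _ := hom_ext (add_assoc _ _ _)
  zero_add _ := hom_ext (zero_add _)
  add_zero _ := hom_ext (add_zero _)
  add_comm _ _ := hom_ext (add_comm _ _)
  neg_add_cancel _ := hom_ext (neg_add_cancel _)
  nsmul := nsmulRec
  zsmul := zsmulRec

instance : Module ℂ (M ⟶ N) where
  one_smul _ := hom_ext (one_smul ℂ _)
  mul_smul _ _ _ := hom_ext (mul_smul _ _ _)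
  smul_zero c := hom_ext (smul_zero c)
  smul_add _ _ _ := hom_ext (smul_add _ _ _)
  add_smul _ _ _ := hom_ext (add_smul _ _ _)
  zero_smul _ := hom_ext (zero_smul ℂ _)

end Linear

/-- Colinear maps are added pointwise. -/
instance : Preadditive (ComodCat.{v, w} B) where
  add_comp _ _ _ _ _ _ := hom_ext (LinearMap.comp_add _ _ _)
  comp_add _ _ _ _ _ _ := hom_ext (LinearMap.add_comp _ _ _)

/-- The category of comodules is `ℂ`-linear. -/
instance : Linear ℂ (ComodCat.{v, w} B) where
  smul_comp _ _ _ _ _ _ := hom_ext (LinearMap.comp_smul _ _ _)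
  comp_smul _ _ _ _ _ _ := hom_ext (LinearMap.smul_comp _ _ _)

/-- A colinear bijection is an isomorphism of comodules. -/
def mkIso {M N : ComodCat.{v, w} B} (e : M.carrier ≃ₗ[ℂ] N.carrier)
    (h : N.coact ∘ₗ e.toLinearMap = e.toLinearMap.rTensor B ∘ₗ M.coact) : M ≅ N where
  hom := ⟨e.toLinearMap, h⟩
  inv := ⟨e.symm.toLinearMap, by
    have h2 : N.coact = e.toLinearMap.rTensor B ∘ₗ M.coact ∘ₗ e.symm.toLinearMap := by
      rw [← LinearMap.comp_assoc, ← h, LinearMap.comp_assoc]; simp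
    rw [h2, ← LinearMap.comp_assoc, ← LinearMap.rTensor_comp]; simp⟩
  hom_inv_id := by ext x; simp
  inv_hom_id := by ext x; simp

theorem isCoaction_tensor {M : Type*} [AddCommGroup M] [Module ℂ M] {N : Type*} [AddCommGroup N]
    [Module ℂ N] {δM : M →ₗ[ℂ] M ⊗[ℂ] B} {δN : N →ₗ[ℂ] N ⊗[ℂ] B}
    (hM : IsCoaction δM) (hN : IsCoaction δN) : IsCoaction (tensorCoaction δM δN) where
  coassoc := by
    have key : ∀ (p : M ⊗[ℂ] B) (q : N ⊗[ℂ] B),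
        TensorProduct.assoc ℂ (M ⊗[ℂ] N) B B ((tensorCoaction δM δN).rTensor B
          ((LinearMap.mul' ℂ B).lTensor (M ⊗[ℂ] N)
            (TensorProduct.tensorTensorTensorComm ℂ M B N B (p ⊗ₜ q)))) =
        (TensorProduct.map (LinearMap.mul' ℂ B) (LinearMap.mul' ℂ B) ∘ₗ
          (TensorProduct.tensorTensorTensorComm ℂ B B B B).toLinearMap).lTensor (M ⊗[ℂ] N)
          (TensorProduct.tensorTensorTensorComm ℂ M (B ⊗[ℂ] B) N (B ⊗[ℂ] B)
          ((TensorProduct.assoc ℂ M B B (δM.rTensor B p)) ⊗ₜ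
            (TensorProduct.assoc ℂ N B B (δN.rTensor B q)))) := by
      intro p q
      induction p with
      | zero => simp
      | add x y hx hy => simp only [TensorProduct.add_tmul, map_add, hx, hy]
      | tmul m b =>
        induction q with
        | zero => simp
        | add x y hx hy => simp only [TensorProduct.tmul_add, map_add, hx, hy]
        | tmul n c =>
          simp only [tensorTensorTensorComm_tmul, LinearMap.lTensor_tmul, LinearMap.mul'_apply,
            LinearMap.rTensor_tmul, tensorCoaction, LinearMap.comp_apply, LinearEquiv.coe_coe,
            TensorProduct.map_tmul]
          generalize δM m = p
          generalize δN n = q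
          induction p with
          | zero => simp
          | add x y hx hy => simp only [TensorProduct.add_tmul, map_add, hx, hy]
          | tmul m b =>
            induction q with
            | zero => simp
            | add x y hx hy => simp only [TensorProduct.tmul_add, TensorProduct.add_tmul, map_add, hx, hy]
            | tmul n c => simp
    have key2 : ∀ (p : M ⊗[ℂ] B) (q : N ⊗[ℂ] B),
        (comul : B →ₗ[ℂ] B ⊗[ℂ] B).lTensor (M ⊗[ℂ] N) ((LinearMap.mul' ℂ B).lTensor (M ⊗[ℂ] N)
            (TensorProduct.tensorTensorTensorComm ℂ M B N B (p ⊗ₜ q))) =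
        (TensorProduct.map (LinearMap.mul' ℂ B) (LinearMap.mul' ℂ B) ∘ₗ
          (TensorProduct.tensorTensorTensorComm ℂ B B B B).toLinearMap).lTensor (M ⊗[ℂ] N)
          (TensorProduct.tensorTensorTensorComm ℂ M (B ⊗[ℂ] B) N (B ⊗[ℂ] B)
          (((comul : B →ₗ[ℂ] B ⊗[ℂ] B).lTensor M p) ⊗ₜ
            ((comul : B →ₗ[ℂ] B ⊗[ℂ] B).lTensor N q))) := by
      intro p q
      induction p with
      | zero => simp
      | add x y hx hy => simp only [TensorProduct.add_tmul, map_add, hx, hy]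
      | tmul m b =>
        induction q with
        | zero => simp
        | add x y hx hy => simp only [TensorProduct.tmul_add, map_add, hx, hy]
        | tmul n c =>
          simp only [tensorTensorTensorComm_tmul, LinearMap.lTensor_tmul, LinearMap.mul'_apply,
            LinearMap.comp_apply, LinearEquiv.coe_coe, Bialgebra.comul_mul]
          generalize (comul b : B ⊗[ℂ] B) = p
          generalize (comul c : B ⊗[ℂ] B) = q
          congr 1
          induction p with
          | zero => simp
          | add x y hx hy => simp only [TensorProduct.add_tmul, map_add, hx, hy, add_mul]
          | tmul m b =>
            induction q with
            | zero => simp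
            | add x y hx hy => simp only [TensorProduct.tmul_add, map_add, hx, hy, mul_add]
            | tmul n c => simp
    ext m n
    have h1 := LinearMap.congr_fun hM.coassoc m
    have h2 := LinearMap.congr_fun hN.coassoc n
    have k1 := key (δM m) (δN n)
    have k2 := key2 (δM m) (δN n)
    simp only [LinearMap.comp_apply, LinearEquiv.coe_coe] at h1 h2
    rw [h1, h2, ← k2] at k1
    simpa [tensorCoaction] using k1
  counit := by
    have key : ∀ (p : M ⊗[ℂ] B) (q : N ⊗[ℂ] B),
        TensorProduct.rid ℂ (M ⊗[ℂ] N) ((counit : B →ₗ[ℂ] ℂ).lTensor (M ⊗[ℂ] N)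
          ((LinearMap.mul' ℂ B).lTensor (M ⊗[ℂ] N)
            (TensorProduct.tensorTensorTensorComm ℂ M B N B (p ⊗ₜ q)))) =
        (TensorProduct.rid ℂ M ((counit : B →ₗ[ℂ] ℂ).lTensor M p)) ⊗ₜ
          (TensorProduct.rid ℂ N ((counit : B →ₗ[ℂ] ℂ).lTensor N q)) := by
      intro p q
      induction p with
      | zero => simp
      | add x y hx hy => simp only [TensorProduct.add_tmul, map_add, hx, hy]
      | tmul m b =>
        induction q with
        | zero => simp
        | add x y hx hy => simp only [TensorProduct.tmul_add, map_add, hx, hy]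
        | tmul n c =>
          simp [TensorProduct.smul_tmul', TensorProduct.tmul_smul, smul_smul, mul_comm]
    ext m n
    have h1 := LinearMap.congr_fun hM.counit m
    have h2 := LinearMap.congr_fun hN.counit n
    have k1 := key (δM m) (δN n)
    simp only [LinearMap.comp_apply, LinearEquiv.coe_coe, LinearMap.id_apply] at h1 h2
    rw [h1, h2] at k1
    simpa [tensorCoaction] using k1

theorem tensorCoaction_natural {M M' N N' : Type*} [AddCommGroup M] [Module ℂ M]
    [AddCommGroup N] [Module ℂ N] [AddCommGroup M'] [Module ℂ M'] [AddCommGroup N'] [Module ℂ N']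
    {δM : M →ₗ[ℂ] M ⊗[ℂ] B} {δN : N →ₗ[ℂ] N ⊗[ℂ] B}
    {δM' : M' →ₗ[ℂ] M' ⊗[ℂ] B} {δN' : N' →ₗ[ℂ] N' ⊗[ℂ] B} (f : M →ₗ[ℂ] M') (g : N →ₗ[ℂ] N')
    (hf : δM' ∘ₗ f = f.rTensor B ∘ₗ δM) (hg : δN' ∘ₗ g = g.rTensor B ∘ₗ δN) :
    tensorCoaction δM' δN' ∘ₗ TensorProduct.map f g
      = (TensorProduct.map f g).rTensor B ∘ₗ tensorCoaction δM δN := by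
  have key : ∀ (p : M ⊗[ℂ] B) (q : N ⊗[ℂ] B),
      (LinearMap.mul' ℂ B).lTensor (M' ⊗[ℂ] N')
        (TensorProduct.tensorTensorTensorComm ℂ M' B N' B (f.rTensor B p ⊗ₜ g.rTensor B q)) =
      (TensorProduct.map f g).rTensor B ((LinearMap.mul' ℂ B).lTensor (M ⊗[ℂ] N)
        (TensorProduct.tensorTensorTensorComm ℂ M B N B (p ⊗ₜ q))) := by
    intro p q
    induction p with
    | zero => simp
    | add x y hx hy => simp only [TensorProduct.add_tmul, map_add, hx, hy]
    | tmul m b =>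
      induction q with
      | zero => simp
      | add x y hx hy => simp only [TensorProduct.tmul_add, map_add, hx, hy]
      | tmul n c => simp
  ext m n
  have h1 := LinearMap.congr_fun hf m
  have h2 := LinearMap.congr_fun hg n
  have k := key (δM m) (δN n)
  simp only [LinearMap.comp_apply] at h1 h2
  rw [← h1, ← h2] at k
  simpa [tensorCoaction] using k

/-- The trivial comodule `ℂ`. -/
def unit (B : Type v) [Ring B] [Bialgebra ℂ B] : ComodCat.{v, w} B where
  carrier := ULift.{w} ℂ
  coact := (TensorProduct.mk ℂ (ULift.{w} ℂ) B).flip 1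
  isCoaction :=
    { coassoc := by
        ext
        simp [Algebra.TensorProduct.one_def]
      counit := by
        ext
        simp }

/-- The tensor product of comodules. -/
def tensor (M N : ComodCat.{v, w} B) : ComodCat.{v, w} B where
  carrier := M.carrier ⊗[ℂ] N.carrier
  coact := tensorCoaction M.coact N.coact
  isCoaction := isCoaction_tensor M.isCoaction N.isCoaction

/-- The tensor product of colinear maps. -/
def tensorMap {M M' N N' : ComodCat.{v, w} B} (f : M ⟶ M') (g : N ⟶ N') :
    tensor M N ⟶ tensor M' N' :=
  ⟨TensorProduct.map (Hom.lin f) (Hom.lin g),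
    tensorCoaction_natural (Hom.lin f) (Hom.lin g) (Hom.comm f) (Hom.comm g)⟩

theorem assoc_comm {M N P : Type*} [AddCommGroup M] [Module ℂ M] [AddCommGroup N] [Module ℂ N]
    [AddCommGroup P] [Module ℂ P] (δM : M →ₗ[ℂ] M ⊗[ℂ] B) (δN : N →ₗ[ℂ] N ⊗[ℂ] B)
    (δP : P →ₗ[ℂ] P ⊗[ℂ] B) :
    tensorCoaction δM (tensorCoaction δN δP) ∘ₗ (TensorProduct.assoc ℂ M N P).toLinearMap =
      (TensorProduct.assoc ℂ M N P).toLinearMap.rTensor B ∘ₗ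
        tensorCoaction (tensorCoaction δM δN) δP := by
  refine TensorProduct.ext_threefold fun m n p => ?_
  simp only [tensorCoaction, LinearMap.comp_apply, LinearEquiv.coe_coe,
    TensorProduct.assoc_tmul, TensorProduct.map_tmul]
  generalize δM m = x
  generalize δN n = y
  generalize δP p = z
  induction x with
  | zero => simp
  | add x x' hx hy => simp only [TensorProduct.add_tmul, map_add, hx, hy]
  | tmul m b =>
    induction y with
    | zero => simp
    | add x y hx hy => simp only [TensorProduct.tmul_add, TensorProduct.add_tmul, map_add, hx, hy]
    | tmul n c =>
      induction z with
      | zero => simp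
      | add x y hx hy => simp only [TensorProduct.tmul_add, map_add, hx, hy]
      | tmul p d => simp [mul_assoc]

/-- The canonical isomorphism `ℂ ⊗ V ≃ V`. -/
def lidEquiv (V : Type w) [AddCommGroup V] [Module ℂ V] : ULift.{w} ℂ ⊗[ℂ] V ≃ₗ[ℂ] V :=
  (TensorProduct.congr ULift.moduleEquiv (LinearEquiv.refl ℂ V)).trans (TensorProduct.lid ℂ V)

/-- The canonical isomorphism `V ⊗ ℂ ≃ V`. -/
def ridEquiv (V : Type w) [AddCommGroup V] [Module ℂ V] : V ⊗[ℂ] ULift.{w} ℂ ≃ₗ[ℂ] V :=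
  (TensorProduct.congr (LinearEquiv.refl ℂ V) ULift.moduleEquiv).trans (TensorProduct.rid ℂ V)

@[simp]
theorem lidEquiv_tmul (V : Type w) [AddCommGroup V] [Module ℂ V] (c : ULift.{w} ℂ) (x : V) :
    lidEquiv V (c ⊗ₜ x) = c.down • x := rfl

@[simp]
theorem ridEquiv_tmul (V : Type w) [AddCommGroup V] [Module ℂ V] (c : ULift.{w} ℂ) (x : V) :
    ridEquiv V (x ⊗ₜ c) = c.down • x := rfl

theorem lid_comm {V : Type w} [AddCommGroup V] [Module ℂ V] (δ : V →ₗ[ℂ] V ⊗[ℂ] B) :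
    δ ∘ₗ (lidEquiv V).toLinearMap = (lidEquiv V).toLinearMap.rTensor B ∘ₗ
      tensorCoaction ((TensorProduct.mk ℂ (ULift.{w} ℂ) B).flip 1) δ := by
  refine TensorProduct.ext' fun c m => ?_
  simp only [tensorCoaction, LinearMap.comp_apply, LinearEquiv.coe_coe,
    TensorProduct.map_tmul, lidEquiv_tmul, map_smul, LinearMap.flip_apply, TensorProduct.mk_apply]
  generalize δ m = x
  induction x with
  | zero => simp
  | add x x' hx hy => simp only [TensorProduct.tmul_add, map_add, smul_add, hx, hy]
  | tmul m b => simp [TensorProduct.smul_tmul']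

theorem rid_comm {V : Type w} [AddCommGroup V] [Module ℂ V] (δ : V →ₗ[ℂ] V ⊗[ℂ] B) :
    δ ∘ₗ (ridEquiv V).toLinearMap = (ridEquiv V).toLinearMap.rTensor B ∘ₗ
      tensorCoaction δ ((TensorProduct.mk ℂ (ULift.{w} ℂ) B).flip 1) := by
  refine TensorProduct.ext' fun m c => ?_
  simp only [tensorCoaction, LinearMap.comp_apply, LinearEquiv.coe_coe,
    TensorProduct.map_tmul, ridEquiv_tmul, map_smul, LinearMap.flip_apply, TensorProduct.mk_apply]
  generalize δ m = x
  induction x with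
  | zero => simp
  | add x x' hx hy => simp only [TensorProduct.add_tmul, map_add, smul_add, hx, hy]
  | tmul m b => simp [TensorProduct.smul_tmul']

instance : MonoidalCategoryStruct (ComodCat.{v, w} B) where
  tensorObj := tensor
  whiskerLeft M _ _ f := tensorMap (𝟙 M) f
  whiskerRight f N := tensorMap f (𝟙 N)
  tensorHom f g := tensorMap f g
  tensorUnit := unit B
  associator M N P := mkIso (TensorProduct.assoc ℂ M.carrier N.carrier P.carrier) 
    (assoc_comm M.coact N.coact P.coact)
  leftUnitor M := mkIso (lidEquiv M.carrier) (lid_comm M.coact)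
  rightUnitor M := mkIso (ridEquiv M.carrier) (rid_comm M.coact)

/-- The monoidal category of right comodules over the bialgebra `B`. -/
instance : MonoidalCategory (ComodCat.{v, w} B) :=
  MonoidalCategory.ofTensorHom
    (id_tensorHom_id := fun _ _ => hom_ext TensorProduct.map_id)
    (id_tensorHom := fun _ _ _ _ => rfl)
    (tensorHom_id := fun _ _ => rfl)
    (tensorHom_comp_tensorHom := fun _ _ _ _ => hom_ext (TensorProduct.map_comp _ _ _ _).symm)
    (associator_naturality := fun _ _ _ => hom_ext (TensorProduct.ext_threefold fun _ _ _ => rfl))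
    (leftUnitor_naturality := fun f => hom_ext (TensorProduct.ext' fun c x =>
      (map_smul (Hom.lin f) c.down x).symm))
    (rightUnitor_naturality := fun f => hom_ext (TensorProduct.ext' fun x c =>
      (map_smul (Hom.lin f) c.down x).symm))
    (pentagon := fun _ _ _ _ => hom_ext (TensorProduct.ext_fourfold fun _ _ _ _ => rfl))
    (triangle := fun _ _ => hom_ext (TensorProduct.ext_threefold fun x c y =>
      (TensorProduct.smul_tmul c.down x y).symm))

end ComodCat

end

section

section General

variable {K : Type u} [Ring K] [Bialgebra ℂ K] (R : K ⊗[ℂ] K →ₗ[ℂ] ℂ)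
variable {M N : Type*} [AddCommGroup M] [Module ℂ M] [AddCommGroup N] [Module ℂ N]

/-- The braiding `m ⊗ n ↦ R(m⁽²⁾, n⁽²⁾) n⁽¹⁾ ⊗ m⁽¹⁾` of two `K`-comodules. -/
def braiding (δM : M →ₗ[ℂ] M ⊗[ℂ] K) (δN : N →ₗ[ℂ] N ⊗[ℂ] K) : M ⊗[ℂ] N →ₗ[ℂ] N ⊗[ℂ] M :=
  (TensorProduct.rid ℂ (N ⊗[ℂ] M)).toLinearMap
    ∘ₗ TensorProduct.map (TensorProduct.comm ℂ M N).toLinearMap R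
    ∘ₗ (TensorProduct.tensorTensorTensorComm ℂ M K N K).toLinearMap
    ∘ₗ TensorProduct.map δM δN

/-- The product `(a ⊗ b)(a' ⊗ b') = R(b⁽²⁾, a'⁽²⁾) a a'⁽¹⁾ ⊗ b⁽¹⁾ b'` of the braided tensor product
of two `K`-comodule algebras. -/
def braidedMul {A B : Type*} [Ring A] [Algebra ℂ A] [Ring B] [Algebra ℂ B]
    (δA : A →ₗ[ℂ] A ⊗[ℂ] K) (δB : B →ₗ[ℂ] B ⊗[ℂ] K) :
    (A ⊗[ℂ] B) ⊗[ℂ] (A ⊗[ℂ] B) →ₗ[ℂ] A ⊗[ℂ] B :=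
  TensorProduct.map (LinearMap.mul' ℂ A) (LinearMap.mul' ℂ B)
    ∘ₗ (TensorProduct.assoc ℂ A A (B ⊗[ℂ] B)).symm.toLinearMap
    ∘ₗ ((TensorProduct.assoc ℂ A B B).toLinearMap
        ∘ₗ (braiding R δB δA).rTensor B
        ∘ₗ (TensorProduct.assoc ℂ B A B).symm.toLinearMap).lTensor A
    ∘ₗ (TensorProduct.assoc ℂ A B (A ⊗[ℂ] B)).toLinearMap

theorem braidedMul_tmul {A B : Type*} [Ring A] [Algebra ℂ A] [Ring B] [Algebra ℂ B]
    (δA : A →ₗ[ℂ] A ⊗[ℂ] K) (δB : B →ₗ[ℂ] B ⊗[ℂ] K) {a a' : A} {b b' : B} {h k : K}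
    (ha : δA a' = a' ⊗ₜ h) (hb : δB b = b ⊗ₜ k) :
    braidedMul R δA δB ((a ⊗ₜ b) ⊗ₜ (a' ⊗ₜ b')) = R (k ⊗ₜ h) • ((a * a') ⊗ₜ (b * b')) := by
  simp [braidedMul, braiding, ha, hb, TensorProduct.smul_tmul']

end General

/-- The braided bialgebra underlying a Hopf algebra in the braided monoidal category of comodules
over the coquasitriangular bialgebra `(K, R)`: an algebra and a coalgebra `A` with a `K`-coaction
such that all structure maps are colinear, and such that the coproduct is multiplicative
as a map from `A` to the braided tensor product of `A` with itself. -/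
structure BraidedBialgebra (K : Type u) [Ring K] [Bialgebra ℂ K] (R : K ⊗[ℂ] K →ₗ[ℂ] ℂ) where
  carrier : Type v
  [ring : Ring carrier]
  [algebra : Algebra ℂ carrier]
  [coalgebra : Coalgebra ℂ carrier]
  coact : carrier →ₗ[ℂ] carrier ⊗[ℂ] K
  isCoaction : IsCoaction coact
  coact_one : coact 1 = 1 ⊗ₜ 1
  coact_mul : ∀ x y, coact (x * y) = coact x * coact y
  coact_counit : (TensorProduct.lid ℂ K).toLinearMap
      ∘ₗ (counit : carrier →ₗ[ℂ] ℂ).rTensor K ∘ₗ coact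
    = Algebra.linearMap ℂ K ∘ₗ counit
  coact_comul : tensorCoaction coact coact ∘ₗ comul
    = (comul : carrier →ₗ[ℂ] carrier ⊗[ℂ] carrier).rTensor K ∘ₗ coact
  counit_one : counit (R := ℂ) (1 : carrier) = 1
  counit_mul : ∀ x y : carrier, counit (R := ℂ) (x * y) = counit (R := ℂ) x * counit (R := ℂ) y
  comul_one : comul (R := ℂ) (1 : carrier) = 1 ⊗ₜ 1
  comul_mul : ∀ x y : carrier, comul (R := ℂ) (x * y)
    = braidedMul R coact coact (comul (R := ℂ) x ⊗ₜ comul (R := ℂ) y)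

attribute [instance] BraidedBialgebra.ring BraidedBialgebra.algebra BraidedBialgebra.coalgebra

section Bos

variable {K : Type u} [Ring K] [Bialgebra ℂ K] {R : K ⊗[ℂ] K →ₗ[ℂ] ℂ}

/-- The smash product `K # A = K ⊗_R A`, with `K` coacting on itself by its coproduct. -/
def smashMul (A : BraidedBialgebra.{u, v} K R) :
    (K ⊗[ℂ] A.carrier) ⊗[ℂ] (K ⊗[ℂ] A.carrier) →ₗ[ℂ] K ⊗[ℂ] A.carrier :=
  braidedMul R comul A.coact

/-- The smash coproduct
`h # a ↦ (h₍₁₎ # a₍₁₎⁽¹⁾) ⊗ (h₍₂₎ a₍₁₎⁽²⁾ # a₍₂₎)`. -/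
def smashComul (A : BraidedBialgebra.{u, v} K R) :
    K ⊗[ℂ] A.carrier →ₗ[ℂ] (K ⊗[ℂ] A.carrier) ⊗[ℂ] (K ⊗[ℂ] A.carrier) :=
  ((LinearMap.mul' ℂ K).rTensor A.carrier
      ∘ₗ (TensorProduct.assoc ℂ K K A.carrier).symm.toLinearMap).lTensor (K ⊗[ℂ] A.carrier)
    ∘ₗ (TensorProduct.tensorTensorTensorComm ℂ K K A.carrier (K ⊗[ℂ] A.carrier)).toLinearMap
    ∘ₗ ((TensorProduct.assoc ℂ A.carrier K A.carrier).toLinearMap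
        ∘ₗ A.coact.rTensor A.carrier).lTensor (K ⊗[ℂ] K)
    ∘ₗ TensorProduct.map comul comul

/-- The counit `h # a ↦ ε(h) ε(a)`. -/
def smashCounit (A : BraidedBialgebra.{u, v} K R) : K ⊗[ℂ] A.carrier →ₗ[ℂ] ℂ :=
  LinearMap.mul' ℂ ℂ ∘ₗ TensorProduct.map counit counit

end Bos

/-- The group algebra `ℂΓ` with its usual Hopf algebra structure. -/
abbrev GroupAlg (Γ : Type u) := MonoidAlgebra ℂ Γ

variable {Γ : Type u} [CommGroup Γ]

/-- A group element, viewed in the group algebra. -/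
abbrev el (g : Γ) : GroupAlg Γ := MonoidAlgebra.single g 1

/-- The linear extension of a bicharacter to the group algebra. -/
def bicharForm (β : Γ →* Γ →* Circle) : GroupAlg Γ ⊗[ℂ] GroupAlg Γ →ₗ[ℂ] ℂ :=
  TensorProduct.lift
    ((Finsupp.linearCombination ℂ fun a : Γ =>
      (Finsupp.linearCombination ℂ fun b : Γ => (β a b : ℂ))
        ∘ₗ (MonoidAlgebra.coeffLinearEquiv ℂ).toLinearMap)
      ∘ₗ (MonoidAlgebra.coeffLinearEquiv ℂ).toLinearMap)

@[simp]
theorem bicharForm_el (β : Γ →* Γ →* Circle) (a b : Γ) :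
    bicharForm β (el a ⊗ₜ el b) = (β a b : ℂ) := by
  simp [bicharForm]

theorem el_mul (a b : Γ) : el a * el b = el (a * b) := by
  simp [el]

theorem el_one : el (1 : Γ) = 1 := rfl

theorem groupAlg_induction {P : GroupAlg Γ → Prop} (add : ∀ x y, P x → P y → P (x + y))
    (smul : ∀ (c : ℂ) x, P x → P (c • x)) (el : ∀ g, P (el g)) (x : GroupAlg Γ) : P x := by
  induction x using MonoidAlgebra.induction_linear with
  | zero => simpa using smul 0 _ (el 1)
  | add x y hx hy => exact add x y hx hy
  | single g c => simpa using smul c _ (el g)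

theorem exists_sum {M : Type*} [AddCommGroup M] [Module ℂ M] (z : M ⊗[ℂ] GroupAlg Γ) :
    ∃ f : Γ →₀ M, z = f.sum fun g m => m ⊗ₜ el g := by
  classical
  induction z with
  | zero => exact ⟨0, by simp⟩
  | add x y hx hy =>
    obtain ⟨f, rfl⟩ := hx
    obtain ⟨f', rfl⟩ := hy
    exact ⟨f + f', by rw [Finsupp.sum_add_index'] <;> simp [TensorProduct.add_tmul]⟩
  | tmul m a =>
    induction a using MonoidAlgebra.induction_linear with
    | zero => exact ⟨0, by simp⟩
    | add x y hx hy =>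
      obtain ⟨f, hf⟩ := hx
      obtain ⟨f', hf'⟩ := hy
      exact ⟨f + f', by
        rw [Finsupp.sum_add_index'] <;> simp [TensorProduct.add_tmul, TensorProduct.tmul_add, hf, hf']⟩
    | single g c =>
      refine ⟨Finsupp.single g (c • m), ?_⟩
      rw [Finsupp.sum_single_index (by simp), TensorProduct.smul_tmul]
      simp

/-- The coefficient of `g`. -/
def coeffAt (M : Type*) [AddCommGroup M] [Module ℂ M] (g : Γ) : M ⊗[ℂ] GroupAlg Γ →ₗ[ℂ] M :=
  (TensorProduct.rid ℂ M).toLinearMap ∘ₗ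
    (Finsupp.lapply g ∘ₗ (MonoidAlgebra.coeffLinearEquiv ℂ).toLinearMap).lTensor M

theorem coeffAt_tmul {M : Type*} [AddCommGroup M] [Module ℂ M] [DecidableEq Γ] (g h : Γ) (m : M) :
    coeffAt M g (m ⊗ₜ el h) = if h = g then m else 0 := by
  simp [coeffAt, Finsupp.single_apply]

theorem coeffAt_sum {M : Type*} [AddCommGroup M] [Module ℂ M] (g : Γ) (f : Γ →₀ M) :
    coeffAt M g (f.sum fun g m => m ⊗ₜ el g) = f g := by
  classical
  rw [map_finsuppSum]
  simp only [coeffAt_tmul]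
  rw [Finsupp.sum_ite_eq']
  simp +contextual [eq_comm]

/-- Every comodule over a group algebra is the sum of its homogeneous components. -/
theorem coaction_sum {M : Type*} [AddCommGroup M] [Module ℂ M]
    {δ : M →ₗ[ℂ] M ⊗[ℂ] GroupAlg Γ} (hδ : IsCoaction δ) (m : M) :
    ∃ f : Γ →₀ M, m = (f.sum fun _ x => x) ∧ ∀ g, δ (f g) = f g ⊗ₜ el g := by
  classical
  obtain ⟨f, hf⟩ := exists_sum (δ m)
  refine ⟨f, ?_, fun g => ?_⟩
  · have h := LinearMap.congr_fun hδ.counit m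
    simp only [LinearMap.comp_apply, hf, LinearMap.id_apply, map_finsuppSum] at h
    simpa using h.symm
  · have h := LinearMap.congr_fun hδ.coassoc m
    have h2 := congrArg (fun z => coeffAt (M ⊗[ℂ] GroupAlg Γ) g
      ((TensorProduct.assoc ℂ M (GroupAlg Γ) (GroupAlg Γ)).symm z)) h
    simp only [LinearMap.comp_apply, hf, map_finsuppSum, LinearEquiv.coe_coe,
      LinearEquiv.symm_apply_apply, LinearMap.rTensor_tmul, LinearMap.lTensor_tmul,
      MonoidAlgebra.comul_single, CommSemiring.comul_apply, TensorProduct.map_tmul,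
      TensorProduct.assoc_symm_tmul, coeffAt_tmul, MonoidAlgebra.lsingle_apply] at h2
    rw [Finsupp.sum_ite_eq', Finsupp.sum_ite_eq'] at h2
    by_cases hg : f g = 0
    · simp [hg]
    · simpa [hg] using h2

theorem coaction_induction {M : Type*} [AddCommGroup M] [Module ℂ M]
    {δ : M →ₗ[ℂ] M ⊗[ℂ] GroupAlg Γ} (hδ : IsCoaction δ) {P : M → Prop}
    (add : ∀ x y, P x → P y → P (x + y)) (hom : ∀ g m, δ m = m ⊗ₜ el g → P m) (m : M) : P m := by
  obtain ⟨f, hm, hf⟩ := coaction_sum hδ m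
  rw [hm, Finsupp.sum]
  refine Finset.sum_induction _ P add (hom 1 0 (by simp)) fun g _ => hom g _ (hf g)

end

section

variable {Γ : Type u} [CommGroup Γ]

section Bosonization

variable {β : Γ →* Γ →* Circle} (A : BraidedBialgebra.{u, v} (GroupAlg Γ) (bicharForm β))

/-- The bosonization `ℂΓ # A` of a braided bialgebra over `(ℂΓ, β)`: the vector space `ℂΓ ⊗ A` with
the smash product and the smash coproduct. -/
def Bosonization : Type (max u v) := GroupAlg Γ ⊗[ℂ] A.carrier

namespace Bosonization

instance : AddCommGroup (Bosonization A) :=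
  inferInstanceAs (AddCommGroup (GroupAlg Γ ⊗[ℂ] A.carrier))

instance : Module ℂ (Bosonization A) := inferInstanceAs (Module ℂ (GroupAlg Γ ⊗[ℂ] A.carrier))

variable {A}

theorem smashMul_tmul {a b g : Γ} {x y : A.carrier} (hx : A.coact x = x ⊗ₜ el g) :
    smashMul A ((el a ⊗ₜ x) ⊗ₜ (el b ⊗ₜ y)) = (β g b : ℂ) • (el (a * b) ⊗ₜ (x * y)) := by
  rw [smashMul, braidedMul_tmul (h := el b) (k := el g) _ _ _ (by simp) hx, el_mul, bicharForm_el]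

theorem induction {P : GroupAlg Γ ⊗[ℂ] A.carrier → Prop} (add : ∀ x y, P x → P y → P (x + y))
    (hom : ∀ (a g : Γ) (x : A.carrier), A.coact x = x ⊗ₜ el g → P (el a ⊗ₜ x))
    (z : GroupAlg Γ ⊗[ℂ] A.carrier) : P z := by
  induction z with
  | zero => simpa using hom 1 1 0 (by simp)
  | add x y hx hy => exact add x y hx hy
  | tmul k x =>
    refine coaction_induction A.isCoaction (P := fun x => P (k ⊗ₜ x))
      (fun x y hx hy => ?_) (fun g x hx => ?_) x
    · rw [TensorProduct.tmul_add]; exact add _ _ hx hy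
    · induction k using MonoidAlgebra.induction_linear with
      | zero => simpa using hom 1 1 0 (by simp)
      | add k l hk hl => rw [TensorProduct.add_tmul]; exact add _ _ hk hl
      | single a c =>
        have h : (MonoidAlgebra.single a c : GroupAlg Γ) = c • el a := by simp
        rw [h, TensorProduct.smul_tmul]
        refine hom a g _ ?_
        rw [map_smul, hx, TensorProduct.smul_tmul']

theorem smashMul_assoc (x y z : GroupAlg Γ ⊗[ℂ] A.carrier) :
    smashMul A (smashMul A (x ⊗ₜ y) ⊗ₜ z) = smashMul A (x ⊗ₜ smashMul A (y ⊗ₜ z)) := by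
  induction x using induction with
  | add x x' hx hx' => simp only [TensorProduct.add_tmul, map_add, hx, hx']
  | hom a g x hx =>
  induction y using induction with
  | add y y' hy hy' => simp only [TensorProduct.add_tmul, TensorProduct.tmul_add, map_add, hy, hy']
  | hom b h y hy =>
  induction z using induction with
  | add z z' hz hz' => simp only [TensorProduct.tmul_add, map_add, hz, hz']
  | hom c k z hz =>
  have hxy : A.coact (x * y) = (x * y) ⊗ₜ el (g * h) := by
    rw [A.coact_mul, hx, hy, Algebra.TensorProduct.tmul_mul_tmul, el_mul]
  rw [smashMul_tmul hx, smashMul_tmul hy, ← TensorProduct.smul_tmul', map_smul,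
    TensorProduct.tmul_smul, map_smul, smashMul_tmul hxy, smashMul_tmul hx, smul_smul, smul_smul,
    mul_assoc, mul_assoc]
  congr 1
  simp only [map_mul, MonoidHom.mul_apply, Circle.coe_mul]
  ring

theorem one_smashMul (x : GroupAlg Γ ⊗[ℂ] A.carrier) : smashMul A ((1 ⊗ₜ 1) ⊗ₜ x) = x := by
  induction x using induction with
  | add x y hx hy => simp only [TensorProduct.tmul_add, map_add, hx, hy]
  | hom a g x hx =>
    have h : A.coact 1 = 1 ⊗ₜ el 1 := A.coact_one
    rw [← el_one, smashMul_tmul h]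
    simp

theorem smashMul_one (x : GroupAlg Γ ⊗[ℂ] A.carrier) : smashMul A (x ⊗ₜ (1 ⊗ₜ 1)) = x := by
  induction x using induction with
  | add x y hx hy => simp only [TensorProduct.add_tmul, map_add, hx, hy]
  | hom a g x hx =>
    rw [← el_one, smashMul_tmul hx]
    simp

theorem smul_smashMul (c : ℂ) (x y : GroupAlg Γ ⊗[ℂ] A.carrier) :
    smashMul A ((c • x) ⊗ₜ y) = c • smashMul A (x ⊗ₜ y) := by
  rw [← TensorProduct.smul_tmul', map_smul]

theorem smashMul_smul (c : ℂ) (x y : GroupAlg Γ ⊗[ℂ] A.carrier) :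
    smashMul A (x ⊗ₜ (c • y)) = c • smashMul A (x ⊗ₜ y) := by
  rw [TensorProduct.tmul_smul, map_smul]

variable (A)

instance : Ring (Bosonization A) where
  __ := (inferInstance : AddCommGroup (Bosonization A))
  mul x y := smashMul A (x ⊗ₜ y)
  one := (1 : GroupAlg Γ) ⊗ₜ (1 : A.carrier)
  mul_assoc := smashMul_assoc
  one_mul := one_smashMul
  mul_one := smashMul_one
  zero_mul x := (congrArg (smashMul A) (TensorProduct.zero_tmul _ _)).trans (map_zero _)
  mul_zero x := (congrArg (smashMul A) (TensorProduct.tmul_zero _ _)).trans (map_zero _)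
  left_distrib x y z := (congrArg (smashMul A) (TensorProduct.tmul_add _ _ _)).trans (map_add _ _ _)
  right_distrib x y z :=
    (congrArg (smashMul A) (TensorProduct.add_tmul _ _ _)).trans (map_add _ _ _)

instance : Algebra ℂ (Bosonization A) :=
  Algebra.ofModule smul_smashMul smashMul_smul

variable {A}

/-- `x ⊗ y ↦ (a # x⁽¹⁾) ⊗ (a x⁽²⁾ # y)`. -/
def comulAux (A : BraidedBialgebra.{u, v} (GroupAlg Γ) (bicharForm β)) (a : Γ) :
    A.carrier ⊗[ℂ] A.carrier →ₗ[ℂ]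
      (GroupAlg Γ ⊗[ℂ] A.carrier) ⊗[ℂ] (GroupAlg Γ ⊗[ℂ] A.carrier) :=
  ((LinearMap.mul' ℂ (GroupAlg Γ)).rTensor A.carrier
      ∘ₗ (TensorProduct.assoc ℂ (GroupAlg Γ) (GroupAlg Γ) A.carrier).symm.toLinearMap).lTensor
        (GroupAlg Γ ⊗[ℂ] A.carrier)
    ∘ₗ (TensorProduct.tensorTensorTensorComm ℂ (GroupAlg Γ) (GroupAlg Γ) A.carrier
        (GroupAlg Γ ⊗[ℂ] A.carrier)).toLinearMap
    ∘ₗ ((TensorProduct.assoc ℂ A.carrier (GroupAlg Γ) A.carrier).toLinearMap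
        ∘ₗ A.coact.rTensor A.carrier).lTensor (GroupAlg Γ ⊗[ℂ] GroupAlg Γ)
    ∘ₗ TensorProduct.mk ℂ _ _ (el a ⊗ₜ el a)

theorem smashComul_tmul (a : Γ) (x : A.carrier) :
    smashComul A (el a ⊗ₜ x) = comulAux A a (comul x) := by
  simp [smashComul, comulAux]

theorem comulAux_tmul (a : Γ) {g : Γ} {x y : A.carrier} (hx : A.coact x = x ⊗ₜ el g) :
    comulAux A a (x ⊗ₜ y) = (el a ⊗ₜ x) ⊗ₜ (el (a * g) ⊗ₜ y) := by
  simp [comulAux, hx]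

theorem tensor_induction {P : A.carrier ⊗[ℂ] A.carrier → Prop}
    (add : ∀ x y, P x → P y → P (x + y))
    (hom : ∀ (g h : Γ) (x y : A.carrier), A.coact x = x ⊗ₜ el g → A.coact y = y ⊗ₜ el h →
      P (x ⊗ₜ y)) (z : A.carrier ⊗[ℂ] A.carrier) : P z := by
  induction z with
  | zero => simpa using hom 1 1 0 0 (by simp) (by simp)
  | add x y hx hy => exact add x y hx hy
  | tmul x y =>
    refine coaction_induction A.isCoaction (P := fun x => P (x ⊗ₜ y))
      (fun x x' hx hx' => ?_) (fun g x hx => ?_) x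
    · rw [TensorProduct.add_tmul]; exact add _ _ hx hx'
    · refine coaction_induction A.isCoaction (P := fun y => P (x ⊗ₜ y))
        (fun y y' hy hy' => ?_) (fun h y hy => hom g h x y hx hy) y
      rw [TensorProduct.tmul_add]; exact add _ _ hy hy'

theorem tensorCoaction_tmul {g h : Γ} {x y : A.carrier} (hx : A.coact x = x ⊗ₜ el g)
    (hy : A.coact y = y ⊗ₜ el h) :
    tensorCoaction A.coact A.coact (x ⊗ₜ y) = (x ⊗ₜ y) ⊗ₜ el (g * h) := by
  simp [tensorCoaction, hx, hy]

theorem coact_comul_hom {g : Γ} {x : A.carrier} (hx : A.coact x = x ⊗ₜ el g) :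
    tensorCoaction A.coact A.coact (comul x) = comul x ⊗ₜ el g := by
  have h := LinearMap.congr_fun A.coact_comul x
  simpa [hx] using h

theorem counit_smul_el {g : Γ} {x : A.carrier} (hx : A.coact x = x ⊗ₜ el g) :
    counit (R := ℂ) x • (el g : GroupAlg Γ) = counit (R := ℂ) x • 1 := by
  have h := LinearMap.congr_fun A.coact_counit x
  simp only [LinearMap.comp_apply, hx, LinearMap.rTensor_tmul, LinearEquiv.coe_coe,
    TensorProduct.lid_tmul, Algebra.linearMap_apply, Algebra.algebraMap_eq_smul_one] at h
  exact h

theorem counit_hom {g : Γ} {x : A.carrier} (hx : A.coact x = x ⊗ₜ el g) (b : Γ) :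
    (β g b : ℂ) * counit (R := ℂ) x = counit (R := ℂ) x := by
  have h := congrArg (fun k => bicharForm β (k ⊗ₜ el b)) (counit_smul_el hx)
  simp only [← el_one, ← TensorProduct.smul_tmul', map_smul, bicharForm_el] at h
  simpa [mul_comm] using h

theorem smashCounit_tmul (a : Γ) (x : A.carrier) :
    smashCounit A (el a ⊗ₜ x) = counit (R := ℂ) x := by
  simp [smashCounit]

theorem counit_comulAux (a : Γ) (z : A.carrier ⊗[ℂ] A.carrier) :
    (smashCounit A).rTensor _ (comulAux A a z) =
      (1 : ℂ) ⊗ₜ (el a ⊗ₜ TensorProduct.lid ℂ _ (counit.rTensor A.carrier z)) := by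
  induction z using tensor_induction with
  | add x y hx hy => simp only [map_add, hx, hy, TensorProduct.tmul_add]
  | hom g h x y hx hy =>
    rw [comulAux_tmul a hx, LinearMap.rTensor_tmul, smashCounit_tmul, LinearMap.rTensor_tmul,
      TensorProduct.lid_tmul, ← el_mul]
    have h1 : counit (R := ℂ) x • (el a * el g) = counit (R := ℂ) x • el a := by
      rw [← mul_smul_comm, counit_smul_el hx, mul_smul_comm, mul_one]
    calc counit (R := ℂ) x ⊗ₜ[ℂ] ((el a * el g) ⊗ₜ[ℂ] y)
        = (1 : ℂ) ⊗ₜ[ℂ] ((counit (R := ℂ) x • (el a * el g)) ⊗ₜ[ℂ] y) := by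
          rw [← TensorProduct.smul_tmul', ← TensorProduct.smul_tmul, smul_eq_mul, mul_one]
      _ = _ := by rw [h1, TensorProduct.smul_tmul]

theorem comulAux_counit (a : Γ) (z : A.carrier ⊗[ℂ] A.carrier) :
    (smashCounit A).lTensor _ (comulAux A a z) =
      (el a ⊗ₜ TensorProduct.rid ℂ _ (counit.lTensor A.carrier z)) ⊗ₜ (1 : ℂ) := by
  induction z using tensor_induction with
  | add x y hx hy => simp only [map_add, hx, hy, TensorProduct.tmul_add, TensorProduct.add_tmul]
  | hom g h x y hx hy =>
    rw [comulAux_tmul a hx, LinearMap.lTensor_tmul, smashCounit_tmul, LinearMap.lTensor_tmul,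
      TensorProduct.rid_tmul, TensorProduct.tmul_smul, ← TensorProduct.smul_tmul',
      ← TensorProduct.tmul_smul, smul_eq_mul, mul_one]

/-- The double coproduct evaluated on `(x ⊗ y) ⊗ z`. -/
def comulAux₃ (A : BraidedBialgebra.{u, v} (GroupAlg Γ) (bicharForm β)) (a : Γ) :
    (A.carrier ⊗[ℂ] A.carrier) ⊗[ℂ] A.carrier →ₗ[ℂ]
      ((GroupAlg Γ ⊗[ℂ] A.carrier) ⊗[ℂ] (GroupAlg Γ ⊗[ℂ] A.carrier)) ⊗[ℂ]
        (GroupAlg Γ ⊗[ℂ] A.carrier) :=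
  TensorProduct.map (comulAux A a)
      ((LinearMap.mulLeft ℂ (el a)).rTensor A.carrier)
    ∘ₗ (TensorProduct.assoc ℂ (A.carrier ⊗[ℂ] A.carrier) (GroupAlg Γ) A.carrier).toLinearMap
    ∘ₗ (tensorCoaction A.coact A.coact).rTensor A.carrier

theorem comulAux₃_tmul (a : Γ) {g h : Γ} {x y z : A.carrier} (hx : A.coact x = x ⊗ₜ el g)
    (hy : A.coact y = y ⊗ₜ el h) :
    comulAux₃ A a ((x ⊗ₜ y) ⊗ₜ z) =
      ((el a ⊗ₜ x) ⊗ₜ (el (a * g) ⊗ₜ y)) ⊗ₜ (el (a * g * h) ⊗ₜ z) := by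
  simp [comulAux₃, tensorCoaction_tmul hx hy, comulAux_tmul a hx, mul_assoc]

theorem comulAux₃_left (a : Γ) (z : A.carrier ⊗[ℂ] A.carrier) :
    (smashComul A).rTensor _ (comulAux A a z) = comulAux₃ A a (comul.rTensor A.carrier z) := by
  induction z using tensor_induction with
  | add x y hx hy => simp only [map_add, hx, hy]
  | hom g h x y hx hy =>
    rw [comulAux_tmul a hx, LinearMap.rTensor_tmul, smashComul_tmul, LinearMap.rTensor_tmul]
    simp [comulAux₃, coact_comul_hom hx]

theorem comulAux₃_right (a : Γ) (z : A.carrier ⊗[ℂ] A.carrier) :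
    (smashComul A).lTensor _ (comulAux A a z) =
      TensorProduct.assoc ℂ _ _ _ (comulAux₃ A a
        ((TensorProduct.assoc ℂ _ _ _).symm (comul.lTensor A.carrier z))) := by
  induction z using tensor_induction with
  | add x y hx hy => simp only [map_add, hx, hy]
  | hom g h x y hx hy =>
    rw [comulAux_tmul a hx, LinearMap.lTensor_tmul, smashComul_tmul, LinearMap.lTensor_tmul]
    generalize (comul y : A.carrier ⊗[ℂ] A.carrier) = w
    induction w using tensor_induction with
    | add w w' hw hw' => simp only [TensorProduct.tmul_add, map_add, hw, hw']
    | hom h k y z hy hz =>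
      rw [comulAux_tmul _ hy, TensorProduct.assoc_symm_tmul, comulAux₃_tmul _ hx hy,
        TensorProduct.assoc_tmul]

variable (A)

instance : Coalgebra ℂ (Bosonization A) where
  comul := smashComul A
  counit := smashCounit A
  coassoc := by
    refine LinearMap.ext fun z => ?_
    induction z using induction (A := A) with
    | add x y hx hy => exact (map_add _ _ _).trans ((congrArg₂ _ hx hy).trans (map_add _ _ _).symm)
    | hom a g x hx =>
      change TensorProduct.assoc ℂ _ _ _ ((smashComul A).rTensor _ (smashComul A (el a ⊗ₜ x))) =
        (smashComul A).lTensor _ (smashComul A (el a ⊗ₜ x))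
      rw [smashComul_tmul, comulAux₃_left, comulAux₃_right, ← Coalgebra.coassoc_apply,
        LinearEquiv.symm_apply_apply]
  rTensor_counit_comp_comul := by
    refine LinearMap.ext fun z => ?_
    induction z using induction (A := A) with
    | add x y hx hy => exact (map_add _ _ _).trans ((congrArg₂ _ hx hy).trans (map_add _ _ _).symm)
    | hom a g x hx =>
      change (smashCounit A).rTensor _ (smashComul A (el a ⊗ₜ x)) = (1 : ℂ) ⊗ₜ (el a ⊗ₜ x)
      rw [smashComul_tmul, counit_comulAux]
      simp
  lTensor_counit_comp_comul := by
    refine LinearMap.ext fun z => ?_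
    induction z using induction (A := A) with
    | add x y hx hy => exact (map_add _ _ _).trans ((congrArg₂ _ hx hy).trans (map_add _ _ _).symm)
    | hom a g x hx =>
      change (smashCounit A).lTensor _ (smashComul A (el a ⊗ₜ x)) = (el a ⊗ₜ x) ⊗ₜ (1 : ℂ)
      rw [smashComul_tmul, comulAux_counit]
      simp

/-- The factor `β(|x| |y|, b)` on `x ⊗ y`. -/
def twist (A : BraidedBialgebra.{u, v} (GroupAlg Γ) (bicharForm β)) (b : Γ) :
    A.carrier ⊗[ℂ] A.carrier →ₗ[ℂ] A.carrier ⊗[ℂ] A.carrier :=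
  (TensorProduct.rid ℂ _).toLinearMap
    ∘ₗ (bicharForm β ∘ₗ (TensorProduct.mk ℂ _ _).flip (el b)).lTensor _
    ∘ₗ tensorCoaction A.coact A.coact

variable {A}

theorem twist_tmul (b : Γ) {g h : Γ} {x y : A.carrier} (hx : A.coact x = x ⊗ₜ el g)
    (hy : A.coact y = y ⊗ₜ el h) :
    twist A b (x ⊗ₜ y) = (β (g * h) b : ℂ) • (x ⊗ₜ y) := by
  rw [twist, LinearMap.comp_apply, LinearMap.comp_apply, tensorCoaction_tmul hx hy,
    LinearMap.lTensor_tmul]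
  simp only [LinearMap.comp_apply, LinearMap.flip_apply, TensorProduct.mk_apply, bicharForm_el,
    LinearEquiv.coe_coe, TensorProduct.rid_tmul]

theorem twist_comul (b : Γ) {g : Γ} {x : A.carrier} (hx : A.coact x = x ⊗ₜ el g) :
    twist A b (comul x) = (β g b : ℂ) • comul x := by
  rw [twist, LinearMap.comp_apply, LinearMap.comp_apply, coact_comul_hom hx,
    LinearMap.lTensor_tmul]
  simp only [LinearMap.comp_apply, LinearMap.flip_apply, TensorProduct.mk_apply, bicharForm_el,
    LinearEquiv.coe_coe, TensorProduct.rid_tmul]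

theorem mul_def (x y : Bosonization A) : x * y = smashMul A (x ⊗ₜ y) := rfl

/-- The componentwise product on `(ℂΓ # A) ⊗ (ℂΓ # A)`. -/
def mulTwo (A : BraidedBialgebra.{u, v} (GroupAlg Γ) (bicharForm β)) :
    ((GroupAlg Γ ⊗[ℂ] A.carrier) ⊗[ℂ] (GroupAlg Γ ⊗[ℂ] A.carrier)) ⊗[ℂ]
      ((GroupAlg Γ ⊗[ℂ] A.carrier) ⊗[ℂ] (GroupAlg Γ ⊗[ℂ] A.carrier)) →ₗ[ℂ]
      (GroupAlg Γ ⊗[ℂ] A.carrier) ⊗[ℂ] (GroupAlg Γ ⊗[ℂ] A.carrier) :=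
  TensorProduct.map (smashMul A) (smashMul A)
    ∘ₗ (TensorProduct.tensorTensorTensorComm ℂ _ _ _ _).toLinearMap

theorem mulTwo_eq (z z' : Bosonization A ⊗[ℂ] Bosonization A) :
    z * z' = mulTwo A (z ⊗ₜ z') := by
  induction z with
  | zero =>
    rw [zero_mul]
    exact ((congrArg (mulTwo A) (TensorProduct.zero_tmul _ _)).trans (map_zero _)).symm
  | add x y hx hy =>
    rw [add_mul, hx, hy]
    exact ((congrArg (mulTwo A) (TensorProduct.add_tmul _ _ _)).trans (map_add _ _ _)).symm
  | tmul x y =>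
    induction z' with
    | zero =>
      rw [mul_zero]
      exact ((congrArg (mulTwo A) (TensorProduct.tmul_zero _ _)).trans (map_zero _)).symm
    | add x y hx hy =>
      rw [mul_add, hx, hy]
      exact ((congrArg (mulTwo A) (TensorProduct.tmul_add _ _ _)).trans (map_add _ _ _)).symm
    | tmul x' y' =>
      rw [Algebra.TensorProduct.tmul_mul_tmul]
      exact (TensorProduct.map_tmul (smashMul A) (smashMul A) (x ⊗ₜ[ℂ] x' : (GroupAlg Γ ⊗[ℂ] A.carrier) ⊗[ℂ] (GroupAlg Γ ⊗[ℂ] A.carrier)) (y ⊗ₜ[ℂ] y' : (GroupAlg Γ ⊗[ℂ] A.carrier) ⊗[ℂ] (GroupAlg Γ ⊗[ℂ] A.carrier))).symm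

theorem mulTwo_comulAux (a b : Γ) (z w : A.carrier ⊗[ℂ] A.carrier) :
    mulTwo A (comulAux A a z ⊗ₜ comulAux A b w) =
      comulAux A (a * b) (braidedMul (bicharForm β) A.coact A.coact (twist A b z ⊗ₜ w)) := by
  induction z using tensor_induction with
  | add x y hx hy => simp only [map_add, hx, hy, TensorProduct.add_tmul]
  | hom g h x y hx hy =>
  induction w using tensor_induction with
  | add x y hx hy => simp only [map_add, hx, hy, TensorProduct.tmul_add]
  | hom g' h' x' y' hx' hy' =>
  have hxx : A.coact (x * x') = (x * x') ⊗ₜ el (g * g') := by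
    rw [A.coact_mul, hx, hx', Algebra.TensorProduct.tmul_mul_tmul, el_mul]
  rw [comulAux_tmul a hx, comulAux_tmul b hx', twist_tmul b hx hy, ← TensorProduct.smul_tmul',
    map_smul, braidedMul_tmul _ _ _ hx' hy, bicharForm_el, map_smul, map_smul,
    comulAux_tmul _ hxx, mulTwo, LinearMap.comp_apply, LinearEquiv.coe_coe,
    TensorProduct.tensorTensorTensorComm_tmul, TensorProduct.map_tmul, smashMul_tmul hx,
    smashMul_tmul hy, ← TensorProduct.smul_tmul', TensorProduct.tmul_smul, smul_smul, smul_smul,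
    mul_mul_mul_comm a g b g']
  congr 1
  simp only [map_mul, MonoidHom.mul_apply, Circle.coe_mul]
  ring

theorem comul_mul' (x y : GroupAlg Γ ⊗[ℂ] A.carrier) :
    smashComul A (smashMul A (x ⊗ₜ y)) = mulTwo A (smashComul A x ⊗ₜ smashComul A y) := by
  induction x using induction with
  | add x x' hx hx' => simp only [TensorProduct.add_tmul, map_add, hx, hx']
  | hom a g x hx =>
  induction y using induction with
  | add y y' hy hy' => simp only [TensorProduct.tmul_add, map_add, hy, hy']
  | hom b h y hy =>
  rw [smashMul_tmul hx, map_smul, smashComul_tmul, smashComul_tmul, smashComul_tmul,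
    mulTwo_comulAux, A.comul_mul, twist_comul b hx, ← TensorProduct.smul_tmul', map_smul, map_smul]

theorem counit_mul' (x y : GroupAlg Γ ⊗[ℂ] A.carrier) :
    smashCounit A (smashMul A (x ⊗ₜ y)) = smashCounit A x * smashCounit A y := by
  induction x using induction with
  | add x x' hx hx' => simp only [TensorProduct.add_tmul, map_add, hx, hx', add_mul]
  | hom a g x hx =>
  induction y using induction with
  | add y y' hy hy' => simp only [TensorProduct.tmul_add, map_add, hy, hy', mul_add]
  | hom b h y hy =>
  rw [smashMul_tmul hx, map_smul, smashCounit_tmul, smashCounit_tmul, smashCounit_tmul,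
    A.counit_mul, smul_eq_mul, ← mul_assoc, counit_hom hx]

variable (A)

instance : Bialgebra ℂ (Bosonization A) :=
  Bialgebra.mk' ℂ (Bosonization A)
    (by
      change smashCounit A (el 1 ⊗ₜ 1) = 1
      rw [smashCounit_tmul, A.counit_one])
    (fun {x y} => counit_mul' x y)
    (by
      change smashComul A (el 1 ⊗ₜ 1) = (el 1 ⊗ₜ 1) ⊗ₜ (el 1 ⊗ₜ 1)
      have h : A.coact 1 = 1 ⊗ₜ el 1 := A.coact_one
      rw [smashComul_tmul, A.comul_one, comulAux_tmul 1 h, mul_one])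
    (fun {x y} => (comul_mul' x y).trans (mulTwo_eq _ _).symm)

end Bosonization

end Bosonization

end

section

section Adjoint

variable {H : Type v} [Ring H] [HopfAlgebra ℂ H]

/-- The iterated coproduct `x ↦ x₍₁₎ ⊗ (x₍₂₎ ⊗ x₍₃₎)`. -/
def comul₃ (H : Type v) [Ring H] [HopfAlgebra ℂ H] : H →ₗ[ℂ] H ⊗[ℂ] (H ⊗[ℂ] H) :=
  (comul : H →ₗ[ℂ] H ⊗[ℂ] H).lTensor H ∘ₗ comul

/-- The adjoint coaction `ad(x) = x₍₂₎ ⊗ S(x₍₁₎) x₍₃₎`. -/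
def ad (H : Type v) [Ring H] [HopfAlgebra ℂ H] : H →ₗ[ℂ] H ⊗[ℂ] H :=
  (LinearMap.mul' ℂ H ∘ₗ (HopfAlgebra.antipode ℂ).rTensor H).lTensor H
    ∘ₗ (TensorProduct.leftComm ℂ H H H).toLinearMap
    ∘ₗ comul₃ H

variable {K : Type u} [Ring K] [HopfAlgebra ℂ K]

/-- The adjoint coaction restricted along a Hopf algebra map `f`, that is `(ι ⊗ f) ad`. -/
def adOf (f : H →ₐc[ℂ] K) : H →ₗ[ℂ] H ⊗[ℂ] K :=
  (f : H →ₗ[ℂ] K).lTensor H ∘ₗ ad H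

/-- The transmuted product
`x ·_R y = R(π(x₍₁₎), π(y₍₂₎)) R(π(x₍₃₎), S(π(y₍₁₎))) x₍₂₎ y₍₃₎`. -/
def transmMul (R : K ⊗[ℂ] K →ₗ[ℂ] ℂ) (π : H →ₐc[ℂ] K) : H ⊗[ℂ] H →ₗ[ℂ] H :=
  (TensorProduct.lid ℂ H).toLinearMap
    ∘ₗ (TensorProduct.rid ℂ H).toLinearMap.lTensor ℂ
    ∘ₗ TensorProduct.map R
      (TensorProduct.map (LinearMap.mul' ℂ H) (R ∘ₗ (HopfAlgebra.antipode ℂ).lTensor K))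
    ∘ₗ (TensorProduct.tensorTensorTensorComm ℂ H K H K).toLinearMap.lTensor (K ⊗[ℂ] K)
    ∘ₗ (TensorProduct.tensorTensorTensorComm ℂ K (H ⊗[ℂ] K) K (H ⊗[ℂ] K)).toLinearMap
    ∘ₗ TensorProduct.map
      (TensorProduct.map (π : H →ₗ[ℂ] K) ((π : H →ₗ[ℂ] K).lTensor H) ∘ₗ comul₃ H)
      ((TensorProduct.comm ℂ K H).toLinearMap.lTensor K
        ∘ₗ (TensorProduct.leftComm ℂ K K H).toLinearMap
        ∘ₗ TensorProduct.map (π : H →ₗ[ℂ] K) ((π : H →ₗ[ℂ] K).rTensor H) ∘ₗ comul₃ H)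

end Adjoint

variable {Γ : Type u} [CommGroup Γ] {H : Type v} [Ring H] [HopfAlgebra ℂ H]
  (π : H →ₐc[ℂ] GroupAlg Γ)

/-- The right coaction `(ι ⊗ π) Δ`. -/
def coactR : H →ₗ[ℂ] H ⊗[ℂ] GroupAlg Γ := (π : H →ₗ[ℂ] GroupAlg Γ).lTensor H ∘ₗ comul

/-- The left coaction `(π ⊗ ι) Δ`, with its two legs exchanged. -/
def coactL : H →ₗ[ℂ] H ⊗[ℂ] GroupAlg Γ :=
  (TensorProduct.comm ℂ (GroupAlg Γ) H).toLinearMap ∘ₗ (π : H →ₗ[ℂ] GroupAlg Γ).rTensor H ∘ₗ comul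

/-- `x` lies in the homogeneous component `H_{a,b}`: `(π ⊗ ι) Δ(x) = a ⊗ x` and
`(ι ⊗ π) Δ(x) = x ⊗ b`. -/
def IsBihom (a b : Γ) (x : H) : Prop :=
  (π : H →ₗ[ℂ] GroupAlg Γ).rTensor H (comul x) = el a ⊗ₜ x ∧
    (π : H →ₗ[ℂ] GroupAlg Γ).lTensor H (comul x) = x ⊗ₜ el b

theorem map_comul (x : H) : comul (R := ℂ) (π x) =
    TensorProduct.map (π : H →ₗ[ℂ] GroupAlg Γ) (π : H →ₗ[ℂ] GroupAlg Γ) (comul x) :=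
  (CoalgHomClass.map_comp_comul_apply π x).symm

theorem coactR_isCoaction : IsCoaction (coactR π) where
  coassoc := by
    have key1 : ∀ z : H ⊗[ℂ] H, TensorProduct.assoc ℂ H (GroupAlg Γ) (GroupAlg Γ)
        ((coactR π).rTensor _ ((π : H →ₗ[ℂ] GroupAlg Γ).lTensor H z)) =
        (TensorProduct.map (π : H →ₗ[ℂ] GroupAlg Γ) (π : H →ₗ[ℂ] GroupAlg Γ)).lTensor H
          (TensorProduct.assoc ℂ H H H (comul.rTensor H z)) := by
      intro z
      induction z with
      | zero => simp
      | add x y hx hy => simp only [map_add, hx, hy]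
      | tmul u v =>
        simp only [coactR, LinearMap.lTensor_tmul, LinearMap.rTensor_tmul, LinearMap.comp_apply]
        generalize (comul u : H ⊗[ℂ] H) = w
        induction w with
        | zero => simp
        | add x y hx hy => simp only [map_add, hx, hy, TensorProduct.add_tmul]
        | tmul a b => simp
    have key2 : ∀ z : H ⊗[ℂ] H, comul.lTensor H ((π : H →ₗ[ℂ] GroupAlg Γ).lTensor H z) =
        (TensorProduct.map (π : H →ₗ[ℂ] GroupAlg Γ) (π : H →ₗ[ℂ] GroupAlg Γ)).lTensor H
          (comul.lTensor H z) := by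
      intro z
      induction z with
      | zero => simp
      | add x y hx hy => simp only [map_add, hx, hy]
      | tmul u v => simp
    ext x
    change TensorProduct.assoc ℂ H (GroupAlg Γ) (GroupAlg Γ)
        ((coactR π).rTensor _ ((π : H →ₗ[ℂ] GroupAlg Γ).lTensor H (comul x))) =
      comul.lTensor H ((π : H →ₗ[ℂ] GroupAlg Γ).lTensor H (comul x))
    rw [key1, key2, Coalgebra.coassoc_apply]
  counit := by
    have key : ∀ z : H ⊗[ℂ] H, (counit : GroupAlg Γ →ₗ[ℂ] ℂ).lTensor H
        ((π : H →ₗ[ℂ] GroupAlg Γ).lTensor H z) = counit.lTensor H z := by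
      intro z
      induction z with
      | zero => simp
      | add x y hx hy => simp only [map_add, hx, hy]
      | tmul u v => simp
    ext x
    change TensorProduct.rid ℂ H ((counit : GroupAlg Γ →ₗ[ℂ] ℂ).lTensor H
        ((π : H →ₗ[ℂ] GroupAlg Γ).lTensor H (comul x))) = x
    rw [key]
    simp

theorem groupAlg_cocomm (k : GroupAlg Γ) :
    TensorProduct.comm ℂ _ _ (comul (R := ℂ) k) = comul k := by
  induction k using groupAlg_induction with
  | add x y hx hy => simp only [map_add, hx, hy]
  | smul c x hx => simp only [map_smul, hx]
  | el g => simp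

theorem coactL_isCoaction : IsCoaction (coactL π) where
  coassoc := by
    have key1 : ∀ z : H ⊗[ℂ] H, TensorProduct.assoc ℂ H (GroupAlg Γ) (GroupAlg Γ)
        ((coactL π).rTensor _ (TensorProduct.comm ℂ _ _
          ((π : H →ₗ[ℂ] GroupAlg Γ).rTensor H z))) =
        TensorProduct.comm ℂ _ _ ((TensorProduct.comm ℂ _ _).toLinearMap.rTensor H
        ((TensorProduct.map (π : H →ₗ[ℂ] GroupAlg Γ) (π : H →ₗ[ℂ] GroupAlg Γ)).rTensor H
          ((TensorProduct.assoc ℂ H H H).symm (comul.lTensor H z)))) := by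
      intro z
      induction z with
      | zero => simp
      | add x y hx hy => simp only [map_add, hx, hy]
      | tmul u v =>
        simp only [coactL, LinearMap.lTensor_tmul, LinearMap.rTensor_tmul, LinearMap.comp_apply,
          TensorProduct.comm_tmul]
        generalize (comul v : H ⊗[ℂ] H) = w
        induction w with
        | zero => simp
        | add x y hx hy => simp only [map_add, hx, hy, TensorProduct.add_tmul, TensorProduct.tmul_add]
        | tmul a b => simp
    have key2 : ∀ z : H ⊗[ℂ] H, comul.lTensor H (TensorProduct.comm ℂ _ _
          ((π : H →ₗ[ℂ] GroupAlg Γ).rTensor H z)) =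
        TensorProduct.comm ℂ _ _ ((TensorProduct.comm ℂ _ _).toLinearMap.rTensor H
        ((TensorProduct.map (π : H →ₗ[ℂ] GroupAlg Γ) (π : H →ₗ[ℂ] GroupAlg Γ)).rTensor H
          (comul.rTensor H z))) := by
      intro z
      induction z with
      | zero => simp
      | add x y hx hy => simp only [map_add, hx, hy]
      | tmul u v => simp [groupAlg_cocomm]
    ext x
    change TensorProduct.assoc ℂ H (GroupAlg Γ) (GroupAlg Γ)
        ((coactL π).rTensor _ (TensorProduct.comm ℂ _ _
          ((π : H →ₗ[ℂ] GroupAlg Γ).rTensor H (comul x)))) =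
      comul.lTensor H (TensorProduct.comm ℂ _ _ ((π : H →ₗ[ℂ] GroupAlg Γ).rTensor H (comul x)))
    have h := Coalgebra.coassoc_apply (R := ℂ) x
    rw [key1, key2, ← h, LinearEquiv.symm_apply_apply]
  counit := by
    have key : ∀ z : H ⊗[ℂ] H, TensorProduct.rid ℂ H ((counit : GroupAlg Γ →ₗ[ℂ] ℂ).lTensor H
        (TensorProduct.comm ℂ _ _ ((π : H →ₗ[ℂ] GroupAlg Γ).rTensor H z))) =
          TensorProduct.lid ℂ H (counit.rTensor H z) := by
      intro z
      induction z with
      | zero => simp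
      | add x y hx hy => simp only [map_add, hx, hy]
      | tmul u v => simp
    ext x
    change TensorProduct.rid ℂ H ((counit : GroupAlg Γ →ₗ[ℂ] ℂ).lTensor H
        (TensorProduct.comm ℂ _ _ ((π : H →ₗ[ℂ] GroupAlg Γ).rTensor H (comul x)))) = x
    rw [key]
    simp

variable {π}

theorem isBihom_iff {a b : Γ} {x : H} :
    IsBihom π a b x ↔ coactL π x = x ⊗ₜ el a ∧ coactR π x = x ⊗ₜ el b := by
  unfold IsBihom coactL coactR
  simp only [LinearMap.comp_apply, LinearEquiv.coe_coe]
  rw [← (TensorProduct.comm ℂ (GroupAlg Γ) H).injective.eq_iff, TensorProduct.comm_tmul]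

theorem coactR_coeffAt (a : Γ) (x : H) :
    coactR π (coeffAt H a (coactL π x)) =
      (coeffAt H a ∘ₗ coactL π).rTensor (GroupAlg Γ) (coactR π x) := by
  have key1 : ∀ z : H ⊗[ℂ] H, coactR π (coeffAt H a (TensorProduct.comm ℂ _ _
          ((π : H →ₗ[ℂ] GroupAlg Γ).rTensor H z))) =
      (coeffAt H a).rTensor (GroupAlg Γ) ((TensorProduct.comm ℂ _ _).toLinearMap.rTensor _
        ((TensorProduct.assoc ℂ _ _ _).symm
        ((TensorProduct.map (π : H →ₗ[ℂ] GroupAlg Γ) ((π : H →ₗ[ℂ] GroupAlg Γ).lTensor H))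
          (comul.lTensor H z)))) := by
    intro z
    induction z with
    | zero => simp
    | add x y hx hy => simp only [map_add, hx, hy]
    | tmul u v =>
      simp only [coeffAt, LinearMap.rTensor_tmul, LinearMap.lTensor_tmul, LinearMap.comp_apply,
        TensorProduct.comm_tmul, TensorProduct.rid_tmul, LinearEquiv.coe_coe, map_smul, coactR]
      generalize (comul v : H ⊗[ℂ] H) = w
      induction w with
      | zero => simp
      | add x y hx hy => simp only [map_add, hx, hy, TensorProduct.tmul_add, smul_add]
      | tmul a b => simp [TensorProduct.smul_tmul']
  have key2 : ∀ z : H ⊗[ℂ] H, (coeffAt H a ∘ₗ coactL π).rTensor (GroupAlg Γ)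
        ((π : H →ₗ[ℂ] GroupAlg Γ).lTensor H z) =
      (coeffAt H a).rTensor (GroupAlg Γ) ((TensorProduct.comm ℂ _ _).toLinearMap.rTensor _
        ((TensorProduct.assoc ℂ _ _ _).symm
        ((TensorProduct.map (π : H →ₗ[ℂ] GroupAlg Γ) ((π : H →ₗ[ℂ] GroupAlg Γ).lTensor H))
          (TensorProduct.assoc ℂ _ _ _ (comul.rTensor H z))))) := by
    intro z
    induction z with
    | zero => simp
    | add x y hx hy => simp only [map_add, hx, hy]
    | tmul u v =>
      simp only [LinearMap.rTensor_tmul, LinearMap.lTensor_tmul, LinearMap.comp_apply,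
        LinearEquiv.coe_coe, coactL]
      generalize (comul u : H ⊗[ℂ] H) = w
      induction w with
      | zero => simp
      | add x y hx hy => simp only [map_add, hx, hy, TensorProduct.add_tmul]
      | tmul a b => simp
  have h1 := key1 (comul x)
  have h2 := key2 (comul x)
  rw [Coalgebra.coassoc_apply, ← h1] at h2
  exact h2.symm

/-- `H` is the sum of its homogeneous components `H_{a,b}`. -/
theorem bihom_induction {P : H → Prop} (add : ∀ x y, P x → P y → P (x + y))
    (hom : ∀ a b x, IsBihom π a b x → P x) (x : H) : P x := by
  refine coaction_induction (coactR_isCoaction π) add (fun b x hx => ?_) x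
  obtain ⟨f, hm, hf⟩ := coaction_sum (coactL_isCoaction π) x
  have hf2 : ∀ a, coactR π (f a) = f a ⊗ₜ el b := by
    intro a
    have h1 : coactL π x = f.sum fun g m => m ⊗ₜ el g := by
      conv_lhs => rw [hm]
      rw [map_finsuppSum]
      exact Finsupp.sum_congr fun g _ => hf g
    have h2 : f a = coeffAt H a (coactL π x) := by rw [h1, coeffAt_sum]
    rw [h2, coactR_coeffAt, hx, LinearMap.rTensor_tmul]
    rfl
  rw [hm, Finsupp.sum]
  refine Finset.sum_induction _ P add (hom 1 1 0 ?_) fun g _ => hom g b _ ?_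
  · simp [IsBihom]
  · exact isBihom_iff.2 ⟨hf g, hf2 g⟩

end

section

variable {Γ : Type u} [CommGroup Γ] {H : Type v} [Ring H] [HopfAlgebra ℂ H]
  {π : H →ₐc[ℂ] GroupAlg Γ}

/-- A bialgebra map between Hopf algebras preserves the antipode. -/
theorem map_antipode (f : H →ₐc[ℂ] GroupAlg Γ) (x : H) :
    f (HopfAlgebra.antipode ℂ x) = HopfAlgebra.antipode ℂ (f x) := by
  have h1 : WithConv.toConv ((f : H →ₗ[ℂ] GroupAlg Γ) ∘ₗ HopfAlgebra.antipode ℂ) *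
      WithConv.toConv (f : H →ₗ[ℂ] GroupAlg Γ) = 1 := by
    refine WithConv.ext (LinearMap.ext fun y => ?_)
    have h := congrArg f (HopfAlgebra.sum_antipode_mul_eq_algebraMap_counit (ℛ ℂ y))
    change (_ * _ : WithConv (H →ₗ[ℂ] GroupAlg Γ)) y = _
    rw [(ℛ ℂ y).convMul_apply]
    rw [show f (algebraMap ℂ H (counit (R := ℂ) y)) = algebraMap ℂ _ (counit (R := ℂ) y) from
      AlgHomClass.commutes f _] at h
    simpa [map_sum] using h
  have h2 : WithConv.toConv (f : H →ₗ[ℂ] GroupAlg Γ) *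
      WithConv.toConv (HopfAlgebra.antipode ℂ ∘ₗ (f : H →ₗ[ℂ] GroupAlg Γ)) = 1 := by
    refine WithConv.ext (LinearMap.ext fun y => ?_)
    have h := LinearMap.congr_fun (HopfAlgebra.mul_antipode_lTensor_comul
      (R := ℂ) (A := GroupAlg Γ)) (f y)
    change (_ * _ : WithConv (H →ₗ[ℂ] GroupAlg Γ)) y = _
    rw [(ℛ ℂ y).convMul_apply]
    simp only [LinearMap.comp_apply, map_comul, ← (ℛ ℂ y).eq, map_sum] at h
    simpa using h
  have h := left_inv_eq_right_inv h1 h2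
  exact LinearMap.congr_fun (congrArg WithConv.ofConv h) x

theorem comul₃_left {a b : Γ} {x : H} (hx : IsBihom π a b x) :
    TensorProduct.map (π : H →ₗ[ℂ] GroupAlg Γ) ((π : H →ₗ[ℂ] GroupAlg Γ).lTensor H) (comul₃ H x) =
      el a ⊗ₜ (x ⊗ₜ el b) := by
  have key : ∀ z : H ⊗[ℂ] H, TensorProduct.map (π : H →ₗ[ℂ] GroupAlg Γ)
      ((π : H →ₗ[ℂ] GroupAlg Γ).lTensor H) (comul.lTensor H z) =
      (((π : H →ₗ[ℂ] GroupAlg Γ).lTensor H) ∘ₗ comul).lTensor _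
        ((π : H →ₗ[ℂ] GroupAlg Γ).rTensor H z) := by
    intro z
    induction z with
    | zero => simp
    | add x y hx hy => simp only [map_add, hx, hy]
    | tmul u v => simp
  rw [comul₃, LinearMap.comp_apply, key, hx.1, LinearMap.lTensor_tmul, LinearMap.comp_apply, hx.2]

theorem comul₃_right {a b : Γ} {x : H} (hx : IsBihom π a b x) :
    TensorProduct.map (π : H →ₗ[ℂ] GroupAlg Γ) ((π : H →ₗ[ℂ] GroupAlg Γ).rTensor H) (comul₃ H x) =
      el a ⊗ₜ (el a ⊗ₜ x) := by
  have key : ∀ z : H ⊗[ℂ] H, TensorProduct.map (π : H →ₗ[ℂ] GroupAlg Γ)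
      ((π : H →ₗ[ℂ] GroupAlg Γ).rTensor H) (comul.lTensor H z) =
      (((π : H →ₗ[ℂ] GroupAlg Γ).rTensor H) ∘ₗ comul).lTensor _
        ((π : H →ₗ[ℂ] GroupAlg Γ).rTensor H z) := by
    intro z
    induction z with
    | zero => simp
    | add x y hx hy => simp only [map_add, hx, hy]
    | tmul u v => simp
  rw [comul₃, LinearMap.comp_apply, key, hx.1, LinearMap.lTensor_tmul, LinearMap.comp_apply, hx.1]

/-- On `H_{a,b}` the restricted adjoint coaction is `x ↦ x ⊗ a⁻¹ b`. -/
theorem adOf_bihom {a b : Γ} {x : H} (hx : IsBihom π a b x) :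
    adOf π x = x ⊗ₜ el (a⁻¹ * b) := by
  have key : ∀ z : H ⊗[ℂ] (H ⊗[ℂ] H), (π : H →ₗ[ℂ] GroupAlg Γ).lTensor H
      ((LinearMap.mul' ℂ H ∘ₗ (HopfAlgebra.antipode ℂ).rTensor H).lTensor H
        (TensorProduct.leftComm ℂ H H H z)) =
      (LinearMap.mul' ℂ _ ∘ₗ (HopfAlgebra.antipode ℂ).rTensor _).lTensor H
        (TensorProduct.leftComm ℂ (GroupAlg Γ) H (GroupAlg Γ) (TensorProduct.map
          (π : H →ₗ[ℂ] GroupAlg Γ) ((π : H →ₗ[ℂ] GroupAlg Γ).lTensor H) z)) := by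
    intro z
    induction z with
    | zero => simp
    | add x y hx hy => simp only [map_add, hx, hy]
    | tmul u w =>
      induction w with
      | zero => simp
      | add x y hx hy => simp only [map_add, hx, hy, TensorProduct.tmul_add]
      | tmul v w => simp [map_antipode]
  have h := key (comul₃ H x)
  rw [comul₃_left hx] at h
  refine Eq.trans h ?_
  simp

/-- The transmuted product on homogeneous elements:
`x ·_β y = β(a⁻¹ b, c⁻¹) x y` for `x ∈ H_{a,b}` and `y ∈ H_{c,d}`. -/
theorem transmMul_bihom (β : Γ →* Γ →* Circle) {a b c d : Γ} {x y : H} (hx : IsBihom π a b x)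
    (hy : IsBihom π c d y) :
    transmMul (bicharForm β) π (x ⊗ₜ y) = (β (a⁻¹ * b) c⁻¹ : ℂ) • (x * y) := by
  simp only [transmMul, LinearMap.comp_apply, TensorProduct.map_tmul, comul₃_left hx,
    comul₃_right hy, LinearEquiv.coe_coe, TensorProduct.leftComm_tmul, LinearMap.lTensor_tmul,
    TensorProduct.comm_tmul, TensorProduct.tensorTensorTensorComm_tmul, LinearMap.mul'_apply,
    MonoidAlgebra.antipode_single, bicharForm_el, TensorProduct.rid_tmul,
    TensorProduct.lid_tmul, smul_smul, CommSemiring.antipode_eq_id, LinearMap.id_apply]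
  congr 1
  rw [← Circle.coe_mul]
  congr 1
  simp only [map_mul, map_inv, MonoidHom.mul_apply, MonoidHom.inv_apply, mul_inv, inv_inv]
  rfl

theorem IsBihom.smul {a b : Γ} {x : H} (hx : IsBihom π a b x) (c : ℂ) : IsBihom π a b (c • x) := by
  constructor
  · rw [map_smul, map_smul, hx.1, TensorProduct.tmul_smul]
  · rw [map_smul, map_smul, hx.2, TensorProduct.smul_tmul']

theorem isBihom_one : IsBihom π 1 1 (1 : H) := by
  constructor <;> simp [Algebra.TensorProduct.one_def, el_one]

theorem IsBihom.mul {a b c d : Γ} {x y : H} (hx : IsBihom π a b x) (hy : IsBihom π c d y) :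
    IsBihom π (a * c) (b * d) (x * y) := by
  have h1 : ∀ z w : H ⊗[ℂ] H, (π : H →ₗ[ℂ] GroupAlg Γ).rTensor H (z * w) =
      (π : H →ₗ[ℂ] GroupAlg Γ).rTensor H z * (π : H →ₗ[ℂ] GroupAlg Γ).rTensor H w :=
    fun z w => map_mul (Algebra.TensorProduct.map (π : H →ₐ[ℂ] GroupAlg Γ) (AlgHom.id ℂ H)) z w
  have h2 : ∀ z w : H ⊗[ℂ] H, (π : H →ₗ[ℂ] GroupAlg Γ).lTensor H (z * w) =
      (π : H →ₗ[ℂ] GroupAlg Γ).lTensor H z * (π : H →ₗ[ℂ] GroupAlg Γ).lTensor H w :=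
    fun z w => map_mul (Algebra.TensorProduct.map (AlgHom.id ℂ H) (π : H →ₐ[ℂ] GroupAlg Γ)) z w
  constructor
  · rw [Bialgebra.comul_mul, h1, hx.1, hy.1, Algebra.TensorProduct.tmul_mul_tmul, el_mul]
  · rw [Bialgebra.comul_mul, h2, hx.2, hy.2, Algebra.TensorProduct.tmul_mul_tmul, el_mul]

theorem IsBihom.counit_smul {a b : Γ} {x : H} (hx : IsBihom π a b x) :
    counit (R := ℂ) x • (el a : GroupAlg Γ) = counit (R := ℂ) x • el b := by
  have h1 : ∀ z : H ⊗[ℂ] H, TensorProduct.rid ℂ _ (counit.lTensor _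
      ((π : H →ₗ[ℂ] GroupAlg Γ).rTensor H z)) = π (TensorProduct.rid ℂ _ (counit.lTensor _ z)) := by
    intro z
    induction z with
    | zero => simp
    | add x y hx hy => simp only [map_add, hx, hy]
    | tmul u v => simp
  have h2 : ∀ z : H ⊗[ℂ] H, TensorProduct.lid ℂ _ (counit.rTensor _
      ((π : H →ₗ[ℂ] GroupAlg Γ).lTensor H z)) = π (TensorProduct.lid ℂ _ (counit.rTensor _ z)) := by
    intro z
    induction z with
    | zero => simp
    | add x y hx hy => simp only [map_add, hx, hy]
    | tmul u v => simp
  have k1 := h1 (comul x)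
  have k2 := h2 (comul x)
  rw [hx.1] at k1
  rw [hx.2] at k2
  rw [LinearMap.lTensor_tmul, TensorProduct.rid_tmul] at k1
  rw [LinearMap.rTensor_tmul, TensorProduct.lid_tmul] at k2
  rw [k1, k2]
  simp

theorem IsBihom.counit_eq {a b : Γ} {x : H} (hx : IsBihom π a b x)
    (h : counit (R := ℂ) x ≠ 0) : a = b := by
  have h1 := smul_right_injective (GroupAlg Γ) h hx.counit_smul
  exact MonoidAlgebra.single_left_injective one_ne_zero h1

/-- The coefficient functional. -/
def coeffFun (g : Γ) : GroupAlg Γ →ₗ[ℂ] ℂ :=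
  Finsupp.lapply g ∘ₗ (MonoidAlgebra.coeffLinearEquiv ℂ).toLinearMap

/-- Projections onto homogeneous components. -/
def projL (π : H →ₐc[ℂ] GroupAlg Γ) (a : Γ) : H →ₗ[ℂ] H :=
  (TensorProduct.lid ℂ H).toLinearMap ∘ₗ (coeffFun a ∘ₗ (π : H →ₗ[ℂ] GroupAlg Γ)).rTensor H ∘ₗ comul

/-- Projections onto homogeneous components. -/
def projR (π : H →ₐc[ℂ] GroupAlg Γ) (a : Γ) : H →ₗ[ℂ] H :=
  (TensorProduct.rid ℂ H).toLinearMap ∘ₗ (coeffFun a ∘ₗ (π : H →ₗ[ℂ] GroupAlg Γ)).lTensor H ∘ₗ comul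

theorem projL_bihom [DecidableEq Γ] {a b : Γ} {x : H} (hx : IsBihom π a b x) (c : Γ) :
    projL π c x = if a = c then x else 0 := by
  rw [projL, LinearMap.rTensor_comp]
  simp only [LinearMap.comp_apply, hx.1]
  simp [coeffFun, Finsupp.single_apply]

theorem projR_bihom [DecidableEq Γ] {a b : Γ} {x : H} (hx : IsBihom π a b x) (c : Γ) :
    projR π c x = if b = c then x else 0 := by
  rw [projR, LinearMap.lTensor_comp]
  simp only [LinearMap.comp_apply, hx.2]
  simp [coeffFun, Finsupp.single_apply]

theorem comul_projL (a : Γ) (x : H) :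
    comul (projL π a x) = (projL π a).rTensor H (comul x) := by
  have key1 : ∀ z : H ⊗[ℂ] H, comul (TensorProduct.lid ℂ H
      ((coeffFun a ∘ₗ (π : H →ₗ[ℂ] GroupAlg Γ)).rTensor H z)) =
      TensorProduct.lid ℂ _ ((coeffFun a ∘ₗ (π : H →ₗ[ℂ] GroupAlg Γ)).rTensor _
        (comul.lTensor H z)) := by
    intro z
    induction z with
    | zero => simp
    | add x y hx hy => simp only [map_add, hx, hy]
    | tmul u v => simp
  have key2 : ∀ z : H ⊗[ℂ] H, (projL π a).rTensor H z =
      TensorProduct.lid ℂ _ ((coeffFun a ∘ₗ (π : H →ₗ[ℂ] GroupAlg Γ)).rTensor _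
        (TensorProduct.assoc ℂ _ _ _ (comul.rTensor H z))) := by
    intro z
    induction z with
    | zero => simp
    | add x y hx hy => simp only [map_add, hx, hy]
    | tmul u v =>
      simp only [projL, LinearMap.rTensor_tmul, LinearMap.comp_apply, LinearEquiv.coe_coe]
      generalize (comul u : H ⊗[ℂ] H) = w
      induction w with
      | zero => simp
      | add x y hx hy => simp only [map_add, hx, hy, TensorProduct.add_tmul]
      | tmul a b => simp [TensorProduct.smul_tmul']
  rw [key2, Coalgebra.coassoc_apply, ← key1]
  rfl

theorem comul_projR (a : Γ) (x : H) :
    comul (projR π a x) = (projR π a).lTensor H (comul x) := by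
  have key1 : ∀ z : H ⊗[ℂ] H, comul (TensorProduct.rid ℂ H
      ((coeffFun a ∘ₗ (π : H →ₗ[ℂ] GroupAlg Γ)).lTensor H z)) =
      TensorProduct.rid ℂ _ ((coeffFun a ∘ₗ (π : H →ₗ[ℂ] GroupAlg Γ)).lTensor _
        (comul.rTensor H z)) := by
    intro z
    induction z with
    | zero => simp
    | add x y hx hy => simp only [map_add, hx, hy]
    | tmul u v => simp
  have key2 : ∀ z : H ⊗[ℂ] H, (projR π a).lTensor H z =
      TensorProduct.rid ℂ _ ((coeffFun a ∘ₗ (π : H →ₗ[ℂ] GroupAlg Γ)).lTensor _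
        ((TensorProduct.assoc ℂ _ _ _).symm (comul.lTensor H z))) := by
    intro z
    induction z with
    | zero => simp
    | add x y hx hy => simp only [map_add, hx, hy]
    | tmul u v =>
      simp only [projR, LinearMap.lTensor_tmul, LinearMap.comp_apply, LinearEquiv.coe_coe]
      generalize (comul v : H ⊗[ℂ] H) = w
      induction w with
      | zero => simp
      | add x y hx hy => simp only [map_add, hx, hy, TensorProduct.tmul_add]
      | tmul a b => simp
  have h := Coalgebra.coassoc_apply (R := ℂ) x
  rw [key2, ← h, LinearEquiv.symm_apply_apply, ← key1]
  rfl

/-- The functional `a ⊗ b ↦ δ_{a,b}`. -/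
def deltaForm (Γ : Type u) : GroupAlg Γ ⊗[ℂ] GroupAlg Γ →ₗ[ℂ] ℂ :=
  TensorProduct.lift
    ((Finsupp.linearCombination ℂ fun a : Γ => coeffFun a)
      ∘ₗ (MonoidAlgebra.coeffLinearEquiv ℂ).toLinearMap)

theorem deltaForm_el [DecidableEq Γ] (a b : Γ) :
    deltaForm Γ (el a ⊗ₜ el b) = if a = b then 1 else 0 := by
  simp [deltaForm, coeffFun, Finsupp.single_apply, eq_comm]

/-- Projection onto the matching part `⊕ H_{a,c} ⊗ H_{c,b}` of `H ⊗ H`. -/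
def matchMap (π : H →ₐc[ℂ] GroupAlg Γ) : H ⊗[ℂ] H →ₗ[ℂ] H ⊗[ℂ] H :=
  (TensorProduct.rid ℂ (H ⊗[ℂ] H)).toLinearMap ∘ₗ (deltaForm Γ).lTensor (H ⊗[ℂ] H)
    ∘ₗ (TensorProduct.tensorTensorTensorComm ℂ H _ H _).toLinearMap
    ∘ₗ TensorProduct.map (coactR π) (coactL π)

theorem matchMap_tmul [DecidableEq Γ] {a b c d : Γ} {x y : H} (hx : IsBihom π a b x)
    (hy : IsBihom π c d y) : matchMap π (x ⊗ₜ y) = if b = c then x ⊗ₜ y else 0 := by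
  simp only [matchMap, LinearMap.comp_apply, TensorProduct.map_tmul, (isBihom_iff.1 hx).2,
    (isBihom_iff.1 hy).1, LinearEquiv.coe_coe, TensorProduct.tensorTensorTensorComm_tmul,
    LinearMap.lTensor_tmul, deltaForm_el, TensorProduct.rid_tmul, ite_smul, one_smul, zero_smul]

variable (π) in
theorem tensor_bihom_induction {P : H ⊗[ℂ] H → Prop} (add : ∀ x y, P x → P y → P (x + y))
    (hom : ∀ a b c d x y, IsBihom π a b x → IsBihom π c d y → P (x ⊗ₜ y)) (z : H ⊗[ℂ] H) : P z := by
  have h0 : IsBihom π 1 1 (0 : H) := by simp [IsBihom]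
  induction z with
  | zero => simpa using hom 1 1 1 1 0 0 h0 h0
  | add x y hx hy => exact add x y hx hy
  | tmul x y =>
    induction x using bihom_induction (π := π) with
    | add x x' hx hx' => rw [TensorProduct.add_tmul]; exact add _ _ hx hx'
    | hom a b x hx =>
      induction y using bihom_induction (π := π) with
      | add y y' hy hy' => rw [TensorProduct.tmul_add]; exact add _ _ hy hy'
      | hom c d y hy => exact hom a b c d x y hx hy

theorem matchMap_comul (x : H) : matchMap π (comul x) = comul x := by
  classical
  let E : (H ⊗[ℂ] GroupAlg Γ) ⊗[ℂ] H →ₗ[ℂ] H ⊗[ℂ] H :=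
    ((TensorProduct.rid ℂ H).toLinearMap ∘ₗ (deltaForm Γ).lTensor H
      ∘ₗ (TensorProduct.assoc ℂ _ _ _).toLinearMap ∘ₗ (coactR π).rTensor _).rTensor H
  let r : H ⊗[ℂ] (H ⊗[ℂ] GroupAlg Γ) →ₗ[ℂ] (H ⊗[ℂ] GroupAlg Γ) ⊗[ℂ] H :=
    (TensorProduct.assoc ℂ _ _ _).symm.toLinearMap ∘ₗ
      (TensorProduct.comm ℂ _ _).toLinearMap.lTensor H
  have hE : ∀ a b x g y, IsBihom π a b x → E ((x ⊗ₜ el g) ⊗ₜ y) = if b = g then x ⊗ₜ y else 0 := by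
    intro a b x g y hx
    simp only [E, LinearMap.rTensor_tmul, LinearMap.comp_apply, (isBihom_iff.1 hx).2,
      LinearEquiv.coe_coe, TensorProduct.assoc_tmul, LinearMap.lTensor_tmul, deltaForm_el,
      TensorProduct.rid_tmul, ite_smul, one_smul, zero_smul]
    split_ifs <;> simp
  have h1 : ∀ z, matchMap π z = E (r ((coactL π).lTensor H z)) := by
    intro z
    induction z using tensor_bihom_induction π with
    | add x y hx hy => simp only [map_add, hx, hy]
    | hom a b c d x y hx hy =>
      rw [matchMap_tmul hx hy, LinearMap.lTensor_tmul, (isBihom_iff.1 hy).1]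
      simp only [r, LinearMap.comp_apply, LinearMap.lTensor_tmul, LinearEquiv.coe_coe,
        TensorProduct.comm_tmul, TensorProduct.assoc_symm_tmul]
      rw [hE _ _ _ _ _ hx]
  have h2 : ∀ z, E ((coactR π).rTensor H z) = z := by
    intro z
    induction z using tensor_bihom_induction π with
    | add x y hx hy => simp only [map_add, hx, hy]
    | hom a b c d x y hx hy =>
      rw [LinearMap.rTensor_tmul, (isBihom_iff.1 hx).2, hE _ _ _ _ _ hx, if_pos rfl]
  have h3 : ∀ z, r ((coactL π).lTensor H z) =
      ((π : H →ₗ[ℂ] GroupAlg Γ).lTensor H).rTensor H ((TensorProduct.assoc ℂ _ _ _).symm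
        (comul.lTensor H z)) := by
    intro z
    induction z with
    | zero => simp
    | add x y hx hy => simp only [map_add, hx, hy]
    | tmul u v =>
      simp only [r, coactL, LinearMap.lTensor_tmul, LinearMap.comp_apply]
      generalize (comul v : H ⊗[ℂ] H) = w
      induction w with
      | zero => simp
      | add x y hx hy => simp only [map_add, hx, hy, TensorProduct.tmul_add]
      | tmul a b => simp
  have h4 : ∀ z, (coactR π).rTensor H z =
      ((π : H →ₗ[ℂ] GroupAlg Γ).lTensor H).rTensor H (comul.rTensor H z) := by
    intro z
    rw [coactR, LinearMap.rTensor_comp]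
    rfl
  have h := Coalgebra.coassoc_apply (R := ℂ) x
  rw [h1, h3, ← h, LinearEquiv.symm_apply_apply, ← h4, h2]

/-- The coproduct maps `H_{a,b}` into the sum of the `H_{a,c} ⊗ H_{c,b}`. -/
theorem comul_mem_span {a b : Γ} {x : H} (hx : IsBihom π a b x) :
    comul x ∈ Submodule.span ℂ
      {z : H ⊗[ℂ] H | ∃ c u v, IsBihom π a c u ∧ IsBihom π c b v ∧ z = u ⊗ₜ v} := by
  classical
  have h : comul x = matchMap π (TensorProduct.map (projL π a) (projR π b) (comul x)) := by
    have h1 : TensorProduct.map (projL π a) (projR π b) (comul x) = comul x := by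
      rw [← LinearMap.rTensor_comp_lTensor, LinearMap.comp_apply, ← comul_projR,
        projR_bihom hx, if_pos rfl, ← comul_projL, projL_bihom hx, if_pos rfl]
    rw [h1, matchMap_comul]
  rw [h]
  generalize (comul x : H ⊗[ℂ] H) = z
  induction z using tensor_bihom_induction π with
  | add x y hx hy => simp only [map_add]; exact Submodule.add_mem _ hx hy
  | hom a' c d b' u v hu hv =>
    rw [TensorProduct.map_tmul, projL_bihom hu, projR_bihom hv]
    by_cases h1 : a' = a
    · by_cases h2 : b' = b
      · subst h1 h2
        rw [if_pos rfl, if_pos rfl, matchMap_tmul hu hv]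
        by_cases h3 : c = d
        · subst h3
          rw [if_pos rfl]
          exact Submodule.subset_span ⟨c, u, v, hu, hv, rfl⟩
        · simp [h3]
      · simp [h2]
    · simp [h1]

end

section

variable {Γ : Type u} [CommGroup Γ] {H : Type v} [Ring H] [HopfAlgebra ℂ H]
  {π : H →ₐc[ℂ] GroupAlg Γ}

section Restrict

variable {Γ₀ : Type u} [CommGroup Γ₀]

/-- The pullback `i^*β` of a bicharacter. -/
def pullBichar (i : Γ₀ →* Γ) (β : Γ →* Γ →* Circle) : Γ₀ →* Γ₀ →* Circle := (β.comp i).compl₂ i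

/-- The linear left inverse of `ℂΓ₀ → ℂΓ` (for `Γ₀ → Γ` injective) killing all group elements
outside of the image of `Γ₀`. -/
def corestrict (i : Γ₀ →* Γ) (hi : Function.Injective i) : GroupAlg Γ →ₗ[ℂ] GroupAlg Γ₀ :=
  (MonoidAlgebra.coeffLinearEquiv ℂ).symm.toLinearMap ∘ₗ Finsupp.lcomapDomain i hi
    ∘ₗ (MonoidAlgebra.coeffLinearEquiv ℂ).toLinearMap

theorem corestrict_el (i : Γ₀ →* Γ) (hi : Function.Injective i) (g : Γ₀) :
    corestrict i hi (el (i g)) = el g := by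
  classical
  apply MonoidAlgebra.coeffEquiv.injective
  ext h
  simp [corestrict, Finsupp.lcomapDomain, Finsupp.single_apply]

/-- The adjoint coaction `ad_π` of `ℂΓ` on `H`, viewed as a coaction of `ℂΓ₀`. It is meaningful
when `ad_π(H)` is contained in `H ⊗ ℂΓ₀`, see `lTensor_adRestrict`. -/
def adRestrict (π : H →ₐc[ℂ] GroupAlg Γ) (i : Γ₀ →* Γ) (hi : Function.Injective i) :
    H →ₗ[ℂ] H ⊗[ℂ] GroupAlg Γ₀ :=
  (corestrict i hi).lTensor H ∘ₗ adOf π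

theorem adRestrict_bihom (i : Γ₀ →* Γ) (hi : Function.Injective i) {a b : Γ} {x : H}
    (hx : IsBihom π a b x) {g : Γ₀} (hg : i g = a⁻¹ * b) :
    adRestrict π i hi x = x ⊗ₜ el g := by
  rw [adRestrict, LinearMap.comp_apply, adOf_bihom hx, ← hg, LinearMap.lTensor_tmul, corestrict_el]

/-- The degrees `a⁻¹ b` of the nonzero elements of `H_{a,b}` lie in the image of `i`. -/
def DegreesIn (π : H →ₐc[ℂ] GroupAlg Γ) (i : Γ₀ →* Γ) : Prop :=
  ∀ a b x, IsBihom π a b x → x ≠ 0 → ∃ g, i g = a⁻¹ * b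

variable {i : Γ₀ →* Γ}

theorem DegreesIn.induction (hc : DegreesIn π i) {P : H → Prop}
    (add : ∀ x y, P x → P y → P (x + y))
    (hom : ∀ a b g x, IsBihom π a b x → i g = a⁻¹ * b → P x) (x : H) : P x := by
  refine bihom_induction (π := π) add (fun a b x hx => ?_) x
  by_cases h : x = 0
  · subst h
    exact hom 1 1 1 0 (by simp [IsBihom]) (by simp)
  · obtain ⟨g, hg⟩ := hc a b x hx h
    exact hom a b g x hx hg

/-- The coaction `adRestrict` really is `ad_π` with values in `H ⊗ ℂΓ₀`. -/
theorem lTensor_adRestrict (hc : DegreesIn π i) (hi : Function.Injective i) (x : H) :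
    (MonoidAlgebra.mapDomainBialgHom ℂ i : GroupAlg Γ₀ →ₗ[ℂ] GroupAlg Γ).lTensor H
      (adRestrict π i hi x) = adOf π x := by
  induction x using hc.induction with
  | add x y hx hy => simp only [map_add, hx, hy]
  | hom a b g x hx hg => simp [adRestrict_bihom i hi hx hg, adOf_bihom hx, hg]

theorem DegreesIn.comul_induction (hc : DegreesIn π i) {a b : Γ} {x : H} (hx : IsBihom π a b x)
    {P : H ⊗[ℂ] H → Prop} (add : ∀ x y, P x → P y → P (x + y))
    (hom : ∀ c u v g h, IsBihom π a c u → IsBihom π c b v → i g = a⁻¹ * c → i h = c⁻¹ * b →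
      P (u ⊗ₜ v)) (zero : P 0) : P (comul x) := by
  refine Submodule.closure_induction (p := fun z _ => P z) ?_ ?_ ?_ (comul_mem_span hx)
  · exact zero
  · exact fun x y _ _ hx hy => add x y hx hy
  · rintro s z ⟨c, u, v, hu, hv, rfl⟩
    rw [TensorProduct.smul_tmul']
    by_cases h1 : s • u = 0
    · simpa [h1] using zero
    by_cases h2 : v = 0
    · simpa [h2] using zero
    obtain ⟨g, hg⟩ := hc a c _ (hu.smul s) h1
    obtain ⟨h, hh⟩ := hc c b v hv h2
    exact hom c _ v g h (hu.smul s) hv hg hh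

/-- `e` identifies `H` with an algebra and coalgebra `A` having the coproduct of `H` and
the product `x ·_β y`, and `δ` is the restricted adjoint coaction. -/
structure IsTransmuted (π : H →ₐc[ℂ] GroupAlg Γ) (i : Γ₀ →* Γ) (β : Γ →* Γ →* Circle)
    {A : Type v} [Ring A] [Algebra ℂ A] [Coalgebra ℂ A] (e : H ≃ₗ[ℂ] A)
    (δ : A →ₗ[ℂ] A ⊗[ℂ] GroupAlg Γ₀) : Prop where
  inj : Function.Injective i
  deg : DegreesIn π i
  coact : ∀ a b g x, IsBihom π a b x → i g = a⁻¹ * b → δ (e x) = e x ⊗ₜ el g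
  mul : ∀ a b c d x y, IsBihom π a b x → IsBihom π c d y →
    e x * e y = (β (a⁻¹ * b) c⁻¹ : ℂ) • e (x * y)
  one : e 1 = 1
  comul : ∀ x, comul (R := ℂ) (e x) = TensorProduct.map e.toLinearMap e.toLinearMap (comul x)
  counit : ∀ x, counit (R := ℂ) (e x) = counit (R := ℂ) x

namespace IsTransmuted

variable {β : Γ →* Γ →* Circle} {A : Type v} [Ring A] [Algebra ℂ A] [Coalgebra ℂ A]
  {e : H ≃ₗ[ℂ] A} {δ : A →ₗ[ℂ] A ⊗[ℂ] GroupAlg Γ₀}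

theorem induction (h : IsTransmuted π i β e δ) {P : A → Prop} (add : ∀ x y, P x → P y → P (x + y))
    (hom : ∀ a b g x, IsBihom π a b x → i g = a⁻¹ * b → P (e x)) (y : A) : P y := by
  obtain ⟨x, rfl⟩ := e.surjective y
  induction x using h.deg.induction with
  | add x y hx hy => rw [map_add]; exact add _ _ hx hy
  | hom a b g x hx hg => exact hom a b g x hx hg

theorem isCoaction (h : IsTransmuted π i β e δ) : IsCoaction δ where
  coassoc := by
    refine LinearMap.ext fun y => ?_
    induction y using h.induction with
    | add x y hx hy => simp only [map_add, hx, hy]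
    | hom a b g x hx hg => simp [h.coact a b g x hx hg]
  counit := by
    refine LinearMap.ext fun y => ?_
    induction y using h.induction with
    | add x y hx hy => simp only [map_add, hx, hy]
    | hom a b g x hx hg => simp [h.coact a b g x hx hg]

theorem coact_one (h : IsTransmuted π i β e δ) : δ 1 = 1 ⊗ₜ 1 := by
  rw [← h.one, h.coact 1 1 1 1 isBihom_one (by simp), el_one]

theorem coact_mul (h : IsTransmuted π i β e δ) (x y : A) : δ (x * y) = δ x * δ y := by
  induction x using h.induction with
  | add x x' hx hx' => simp only [map_add, hx, hx', add_mul]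
  | hom a b g x hx hg =>
  induction y using h.induction with
  | add y y' hy hy' => simp only [map_add, hy, hy', mul_add]
  | hom c d k y hy hk =>
  have hgk : i (g * k) = (a * c)⁻¹ * (b * d) := by
    rw [map_mul, hg, hk, mul_inv, mul_mul_mul_comm]
  rw [h.coact a b g x hx hg, h.coact c d k y hy hk, Algebra.TensorProduct.tmul_mul_tmul,
    h.mul a b c d x y hx hy, map_smul, h.coact _ _ _ _ (hx.mul hy) hgk, el_mul,
    TensorProduct.smul_tmul']

theorem coact_counit (h : IsTransmuted π i β e δ) :
    (TensorProduct.lid ℂ (GroupAlg Γ₀)).toLinearMap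
      ∘ₗ (Coalgebra.counit : A →ₗ[ℂ] ℂ).rTensor (GroupAlg Γ₀) ∘ₗ δ
    = Algebra.linearMap ℂ (GroupAlg Γ₀) ∘ₗ Coalgebra.counit := by
  refine LinearMap.ext fun y => ?_
  induction y using h.induction with
  | add x y hx hy => simp only [map_add, hx, hy]
  | hom a b g x hx hg =>
    simp only [LinearMap.comp_apply, h.coact a b g x hx hg, LinearMap.rTensor_tmul,
      LinearEquiv.coe_coe, TensorProduct.lid_tmul, Algebra.linearMap_apply,
      Algebra.algebraMap_eq_smul_one, h.counit]
    by_cases h0 : Coalgebra.counit (R := ℂ) x = 0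
    · simp [h0]
    · have h1 : g = 1 := h.inj (by rw [hg, hx.counit_eq h0]; simp)
      rw [h1, el_one]

theorem coact_comul (h : IsTransmuted π i β e δ) : tensorCoaction δ δ ∘ₗ Coalgebra.comul
    = (Coalgebra.comul : A →ₗ[ℂ] A ⊗[ℂ] A).rTensor (GroupAlg Γ₀) ∘ₗ δ := by
  refine LinearMap.ext fun y => ?_
  induction y using h.induction with
  | add x y hx hy => simp only [map_add, hx, hy]
  | hom a b g x hx hg =>
    rw [LinearMap.comp_apply, LinearMap.comp_apply, h.coact a b g x hx hg, LinearMap.rTensor_tmul,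
      h.comul]
    refine h.deg.comul_induction hx (P := fun z => tensorCoaction δ δ (TensorProduct.map
      e.toLinearMap e.toLinearMap z) = TensorProduct.map e.toLinearMap e.toLinearMap z ⊗ₜ el g)
      (fun x y hx hy => ?_) (fun c u v k l hu hv hk hl => ?_) ?_
    · simp only [map_add, hx, hy, TensorProduct.add_tmul]
    · have h1 : k * l = g := h.inj (by rw [map_mul, hk, hl, hg]; group)
      simp [tensorCoaction, h.coact _ _ _ _ hu hk, h.coact _ _ _ _ hv hl, h1]
    · simp

theorem counit_one (h : IsTransmuted π i β e δ) : Coalgebra.counit (R := ℂ) (1 : A) = 1 := by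
  rw [← h.one, h.counit, Bialgebra.counit_one]

theorem counit_mul (h : IsTransmuted π i β e δ) (x y : A) : Coalgebra.counit (R := ℂ) (x * y)
    = Coalgebra.counit (R := ℂ) x * Coalgebra.counit (R := ℂ) y := by
  induction x using h.induction with
  | add x x' hx hx' => simp only [map_add, hx, hx', add_mul]
  | hom a b g x hx hg =>
  induction y using h.induction with
  | add y y' hy hy' => simp only [map_add, hy, hy', mul_add]
  | hom c d k y hy hk =>
  rw [h.mul a b c d x y hx hy, map_smul, h.counit, h.counit, h.counit, Bialgebra.counit_mul]
  by_cases h0 : Coalgebra.counit (R := ℂ) x = 0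
  · simp [h0]
  · simp [hx.counit_eq h0]

theorem comul_one (h : IsTransmuted π i β e δ) : Coalgebra.comul (R := ℂ) (1 : A) = 1 ⊗ₜ 1 := by
  rw [← h.one, h.comul, Bialgebra.comul_one, Algebra.TensorProduct.one_def, TensorProduct.map_tmul]
  rfl

theorem comul_mul (h : IsTransmuted π i β e δ) (x y : A) : Coalgebra.comul (R := ℂ) (x * y)
    = braidedMul (bicharForm (pullBichar i β)) δ δ
      (Coalgebra.comul (R := ℂ) x ⊗ₜ Coalgebra.comul (R := ℂ) y) := by
  induction x using h.induction with
  | add x x' hx hx' => simp only [map_add, hx, hx', add_mul, TensorProduct.add_tmul]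
  | hom a b g x hx hg =>
  induction y using h.induction with
  | add y y' hy hy' => simp only [map_add, hy, hy', mul_add, TensorProduct.tmul_add]
  | hom c d k y hy hk =>
  rw [h.mul a b c d x y hx hy, map_smul, h.comul, h.comul, h.comul, Bialgebra.comul_mul]
  refine h.deg.comul_induction hx (P := fun z => (β (a⁻¹ * b) c⁻¹ : ℂ) •
    TensorProduct.map e.toLinearMap e.toLinearMap (z * Coalgebra.comul y) =
      braidedMul (bicharForm (pullBichar i β)) δ δ (TensorProduct.map e.toLinearMap e.toLinearMap z
        ⊗ₜ TensorProduct.map e.toLinearMap e.toLinearMap (Coalgebra.comul y)))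
      (fun z w hz hw => ?_) (fun p u v g₁ g₂ hu hv hg₁ hg₂ => ?_) (by simp)
  · simp only [map_add, add_mul, smul_add, hz, hw, TensorProduct.add_tmul]
  refine h.deg.comul_induction hy (P := fun z => (β (a⁻¹ * b) c⁻¹ : ℂ) •
    TensorProduct.map e.toLinearMap e.toLinearMap ((u ⊗ₜ v) * z) =
      braidedMul (bicharForm (pullBichar i β)) δ δ (TensorProduct.map e.toLinearMap e.toLinearMap
        (u ⊗ₜ v) ⊗ₜ TensorProduct.map e.toLinearMap e.toLinearMap z))
      (fun z w hz hw => ?_) (fun q u' v' k₁ k₂ hu' hv' hk₁ hk₂ => ?_) (by simp)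
  · simp only [map_add, mul_add, smul_add, hz, hw, TensorProduct.tmul_add]
  simp only [TensorProduct.map_tmul, LinearEquiv.coe_coe, Algebra.TensorProduct.tmul_mul_tmul]
  rw [braidedMul_tmul _ _ _ (h.coact _ _ _ _ hu' hk₁) (h.coact _ _ _ _ hv hg₂),
    h.mul _ _ _ _ _ _ hu hu', h.mul _ _ _ _ _ _ hv hv', bicharForm_el, ← TensorProduct.smul_tmul',
    TensorProduct.tmul_smul, smul_smul, smul_smul]
  congr 1
  have h1 : pullBichar i β g₂ k₁ = β (p⁻¹ * b) (c⁻¹ * q) := by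
    rw [← hg₂, ← hk₁]
    rfl
  have h2 : a⁻¹ * b = (a⁻¹ * p) * (p⁻¹ * b) := by group
  have h3 : β (p⁻¹ * b) c⁻¹ = β (p⁻¹ * b) (c⁻¹ * q) * β (p⁻¹ * b) q⁻¹ := by
    rw [← map_mul, mul_inv_cancel_right]
  rw [h1, h2, map_mul β, MonoidHom.mul_apply, h3, Circle.coe_mul, Circle.coe_mul]
  ring

end IsTransmuted

end Restrict

variable (π)

/-- The vector space of `H`, to be equipped with the coalgebra structure of `H` and with
the transmuted product `·_β`. -/
def Transm (_ : H →ₐc[ℂ] GroupAlg Γ) (_ : Γ →* Γ →* Circle) : Type v := H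

namespace Transm

variable (β : Γ →* Γ →* Circle)

instance : AddCommGroup (Transm π β) := inferInstanceAs (AddCommGroup H)

instance : Module ℂ (Transm π β) := inferInstanceAs (Module ℂ H)

theorem transmMul_assoc (x y z : H) :
    transmMul (bicharForm β) π (transmMul (bicharForm β) π (x ⊗ₜ y) ⊗ₜ z) =
      transmMul (bicharForm β) π (x ⊗ₜ transmMul (bicharForm β) π (y ⊗ₜ z)) := by
  induction x using bihom_induction (π := π) with
  | add x x' hx hx' => simp only [TensorProduct.add_tmul, map_add, hx, hx']
  | hom a b x hx =>
  induction y using bihom_induction (π := π) with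
  | add y y' hy hy' => simp only [TensorProduct.add_tmul, TensorProduct.tmul_add, map_add, hy, hy']
  | hom c d y hy =>
  induction z using bihom_induction (π := π) with
  | add z z' hz hz' => simp only [TensorProduct.tmul_add, map_add, hz, hz']
  | hom k l z hz =>
  rw [transmMul_bihom β hx hy, transmMul_bihom β hy hz, ← TensorProduct.smul_tmul', map_smul,
    TensorProduct.tmul_smul, map_smul, transmMul_bihom β (hx.mul hy) hz,
    transmMul_bihom β hx (hy.mul hz), smul_smul, smul_smul, mul_assoc]
  congr 1
  rw [mul_inv, mul_inv, mul_mul_mul_comm]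
  simp only [map_mul, MonoidHom.mul_apply, Circle.coe_mul]
  ring

theorem one_transmMul (x : H) : transmMul (bicharForm β) π (1 ⊗ₜ x) = x := by
  induction x using bihom_induction (π := π) with
  | add x y hx hy => simp only [TensorProduct.tmul_add, map_add, hx, hy]
  | hom a b x hx =>
    rw [transmMul_bihom β isBihom_one hx]
    simp

theorem transmMul_one (x : H) : transmMul (bicharForm β) π (x ⊗ₜ 1) = x := by
  induction x using bihom_induction (π := π) with
  | add x y hx hy => simp only [TensorProduct.add_tmul, map_add, hx, hy]
  | hom a b x hx =>
    rw [transmMul_bihom β hx isBihom_one]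
    simp

instance : Ring (Transm π β) where
  __ := (inferInstance : AddCommGroup (Transm π β))
  mul x y := transmMul (bicharForm β) π ((x : H) ⊗ₜ[ℂ] (y : H))
  one := (1 : H)
  mul_assoc := transmMul_assoc π β
  one_mul := one_transmMul π β
  mul_one := transmMul_one π β
  zero_mul x := (congrArg (transmMul (bicharForm β) π)
    (TensorProduct.zero_tmul H (x : H))).trans (map_zero _)
  mul_zero x := (congrArg (transmMul (bicharForm β) π)
    (TensorProduct.tmul_zero H (x : H))).trans (map_zero _)
  left_distrib x y z := (congrArg (transmMul (bicharForm β) π)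
    (TensorProduct.tmul_add (x : H) (y : H) (z : H))).trans (map_add _ _ _)
  right_distrib x y z := (congrArg (transmMul (bicharForm β) π)
    (TensorProduct.add_tmul (x : H) (y : H) (z : H))).trans (map_add _ _ _)

theorem smul_transmMul (c : ℂ) (x y : H) :
    transmMul (bicharForm β) π ((c • x) ⊗ₜ y) = c • transmMul (bicharForm β) π (x ⊗ₜ y) := by
  rw [← TensorProduct.smul_tmul', map_smul]

theorem transmMul_smul (c : ℂ) (x y : H) :
    transmMul (bicharForm β) π (x ⊗ₜ (c • y)) = c • transmMul (bicharForm β) π (x ⊗ₜ y) := by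
  rw [TensorProduct.tmul_smul, map_smul]

instance : Algebra ℂ (Transm π β) :=
  Algebra.ofModule (smul_transmMul π β) (transmMul_smul π β)

instance : Coalgebra ℂ (Transm π β) := inferInstanceAs (Coalgebra ℂ H)

end Transm

section Constructions

variable {Γ₀ : Type u} [CommGroup Γ₀]

/-- The identity map `H → H_β`. -/
def Transm.of (β : Γ →* Γ →* Circle) : H ≃ₗ[ℂ] Transm π β := LinearEquiv.refl ℂ H

/-- The restricted adjoint coaction on `H_β`. -/
def Transm.coact (β : Γ →* Γ →* Circle) (i : Γ₀ →* Γ) (hi : Function.Injective i) :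
    Transm π β →ₗ[ℂ] Transm π β ⊗[ℂ] GroupAlg Γ₀ :=
  (Transm.of π β).toLinearMap.rTensor (GroupAlg Γ₀) ∘ₗ adRestrict π i hi
    ∘ₗ (Transm.of π β).symm.toLinearMap

theorem isTransmuted_transm (β : Γ →* Γ →* Circle) {i : Γ₀ →* Γ} (hi : Function.Injective i)
    (hc : DegreesIn π i) : IsTransmuted π i β (Transm.of π β) (Transm.coact π β i hi) where
  inj := hi
  deg := hc
  coact a b g x hx hg := by
    simp [Transm.coact, adRestrict_bihom i hi hx hg]
  mul a b c d x y hx hy := by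
    have h := transmMul_bihom β hx hy
    exact h
  one := rfl
  comul x := (LinearMap.congr_fun TensorProduct.map_id (comul x : H ⊗[ℂ] H)).symm
  counit x := rfl

theorem isTransmuted_self {i : Γ₀ →* Γ} (hi : Function.Injective i)
    (hc : DegreesIn π i) :
    IsTransmuted π i 1 (A := H) (LinearEquiv.refl ℂ H) (adRestrict π i hi) where
  inj := hi
  deg := hc
  coact a b g x hx hg := adRestrict_bihom i hi hx hg
  mul a b c d x y hx hy := by simp
  one := rfl
  comul x := (LinearMap.congr_fun TensorProduct.map_id (comul x : H ⊗[ℂ] H)).symm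
  counit x := rfl

/-- The transmutation `H_β` of `H` along `π`, as a braided bialgebra over `(ℂΓ₀, i^*β)`. -/
def transmutedBraided (β : Γ →* Γ →* Circle) {i : Γ₀ →* Γ} (hi : Function.Injective i)
    (hc : DegreesIn π i) :
    BraidedBialgebra.{u, v} (GroupAlg Γ₀) (bicharForm (pullBichar i β)) where
  carrier := Transm π β
  coact := Transm.coact π β i hi
  isCoaction := (isTransmuted_transm π β hi hc).isCoaction
  coact_one := (isTransmuted_transm π β hi hc).coact_one
  coact_mul := (isTransmuted_transm π β hi hc).coact_mul
  coact_counit := (isTransmuted_transm π β hi hc).coact_counit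
  coact_comul := (isTransmuted_transm π β hi hc).coact_comul
  counit_one := (isTransmuted_transm π β hi hc).counit_one
  counit_mul := (isTransmuted_transm π β hi hc).counit_mul
  comul_one := (isTransmuted_transm π β hi hc).comul_one
  comul_mul := (isTransmuted_transm π β hi hc).comul_mul

/-- `H` itself, with its given structure maps and the adjoint coaction, as a braided bialgebra over
`ℂΓ₀` with the trivial bicharacter `1`, that is with the coquasitriangular structure `ε ⊗ ε`. -/
def untwistedBraided {i : Γ₀ →* Γ} (hi : Function.Injective i) (hc : DegreesIn π i) :
    BraidedBialgebra.{u, v} (GroupAlg Γ₀) (bicharForm (1 : Γ₀ →* Γ₀ →* Circle)) where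
  carrier := H
  coact := adRestrict π i hi
  isCoaction := (isTransmuted_self π hi hc).isCoaction
  coact_one := (isTransmuted_self π hi hc).coact_one
  coact_mul := (isTransmuted_self π hi hc).coact_mul
  coact_counit := (isTransmuted_self π hi hc).coact_counit
  coact_comul := (isTransmuted_self π hi hc).coact_comul
  counit_one := (isTransmuted_self π hi hc).counit_one
  counit_mul := (isTransmuted_self π hi hc).counit_mul
  comul_one := (isTransmuted_self π hi hc).comul_one
  comul_mul := (isTransmuted_self π hi hc).comul_mul

end Constructions

end

section

/-- The involution of `ℂΓ`: `(∑ c_g g)^* = ∑ \bar c_g g⁻¹`. -/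
def groupAlgStar {Γ : Type u} [CommGroup Γ] (k : GroupAlg Γ) : GroupAlg Γ :=
  k.coeff.sum fun g c => MonoidAlgebra.single g⁻¹ (star c)

/-- `H` is a Hopf `*`-algebra: a Hopf algebra and a `*`-algebra such that the coproduct is
a `*`-homomorphism, where `(x ⊗ y)^* = x^* ⊗ y^*`. -/
class IsHopfStarAlgebra (H : Type v) [Ring H] [HopfAlgebra ℂ H] [StarRing H] [StarModule ℂ H] :
    Prop where
  comul_star : ∀ x : H, comul (R := ℂ) (star x) = star (comul (R := ℂ) x)

variable {T : Type u} [CommGroup T] [TopologicalSpace T] [IsTopologicalGroup T]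

/-- The Hopf algebra `ℂ[T]` of regular functions on the compact abelian group `T`, that is
the group algebra of the dual group. -/
abbrev FunAlg (T : Type u) [CommGroup T] [TopologicalSpace T] := GroupAlg (PontryaginDual T)

/-- The restriction of characters to a subgroup. -/
def dualRes (T₀ : Subgroup T) : PontryaginDual T →* PontryaginDual T₀ :=
  (PontryaginDual.map (⟨T₀.subtype, continuous_subtype_val⟩ : T₀ →ₜ* T)).toMonoidHom

/-- The inflation of characters of the quotient group. -/
def dualInfl (T₀ : Subgroup T) : PontryaginDual (T ⧸ T₀) →* PontryaginDual T :=
  (PontryaginDual.map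
    (⟨QuotientGroup.mk' T₀, continuous_quotient_mk'⟩ : T →ₜ* T ⧸ T₀)).toMonoidHom

/-- The restriction map `q : ℂ[T] → ℂ[T₀]`. -/
def resMap (T₀ : Subgroup T) : FunAlg T →ₐc[ℂ] FunAlg T₀ :=
  MonoidAlgebra.mapDomainBialgHom ℂ (dualRes T₀)

variable {H : Type v} [Ring H] [HopfAlgebra ℂ H] (π : H →ₐc[ℂ] FunAlg T)

/-- `T₀` is `H`-cocentral: the adjoint coaction `ad_{qπ}` of `ℂ[T₀]` on `H` is trivial. -/
def IsCocentral (T₀ : Subgroup T) : Prop :=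
  ∀ x : H, adOf ((resMap T₀).comp π) x = x ⊗ₜ 1

theorem dualInfl_injective (T₀ : Subgroup T) : Function.Injective (dualInfl T₀) := by
  intro χ ψ h
  refine PontryaginDual.ext fun t => ?_
  obtain ⟨s, rfl⟩ := QuotientGroup.mk_surjective t
  exact congrArg (fun χ : PontryaginDual T => χ s) h

theorem exists_dualInfl (T₀ : Subgroup T) (χ : PontryaginDual T) (h : dualRes T₀ χ = 1) :
    ∃ ψ, dualInfl T₀ ψ = χ := by
  have h1 : ∀ t ∈ T₀, χ t = 1 := fun t ht => congrArg (fun ψ : PontryaginDual T₀ => ψ ⟨t, ht⟩) h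
  let f : T ⧸ T₀ →* Circle := QuotientGroup.lift T₀ (χ : T →* Circle) h1
  have hf : Continuous f := continuous_quot_lift _ (map_continuous χ)
  let ψ : T ⧸ T₀ →ₜ* Circle := ⟨f, hf⟩
  exact ⟨ψ, rfl⟩

variable {π}

theorem IsCocentral.degreesIn {T₀ : Subgroup T} (hc : IsCocentral π T₀) :
    DegreesIn π (dualInfl T₀) := by
  classical
  intro a b x hx h0
  refine exists_dualInfl T₀ _ ?_
  have h1 := hc x
  have h2 : adOf ((resMap T₀).comp π) x =
      (resMap T₀ : FunAlg T →ₗ[ℂ] FunAlg T₀).lTensor H (adOf π x) := by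
    rw [adOf, adOf, LinearMap.comp_apply, LinearMap.comp_apply, ← LinearMap.comp_apply,
      ← LinearMap.comp_apply, ← LinearMap.lTensor_comp]
    rfl
  have h3 : resMap T₀ (el (a⁻¹ * b)) = el (dualRes T₀ (a⁻¹ * b)) := by
    simp [resMap]
  rw [h2, adOf_bihom hx, LinearMap.lTensor_tmul] at h1
  have h4 := congrArg (coeffAt H 1) h1
  rw [← el_one, coeffAt_tmul, if_pos rfl] at h4
  erw [h3] at h4
  rw [coeffAt_tmul] at h4
  by_contra hne
  rw [if_neg hne] at h4
  exact h0 h4.symm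

variable (π)

/-- The transmutation `H_β`, viewed as a braided bialgebra over `(ℂ[T/T₀], i^*β)`, where
`i : ℂ[T/T₀] → ℂ[T]` is the inclusion. -/
def transmutation (β : PontryaginDual T →* PontryaginDual T →* Circle) (T₀ : Subgroup T)
    (hc : IsCocentral π T₀) : BraidedBialgebra.{u, v} (FunAlg (T ⧸ T₀))
      (bicharForm (pullBichar (dualInfl T₀) β)) :=
  transmutedBraided π β (dualInfl_injective T₀) hc.degreesIn

/-- The Hopf algebra `H` with the adjoint coaction, viewed as a braided bialgebra over
`(ℂ[T/T₀], ε ⊗ ε)`. -/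
def untwisted (T₀ : Subgroup T) (hc : IsCocentral π T₀) :
    BraidedBialgebra.{u, v} (FunAlg (T ⧸ T₀)) (bicharForm 1) :=
  untwistedBraided π (dualInfl_injective T₀) hc.degreesIn

/-- The bosonization `ℂ[T/T₀] # H_β`. -/
abbrev TwistedBosonization (β : PontryaginDual T →* PontryaginDual T →* Circle) (T₀ : Subgroup T)
    (hc : IsCocentral π T₀) := Bosonization (transmutation π β T₀ hc)

/-- The bosonization `ℂ[T/T₀] ⋉ H`. -/
abbrev UntwistedBosonization (T₀ : Subgroup T) (hc : IsCocentral π T₀) :=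
  Bosonization (untwisted π T₀ hc)

end

end

end Transmutation

open Transmutation CategoryTheory

/-! The two bosonizations share one coalgebra, and their products differ by a 2-cocycle twist. Such
a twist leaves the category of comodules unchanged and changes its tensor product only by invertible
scalars.

Let `i` be the inclusion of the dual of `T/T₀` into the dual of `T`. Cocentrality says that `H_{a,b}
≠ 0` forces `a⁻¹ b = i(g)` for some `g`. The rule `p(k # x) = (k, π(x))` then gives a bialgebra map
from `ℂ[T/T₀] # H_β` to the group algebra of `G`, the product of the two dual groups. For `x ∈
H_{a,b}`, the element `k # x` has left degree `(k, a)` and right degree `(k g, b)`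
(`bosDegree_left`, `bosDegree_right`). Put `χ((k, a), (l, c)) = β(a, i(l)⁻¹ c)`. If `y ∈ H_{c,d}`,
then `l # y` has the same value of `i(l)⁻¹ c` at its left and at its right degree. The quotient of
`χ` at the right degrees by `χ` at the left degrees is therefore `β(a⁻¹ b, i(l)⁻¹ c)`. This is the
inverse of the scalar `β(a⁻¹ b, i(l) c⁻¹)` by which the product `(k # x)(l # y)` of `ℂ[T/T₀] # H_β`
differs from that of `ℂ[T/T₀] ⋉ H` (`bosEquiv_mul`). In Sweedler notation, with `e` the identity map
between the two bosonizations, `e(x₍₁₎ y₍₁₎) χ(p x₍₂₎, p y₍₂₎) = χ(p x₍₁₎, p y₍₁₎) e(x₍₂₎) e(y₍₂₎)`.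

Pushing coactions forward along `e` is an equivalence of categories. Through `p` every comodule is
graded by `G`, and the displayed identity says exactly that `m ⊗ n ↦ χ(|m|, |n|) m ⊗ n` is colinear
between the two tensor products (`IsCocycleTwist.gradedTwist_colinear`). A bicharacter is a
2-cocycle (`gradedTwist_assoc`) and is `1` when either argument is trivial, so these maps form a
monoidal structure. -/

namespace Transmutation

open TensorProduct CategoryTheory Coalgebra

noncomputable section

/-! ### Rescaling tensor products of graded spaces by a bicharacter -/

section GradedTwist

variable {G : Type u} [CommGroup G] {M N P : Type*} [AddCommGroup M] [Module ℂ M]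
  [AddCommGroup N] [Module ℂ N] [AddCommGroup P] [Module ℂ P]

/-- The map `m ⊗ n ↦ χ(|m|, |n|) m ⊗ n` on the tensor product of two `G`-graded spaces. -/
def gradedTwist (χ : G →* G →* Circle) (δM : M →ₗ[ℂ] M ⊗[ℂ] GroupAlg G)
    (δN : N →ₗ[ℂ] N ⊗[ℂ] GroupAlg G) : M ⊗[ℂ] N →ₗ[ℂ] M ⊗[ℂ] N :=
  (TensorProduct.rid ℂ (M ⊗[ℂ] N)).toLinearMap
    ∘ₗ (bicharForm χ).lTensor (M ⊗[ℂ] N)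
    ∘ₗ (TensorProduct.tensorTensorTensorComm ℂ M (GroupAlg G) N (GroupAlg G)).toLinearMap
    ∘ₗ TensorProduct.map δM δN

variable {δM : M →ₗ[ℂ] M ⊗[ℂ] GroupAlg G} {δN : N →ₗ[ℂ] N ⊗[ℂ] GroupAlg G}
  {δP : P →ₗ[ℂ] P ⊗[ℂ] GroupAlg G}

theorem gradedTwist_tmul (χ : G →* G →* Circle) {g h : G} {m : M} {n : N}
    (hm : δM m = m ⊗ₜ el g) (hn : δN n = n ⊗ₜ el h) :
    gradedTwist χ δM δN (m ⊗ₜ n) = (χ g h : ℂ) • (m ⊗ₜ n) := by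
  simp only [gradedTwist, LinearMap.comp_apply, TensorProduct.map_tmul, hm, hn,
    LinearEquiv.coe_coe, TensorProduct.tensorTensorTensorComm_tmul, LinearMap.lTensor_tmul,
    bicharForm_el, TensorProduct.rid_tmul]

/-- An element of degree `1` contributes `χ(1, h) = 1`. With its mirror image below, this yields the
unit constraints of the monoidal functor. -/
theorem gradedTwist_one_left (χ : G →* G →* Circle) (hN : IsCoaction δN) {m : M}
    (hm : δM m = m ⊗ₜ 1) (n : N) : gradedTwist χ δM δN (m ⊗ₜ n) = m ⊗ₜ n := by
  induction n using coaction_induction hN with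
  | add x y hx hy => rw [TensorProduct.tmul_add, map_add, hx, hy]
  | hom g n hn =>
    rw [gradedTwist_tmul χ (hm.trans (congrArg _ el_one.symm)) hn]
    simp

theorem gradedTwist_one_right (χ : G →* G →* Circle) (hM : IsCoaction δM) {n : N}
    (hn : δN n = n ⊗ₜ 1) (m : M) : gradedTwist χ δM δN (m ⊗ₜ n) = m ⊗ₜ n := by
  induction m using coaction_induction hM with
  | add x y hx hy => rw [TensorProduct.add_tmul, map_add, hx, hy]
  | hom g m hm =>
    rw [gradedTwist_tmul χ hm (hn.trans (congrArg _ el_one.symm))]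
    simp

/-- A comodule over a group algebra is the sum of its homogeneous components, so tensors of
homogeneous vectors span. Identities for `gradedTwist` thereby become identities between scalars. -/
theorem graded_tensor_induction (hM : IsCoaction δM) (hN : IsCoaction δN) {Q : M ⊗[ℂ] N → Prop}
    (add : ∀ x y, Q x → Q y → Q (x + y))
    (hom : ∀ g h m n, δM m = m ⊗ₜ el g → δN n = n ⊗ₜ el h → Q (m ⊗ₜ n)) (z : M ⊗[ℂ] N) : Q z := by
  induction z with
  -- The zero vector is homogeneous of every degree; degree `1` is an arbitrary choice.
  | zero => simpa using hom 1 1 0 0 (by simp) (by simp)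
  | add x y hx hy => exact add x y hx hy
  | tmul x y =>
    refine coaction_induction hM (P := fun x => Q (x ⊗ₜ y))
      (fun x x' hx hx' => ?_) (fun g x hx => ?_) x
    · rw [TensorProduct.add_tmul]; exact add _ _ hx hx'
    · refine coaction_induction hN (P := fun y => Q (x ⊗ₜ y))
        (fun y y' hy hy' => ?_) (fun h y hy => hom g h x y hx hy) y
      rw [TensorProduct.tmul_add]; exact add _ _ hy hy'

/-- The values of `χ` lie in the circle, so they are invertible, with inverses given by the
bicharacter `χ⁻¹`. -/
theorem gradedTwist_comp_inv (χ : G →* G →* Circle) (hM : IsCoaction δM) (hN : IsCoaction δN) :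
    gradedTwist χ δM δN ∘ₗ gradedTwist χ⁻¹ δM δN = LinearMap.id := by
  refine LinearMap.ext fun z => ?_
  induction z using graded_tensor_induction hM hN with
  | add x y hx hy => simp only [map_add, hx, hy]
  | hom g h m n hm hn =>
    rw [LinearMap.comp_apply, gradedTwist_tmul _ hm hn, map_smul, gradedTwist_tmul _ hm hn,
      smul_smul, ← Circle.coe_mul]
    simp

theorem gradedTwist_inv_comp (χ : G →* G →* Circle) (hM : IsCoaction δM) (hN : IsCoaction δN) :
    gradedTwist χ⁻¹ δM δN ∘ₗ gradedTwist χ δM δN = LinearMap.id := by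
  simpa using gradedTwist_comp_inv χ⁻¹ hM hN

/-- The map `gradedTwist` as an isomorphism. -/
def gradedTwistEquiv (χ : G →* G →* Circle) (hM : IsCoaction δM) (hN : IsCoaction δN) :
    M ⊗[ℂ] N ≃ₗ[ℂ] M ⊗[ℂ] N :=
  LinearEquiv.ofLinearMap (gradedTwist χ δM δN) (gradedTwist χ⁻¹ δM δN)
    (gradedTwist_comp_inv χ hM hN) (gradedTwist_inv_comp χ hM hN)

/-- Degrees multiply under the codiagonal coaction. This is what brings `χ(g h, k)` and `χ(g, h k)`
into the cocycle identity. -/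
theorem tensorCoaction_graded {g h : G} {m : M} {n : N}
    (hm : δM m = m ⊗ₜ el g) (hn : δN n = n ⊗ₜ el h) :
    tensorCoaction δM δN (m ⊗ₜ n) = (m ⊗ₜ n) ⊗ₜ el (g * h) := by
  simp [tensorCoaction, hm, hn]

/-- The 2-cocycle identity for `gradedTwist`. -/
theorem gradedTwist_assoc (χ : G →* G →* Circle) (hM : IsCoaction δM) (hN : IsCoaction δN)
    (hP : IsCoaction δP) :
    (TensorProduct.assoc ℂ M N P).toLinearMap ∘ₗ gradedTwist χ (tensorCoaction δM δN) δP
        ∘ₗ (gradedTwist χ δM δN).rTensor P =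
      gradedTwist χ δM (tensorCoaction δN δP) ∘ₗ (gradedTwist χ δN δP).lTensor M
        ∘ₗ (TensorProduct.assoc ℂ M N P).toLinearMap := by
  refine TensorProduct.ext' fun z r => ?_
  induction z using graded_tensor_induction hM hN with
  | add x y hx hy => simp only [map_add, TensorProduct.add_tmul, hx, hy]
  | hom g h m n hm hn =>
  induction r using coaction_induction hP with
  | add x y hx hy => simp only [map_add, TensorProduct.tmul_add, hx, hy]
  | hom k r hr =>
  simp only [LinearMap.comp_apply, LinearMap.rTensor_tmul, LinearMap.lTensor_tmul,
    gradedTwist_tmul χ hm hn, gradedTwist_tmul χ hn hr, ← TensorProduct.smul_tmul',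
    TensorProduct.tmul_smul, map_smul, LinearEquiv.coe_coe, TensorProduct.assoc_tmul,
    gradedTwist_tmul χ (tensorCoaction_graded hm hn) hr,
    gradedTwist_tmul χ hm (tensorCoaction_graded hn hr), smul_smul, ← Circle.coe_mul]
  congr 2
  -- What remains is `χ(g, h) χ(g h, k) = χ(h, k) χ(g, h k)`; by bimultiplicativity both sides are
  -- `χ(g, h) χ(g, k) χ(h, k)`.
  simp only [map_mul, MonoidHom.mul_apply]
  rw [mul_comm (χ h k), mul_assoc]

/-- Colinear maps preserve degrees, so the same scalar appears before and after applying them. -/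
theorem gradedTwist_natural {M' N' : Type*} [AddCommGroup M'] [Module ℂ M'] [AddCommGroup N']
    [Module ℂ N'] {δM' : M' →ₗ[ℂ] M' ⊗[ℂ] GroupAlg G} {δN' : N' →ₗ[ℂ] N' ⊗[ℂ] GroupAlg G}
    (χ : G →* G →* Circle) (hM : IsCoaction δM) (hN : IsCoaction δN) (f : M →ₗ[ℂ] M')
    (g : N →ₗ[ℂ] N') (hf : δM' ∘ₗ f = f.rTensor _ ∘ₗ δM) (hg : δN' ∘ₗ g = g.rTensor _ ∘ₗ δN) :
    gradedTwist χ δM' δN' ∘ₗ TensorProduct.map f g =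
      TensorProduct.map f g ∘ₗ gradedTwist χ δM δN := by
  refine LinearMap.ext fun z => ?_
  induction z using graded_tensor_induction hM hN with
  | add x y hx hy => simp only [map_add, hx, hy]
  | hom a b m n hm hn =>
    have hm' : δM' (f m) = f m ⊗ₜ el a := by
      rw [← LinearMap.comp_apply, hf, LinearMap.comp_apply, hm, LinearMap.rTensor_tmul]
    have hn' : δN' (g n) = g n ⊗ₜ el b := by
      rw [← LinearMap.comp_apply, hg, LinearMap.comp_apply, hn, LinearMap.rTensor_tmul]
    rw [LinearMap.comp_apply, LinearMap.comp_apply, TensorProduct.map_tmul,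
      gradedTwist_tmul χ hm' hn', gradedTwist_tmul χ hm hn, map_smul, TensorProduct.map_tmul]

end GradedTwist

/-! ### Pushing coactions forward along maps of coalgebras -/

section Corestriction

variable {C D : Type*} [AddCommGroup C] [Module ℂ C] [AddCommGroup D] [Module ℂ D]

/-- A linear map compatible with coproducts and counits. -/
structure IsCoalgMap [Coalgebra ℂ C] [Coalgebra ℂ D] (f : C →ₗ[ℂ] D) : Prop where
  comul : ∀ x, comul (R := ℂ) (f x) = TensorProduct.map f f (comul x)
  counit : ∀ x, counit (R := ℂ) (f x) = counit (R := ℂ) x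

theorem IsCoalgMap.symm [Coalgebra ℂ C] [Coalgebra ℂ D] {e : C ≃ₗ[ℂ] D}
    (he : IsCoalgMap e.toLinearMap) :
    IsCoalgMap e.symm.toLinearMap where
  comul x := by
    obtain ⟨x, rfl⟩ := e.surjective x
    have h := he.comul x
    simp only [LinearEquiv.coe_coe] at h ⊢
    rw [h, e.symm_apply_apply, ← LinearMap.comp_apply, ← TensorProduct.map_comp]
    simp
  counit x := by
    obtain ⟨x, rfl⟩ := e.surjective x
    simpa using (he.counit x).symm

/-- Comodules are pushed forward along coalgebra maps. -/
theorem IsCoaction.lTensor_comp [Coalgebra ℂ C] [Coalgebra ℂ D] {M : Type*} [AddCommGroup M]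
    [Module ℂ M]
    {δ : M →ₗ[ℂ] M ⊗[ℂ] C} (hδ : IsCoaction δ) {f : C →ₗ[ℂ] D} (hf : IsCoalgMap f) :
    IsCoaction (f.lTensor M ∘ₗ δ) where
  coassoc := by
    have key1 : ∀ z : M ⊗[ℂ] C, TensorProduct.assoc ℂ M D D
        ((f.lTensor M ∘ₗ δ).rTensor D (f.lTensor M z)) =
        (TensorProduct.map f f).lTensor M (TensorProduct.assoc ℂ M C C (δ.rTensor C z)) := by
      intro z
      induction z with
      | zero => simp
      | add x y hx hy => simp only [map_add, hx, hy]
      | tmul m c =>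
        simp only [LinearMap.lTensor_tmul, LinearMap.rTensor_tmul, LinearMap.comp_apply]
        generalize δ m = w
        induction w with
        | zero => simp
        | add x y hx hy => simp only [map_add, hx, hy, TensorProduct.add_tmul]
        | tmul a b => simp
    have key2 : ∀ z : M ⊗[ℂ] C, (Coalgebra.comul : D →ₗ[ℂ] D ⊗[ℂ] D).lTensor M (f.lTensor M z) =
        (TensorProduct.map f f).lTensor M (Coalgebra.comul.lTensor M z) := by
      intro z
      induction z with
      | zero => simp
      | add x y hx hy => simp only [map_add, hx, hy]
      | tmul m c => simp [hf.comul]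
    refine LinearMap.ext fun m => ?_
    have h := LinearMap.congr_fun hδ.coassoc m
    simp only [LinearMap.comp_apply, LinearEquiv.coe_coe] at h key1 ⊢
    rw [key2, ← h, ← key1]
  counit := by
    have hf' : (Coalgebra.counit : D →ₗ[ℂ] ℂ) ∘ₗ f = Coalgebra.counit :=
      LinearMap.ext hf.counit
    rw [← LinearMap.comp_assoc (f := δ), ← LinearMap.lTensor_comp, hf', hδ.counit]

/-- The maps `f` and `g` act on different tensor legs and hence commute. It serves three purposes:
to push morphisms forward along `e`, to pull them back along `e.symm`, and to see that colinear maps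
respect the grading given by `p`. -/
theorem lTensor_comp_natural {M N : Type*} [AddCommGroup M] [Module ℂ M] [AddCommGroup N]
    [Module ℂ N] {δ : M →ₗ[ℂ] M ⊗[ℂ] C} {δ' : N →ₗ[ℂ] N ⊗[ℂ] C} (f : C →ₗ[ℂ] D)
    {g : M →ₗ[ℂ] N} (hg : δ' ∘ₗ g = g.rTensor C ∘ₗ δ) :
    (f.lTensor N ∘ₗ δ') ∘ₗ g = g.rTensor D ∘ₗ f.lTensor M ∘ₗ δ := by
  rw [LinearMap.comp_assoc, hg, ← LinearMap.comp_assoc, ← LinearMap.comp_assoc,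
    LinearMap.lTensor_comp_rTensor, LinearMap.rTensor_comp_lTensor]

/-- The product is used only in the last leg, where `f` respects it. For the degree map `p`, it says
that the grading of a tensor product of comodules is the product grading. The comparison map `e` is
only a coalgebra map, and the rescaling by `χ` takes the place of this identity there. -/
theorem tensorCoaction_lTensor {A B : Type*} [Ring A] [Algebra ℂ A] [Ring B] [Algebra ℂ B]
    {M N : Type*} [AddCommGroup M] [Module ℂ M] [AddCommGroup N] [Module ℂ N]
    (δM : M →ₗ[ℂ] M ⊗[ℂ] A) (δN : N →ₗ[ℂ] N ⊗[ℂ] A) {f : A →ₗ[ℂ] B}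
    (hf : ∀ x y, f (x * y) = f x * f y) :
    f.lTensor (M ⊗[ℂ] N) ∘ₗ tensorCoaction δM δN =
      tensorCoaction (f.lTensor M ∘ₗ δM) (f.lTensor N ∘ₗ δN) := by
  refine TensorProduct.ext' fun m n => ?_
  simp only [tensorCoaction, LinearMap.comp_apply, TensorProduct.map_tmul]
  generalize δM m = x
  generalize δN n = y
  induction x with
  | zero => simp
  | add x x' hx hy => simp only [TensorProduct.add_tmul, map_add, hx, hy]
  | tmul m b =>
    induction y with
    | zero => simp
    | add x y hx hy => simp only [TensorProduct.tmul_add, map_add, hx, hy]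
    | tmul n c => simp [hf]

end Corestriction

/-! ### Isomorphic coalgebras have equivalent categories of comodules -/

section CoalgIso

variable {A B : Type v} [Ring A] [Bialgebra ℂ A] [Ring B] [Bialgebra ℂ B] {e : A ≃ₗ[ℂ] B}

/-- The functor between categories of comodules induced by an isomorphism of coalgebras. -/
def comodFunctor (he : IsCoalgMap e.toLinearMap) : ComodCat.{v, w} A ⥤ ComodCat.{v, w} B where
  obj M := ⟨M.carrier, e.toLinearMap.lTensor M.carrier ∘ₗ M.coact, M.isCoaction.lTensor_comp he⟩
  map {M N} f :=
    ⟨ComodCat.Hom.lin (M := M) (N := N) f,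
      lTensor_comp_natural e.toLinearMap (ComodCat.Hom.comm (M := M) (N := N) f)⟩

theorem lTensor_symm_comp {M : Type*} [AddCommGroup M] [Module ℂ M] (e : A ≃ₗ[ℂ] B)
    (δ : M →ₗ[ℂ] M ⊗[ℂ] A) :
    e.symm.toLinearMap.lTensor M ∘ₗ e.toLinearMap.lTensor M ∘ₗ δ = δ := by
  rw [← LinearMap.comp_assoc, ← LinearMap.lTensor_comp]
  simp

variable (he : IsCoalgMap e.toLinearMap)

instance : (comodFunctor.{v, w} he).Additive where
  map_add := rfl

instance : (comodFunctor.{v, w} he).Linear ℂ where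
  map_smul _ _ := rfl

instance : (comodFunctor.{v, w} he).Faithful where
  map_injective {M N _ _} h := ComodCat.hom_ext (M := M) (N := N)
    (congrArg (ComodCat.Hom.lin (M := (comodFunctor he).obj M) (N := (comodFunctor he).obj N)) h)

instance : (comodFunctor.{v, w} he).Full where
  map_surjective {M N} f := ⟨⟨ComodCat.Hom.lin
      (M := (comodFunctor he).obj M) (N := (comodFunctor he).obj N) f, by
    -- A linear map that is colinear over `B` after pushing forward along `e` is colinear over `A`,
    -- as one sees by pushing forward once more along `e.symm`.
    have h := lTensor_comp_natural e.symm.toLinearMap (ComodCat.Hom.comm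
      (M := (comodFunctor he).obj M) (N := (comodFunctor he).obj N) f)
    have h1 := lTensor_symm_comp e M.coact
    have h2 := lTensor_symm_comp e N.coact
    change (e.symm.toLinearMap.lTensor N.carrier ∘ₗ e.toLinearMap.lTensor N.carrier ∘ₗ N.coact) ∘ₗ
      _ = _ ∘ₗ e.symm.toLinearMap.lTensor M.carrier ∘ₗ e.toLinearMap.lTensor M.carrier ∘ₗ M.coact
      at h
    rwa [h1, h2] at h⟩, rfl⟩

instance : (comodFunctor.{v, w} he).EssSurj where
  mem_essImage M := ⟨(comodFunctor.{v, w} he.symm).obj M,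
    -- The preimage of `M` is `M` pushed forward along `e.symm`. Applying the functor to it restores
    -- the original coaction on the same vector space, so the identity map is the required
    -- isomorphism.
    ⟨ComodCat.mkIso (LinearEquiv.refl ℂ M.carrier) (by
      have h := lTensor_symm_comp e.symm M.coact
      change M.coact ∘ₗ LinearMap.id = LinearMap.rTensor B LinearMap.id ∘ₗ
        e.symm.symm.toLinearMap.lTensor M.carrier ∘ₗ e.symm.toLinearMap.lTensor M.carrier ∘ₗ M.coact
      rw [h, LinearMap.rTensor_id, LinearMap.comp_id, LinearMap.id_comp])⟩⟩

instance : (comodFunctor.{v, w} he).IsEquivalence where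

end CoalgIso

/-! ### The twisting identity for products -/

section CocycleTwist

variable {A B : Type v} [Ring A] [Bialgebra ℂ A] [Ring B] [Bialgebra ℂ B]
  {G : Type u} [CommGroup G]

/-- The left-hand side is `e(x₍₁₎ y₍₁₎) χ(p x₍₂₎, p y₍₂₎)`. It depends on the coproducts only
through `x₍₁₎ ⊗ p(x₍₂₎)` and `y₍₁₎ ⊗ p(y₍₂₎)`, which the right degrees make into simple tensors. -/
theorem twist_right_degree {χ : G →* G →* Circle} {p : A →ₗ[ℂ] GroupAlg G} {x y : A} {s t : G}
    (e : A ≃ₗ[ℂ] B) (hx : p.lTensor A (comul x) = x ⊗ₜ el s)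
    (hy : p.lTensor A (comul y) = y ⊗ₜ el t) :
    TensorProduct.rid ℂ B (TensorProduct.map (e.toLinearMap ∘ₗ LinearMap.mul' ℂ A)
      (bicharForm χ ∘ₗ TensorProduct.map p p)
      (TensorProduct.tensorTensorTensorComm ℂ A A A A (comul x ⊗ₜ comul y))) =
    (χ s t : ℂ) • e (x * y) := by
  have key : ∀ z w : A ⊗[ℂ] A,
      TensorProduct.rid ℂ B (TensorProduct.map (e.toLinearMap ∘ₗ LinearMap.mul' ℂ A)
        (bicharForm χ ∘ₗ TensorProduct.map p p)
        (TensorProduct.tensorTensorTensorComm ℂ A A A A (z ⊗ₜ w))) =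
      TensorProduct.rid ℂ B (TensorProduct.map (e.toLinearMap ∘ₗ LinearMap.mul' ℂ A) (bicharForm χ)
        (TensorProduct.tensorTensorTensorComm ℂ A _ A _ (p.lTensor A z ⊗ₜ p.lTensor A w))) := by
    intro z w
    induction z with
    | zero => simp
    | add x y hx hy => simp only [TensorProduct.add_tmul, map_add, hx, hy]
    | tmul a b =>
      induction w with
      | zero => simp
      | add x y hx hy => simp only [TensorProduct.tmul_add, map_add, hx, hy]
      | tmul c d => simp
  rw [key, hx, hy, TensorProduct.tensorTensorTensorComm_tmul, TensorProduct.map_tmul,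
    bicharForm_el, TensorProduct.rid_tmul]
  rfl

/-- The mirror image for `χ(p x₍₁₎, p y₍₁₎) e(x₍₂₎) e(y₍₂₎)`, which sees the coproducts only through
`p(x₍₁₎) ⊗ x₍₂₎` and `p(y₍₁₎) ⊗ y₍₂₎`. -/
theorem twist_left_degree {χ : G →* G →* Circle} {p : A →ₗ[ℂ] GroupAlg G} {x y : A} {s t : G}
    (e : A ≃ₗ[ℂ] B) (hx : p.rTensor A (comul x) = el s ⊗ₜ x)
    (hy : p.rTensor A (comul y) = el t ⊗ₜ y) :
    TensorProduct.lid ℂ B (TensorProduct.map (bicharForm χ ∘ₗ TensorProduct.map p p)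
      (LinearMap.mul' ℂ B ∘ₗ TensorProduct.map e.toLinearMap e.toLinearMap)
      (TensorProduct.tensorTensorTensorComm ℂ A A A A (comul x ⊗ₜ comul y))) =
    (χ s t : ℂ) • (e x * e y) := by
  have key : ∀ z w : A ⊗[ℂ] A,
      TensorProduct.lid ℂ B (TensorProduct.map (bicharForm χ ∘ₗ TensorProduct.map p p)
        (LinearMap.mul' ℂ B ∘ₗ TensorProduct.map e.toLinearMap e.toLinearMap)
        (TensorProduct.tensorTensorTensorComm ℂ A A A A (z ⊗ₜ w))) =
      TensorProduct.lid ℂ B (TensorProduct.map (bicharForm χ)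
        (LinearMap.mul' ℂ B ∘ₗ TensorProduct.map e.toLinearMap e.toLinearMap)
        (TensorProduct.tensorTensorTensorComm ℂ _ A _ A (p.rTensor A z ⊗ₜ p.rTensor A w))) := by
    intro z w
    induction z with
    | zero => simp
    | add x y hx hy => simp only [TensorProduct.add_tmul, map_add, hx, hy]
    | tmul a b =>
      induction w with
      | zero => simp
      | add x y hx hy => simp only [TensorProduct.tmul_add, map_add, hx, hy]
      | tmul c d => simp
  rw [key, hx, hy, TensorProduct.tensorTensorTensorComm_tmul, TensorProduct.map_tmul,
    bicharForm_el, TensorProduct.lid_tmul]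
  rfl

/-- The twisting identity can be checked on a spanning family of homogeneous elements. -/
theorem twist_of_homogeneous {χ : G →* G →* Circle} {e : A ≃ₗ[ℂ] B} {p : A →ₗ[ℂ] GroupAlg G}
    (D : A → G → G → Prop)
    (hD : ∀ {P : A → Prop} (_ : ∀ x y, P x → P y → P (x + y)) (_ : ∀ x s t, D x s t → P x) x, P x)
    (hl : ∀ x s t, D x s t → p.rTensor A (comul x) = el s ⊗ₜ x)
    (hr : ∀ x s t, D x s t → p.lTensor A (comul x) = x ⊗ₜ el t)
    (hmul : ∀ x s t y s' t', D x s t → D y s' t' →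
      (χ t t' : ℂ) • e (x * y) = (χ s s' : ℂ) • (e x * e y)) (x y : A) :
    TensorProduct.rid ℂ B (TensorProduct.map (e.toLinearMap ∘ₗ LinearMap.mul' ℂ A)
      (bicharForm χ ∘ₗ TensorProduct.map p p)
      (TensorProduct.tensorTensorTensorComm ℂ A A A A (comul x ⊗ₜ comul y))) =
    TensorProduct.lid ℂ B (TensorProduct.map (bicharForm χ ∘ₗ TensorProduct.map p p)
      (LinearMap.mul' ℂ B ∘ₗ TensorProduct.map e.toLinearMap e.toLinearMap)
      (TensorProduct.tensorTensorTensorComm ℂ A A A A (comul x ⊗ₜ comul y))) := by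
  -- The relation `D x s t` records that `x` has left degree `s` and right degree `t`. Both sides
  -- are additive in `x` and in `y`, so such elements suffice, and on them each side collapses to a
  -- single scalar times a product.
  revert x
  refine hD (fun x x' hx hx' => ?_) fun x s t hx => ?_
  · simp only [map_add, TensorProduct.add_tmul, hx, hx']
  revert y
  refine hD (fun y y' hy hy' => ?_) fun y s' t' hy => ?_
  · simp only [map_add, TensorProduct.tmul_add, hy, hy']
  rw [twist_right_degree e (hr x s t hx) (hr y s' t' hy),
    twist_left_degree e (hl x s t hx) (hl y s' t' hy), hmul x s t y s' t' hx hy]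

/-- `e` is an isomorphism of coalgebras, and it transforms the product of `A` into the twist of
the product of `B` by the 2-cocycle `χ ∘ (p ⊗ p)`, where `p : A → ℂG` is a bialgebra map. -/
structure IsCocycleTwist (χ : G →* G →* Circle) (e : A ≃ₗ[ℂ] B) (p : A →ₗ[ℂ] GroupAlg G) :
    Prop where
  coalgMap : IsCoalgMap e.toLinearMap
  map_one : e 1 = 1
  degree_coalgMap : IsCoalgMap p
  degree_one : p 1 = 1
  degree_mul : ∀ x y, p (x * y) = p x * p y
  twist : ∀ x y : A,
    TensorProduct.rid ℂ B (TensorProduct.map (e.toLinearMap ∘ₗ LinearMap.mul' ℂ A)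
      (bicharForm χ ∘ₗ TensorProduct.map p p)
      (TensorProduct.tensorTensorTensorComm ℂ A A A A (comul x ⊗ₜ comul y))) =
    TensorProduct.lid ℂ B (TensorProduct.map (bicharForm χ ∘ₗ TensorProduct.map p p)
      (LinearMap.mul' ℂ B ∘ₗ TensorProduct.map e.toLinearMap e.toLinearMap)
      (TensorProduct.tensorTensorTensorComm ℂ A A A A (comul x ⊗ₜ comul y)))

namespace IsCocycleTwist

open scoped MonoidalCategory

variable {χ : G →* G →* Circle} {e : A ≃ₗ[ℂ] B} {p : A →ₗ[ℂ] GroupAlg G}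

/-- By coassociativity, both sides arise from `m₍₀₎ ⊗ m₍₁₎ ⊗ m₍₂₎` and `n₍₀₎ ⊗ n₍₁₎ ⊗ n₍₂₎`.
Rescaling before coacting gives `m₍₀₎ ⊗ n₍₀₎ ⊗ e(m₍₁₎ n₍₁₎) χ(p m₍₂₎, p n₍₂₎)`, and rescaling
afterwards gives `m₍₀₎ ⊗ n₍₀₎ ⊗ χ(p m₍₁₎, p n₍₁₎) e(m₍₂₎) e(n₍₂₎)`. The twisting identity equates
the two in `B`. -/
theorem gradedTwist_colinear (h : IsCocycleTwist χ e p) {M N : Type*} [AddCommGroup M] [Module ℂ M]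
    [AddCommGroup N] [Module ℂ N] {δM : M →ₗ[ℂ] M ⊗[ℂ] A} {δN : N →ₗ[ℂ] N ⊗[ℂ] A}
    (hM : IsCoaction δM) (hN : IsCoaction δN) :
    (e.toLinearMap.lTensor (M ⊗[ℂ] N) ∘ₗ tensorCoaction δM δN) ∘ₗ
        gradedTwist χ (p.lTensor M ∘ₗ δM) (p.lTensor N ∘ₗ δN) =
      (gradedTwist χ (p.lTensor M ∘ₗ δM) (p.lTensor N ∘ₗ δN)).rTensor B ∘ₗ
        tensorCoaction (e.toLinearMap.lTensor M ∘ₗ δM) (e.toLinearMap.lTensor N ∘ₗ δN) := by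
  -- Rescale, then coact: the outer leg of each coaction feeds `χ`, and the inner legs are
  -- multiplied in `A` before `e` is applied. General tensors `x` and `y` replace `δM m` and `δN n`
  -- so that induction is possible.
  have key1 : ∀ (x : M ⊗[ℂ] A) (y : N ⊗[ℂ] A),
      e.toLinearMap.lTensor (M ⊗[ℂ] N) (tensorCoaction δM δN
        (TensorProduct.rid ℂ (M ⊗[ℂ] N) ((bicharForm χ).lTensor (M ⊗[ℂ] N)
          (TensorProduct.tensorTensorTensorComm ℂ M _ N _ (p.lTensor M x ⊗ₜ p.lTensor N y))))) =
      ((TensorProduct.rid ℂ B).toLinearMap ∘ₗ TensorProduct.map (e.toLinearMap ∘ₗ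
          LinearMap.mul' ℂ A) (bicharForm χ ∘ₗ TensorProduct.map p p) ∘ₗ
          (TensorProduct.tensorTensorTensorComm ℂ A A A A).toLinearMap).lTensor (M ⊗[ℂ] N)
        (TensorProduct.tensorTensorTensorComm ℂ M (A ⊗[ℂ] A) N (A ⊗[ℂ] A)
          ((TensorProduct.assoc ℂ M A A (δM.rTensor A x)) ⊗ₜ
            (TensorProduct.assoc ℂ N A A (δN.rTensor A y)))) := by
    intro x y
    induction x with
    | zero => simp
    | add x x' hx hx' => simp only [TensorProduct.add_tmul, map_add, hx, hx']
    | tmul m a =>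
      induction y with
      | zero => simp
      | add y y' hy hy' => simp only [TensorProduct.tmul_add, map_add, hy, hy']
      | tmul n b =>
        simp only [tensorTensorTensorComm_tmul, LinearMap.lTensor_tmul, LinearMap.rTensor_tmul,
          TensorProduct.rid_tmul, map_smul, tensorCoaction, LinearMap.comp_apply,
          LinearEquiv.coe_coe, TensorProduct.map_tmul]
        generalize δM m = x
        generalize δN n = y
        induction x with
        | zero => simp
        | add x x' hx hx' => simp only [TensorProduct.add_tmul, map_add, smul_add, hx, hx']
        | tmul m a =>
          induction y with
          | zero => simp
          | add y y' hy hy' =>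
            simp only [TensorProduct.tmul_add, TensorProduct.add_tmul, map_add, smul_add, hy, hy']
          | tmul n c => simp
  -- Coact, then rescale: now the inner legs feed `χ`, and the outer legs are sent to `B` and
  -- multiplied there.
  have key2 : ∀ (x : M ⊗[ℂ] A) (y : N ⊗[ℂ] A),
      (gradedTwist χ (p.lTensor M ∘ₗ δM) (p.lTensor N ∘ₗ δN)).rTensor B
        ((LinearMap.mul' ℂ B).lTensor (M ⊗[ℂ] N) (TensorProduct.tensorTensorTensorComm ℂ M B N B
          (e.toLinearMap.lTensor M x ⊗ₜ e.toLinearMap.lTensor N y))) =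
      ((TensorProduct.lid ℂ B).toLinearMap ∘ₗ TensorProduct.map (bicharForm χ ∘ₗ
          TensorProduct.map p p) (LinearMap.mul' ℂ B ∘ₗ
          TensorProduct.map e.toLinearMap e.toLinearMap) ∘ₗ
          (TensorProduct.tensorTensorTensorComm ℂ A A A A).toLinearMap).lTensor (M ⊗[ℂ] N)
        (TensorProduct.tensorTensorTensorComm ℂ M (A ⊗[ℂ] A) N (A ⊗[ℂ] A)
          ((TensorProduct.assoc ℂ M A A (δM.rTensor A x)) ⊗ₜ
            (TensorProduct.assoc ℂ N A A (δN.rTensor A y)))) := by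
    intro x y
    induction x with
    | zero => simp
    | add x x' hx hx' => simp only [TensorProduct.add_tmul, map_add, hx, hx']
    | tmul m a =>
      induction y with
      | zero => simp
      | add y y' hy hy' => simp only [TensorProduct.tmul_add, map_add, hy, hy']
      | tmul n b =>
        simp only [tensorTensorTensorComm_tmul, LinearMap.lTensor_tmul, LinearMap.rTensor_tmul,
          gradedTwist, LinearMap.comp_apply, LinearEquiv.coe_coe, TensorProduct.map_tmul]
        generalize δM m = x
        generalize δN n = y
        induction x with
        | zero => simp
        | add x x' hx hx' => simp only [TensorProduct.add_tmul, map_add, hx, hx']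
        | tmul m a =>
          induction y with
          | zero => simp
          | add y y' hy hy' =>
            simp only [TensorProduct.tmul_add, TensorProduct.add_tmul, map_add, hy, hy']
          | tmul n c => simp [TensorProduct.smul_tmul']
  -- Once coassociativity has replaced the iterated coactions by coproducts in `A`, this is the
  -- twisting identity applied in the last leg.
  have key3 : ∀ (x : M ⊗[ℂ] A) (y : N ⊗[ℂ] A),
      ((TensorProduct.rid ℂ B).toLinearMap ∘ₗ TensorProduct.map (e.toLinearMap ∘ₗ
          LinearMap.mul' ℂ A) (bicharForm χ ∘ₗ TensorProduct.map p p) ∘ₗ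
          (TensorProduct.tensorTensorTensorComm ℂ A A A A).toLinearMap).lTensor (M ⊗[ℂ] N)
        (TensorProduct.tensorTensorTensorComm ℂ M (A ⊗[ℂ] A) N (A ⊗[ℂ] A)
          (comul.lTensor M x ⊗ₜ comul.lTensor N y)) =
      ((TensorProduct.lid ℂ B).toLinearMap ∘ₗ TensorProduct.map (bicharForm χ ∘ₗ
          TensorProduct.map p p) (LinearMap.mul' ℂ B ∘ₗ
          TensorProduct.map e.toLinearMap e.toLinearMap) ∘ₗ
          (TensorProduct.tensorTensorTensorComm ℂ A A A A).toLinearMap).lTensor (M ⊗[ℂ] N)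
        (TensorProduct.tensorTensorTensorComm ℂ M (A ⊗[ℂ] A) N (A ⊗[ℂ] A)
          (comul.lTensor M x ⊗ₜ comul.lTensor N y)) := by
    intro x y
    induction x with
    | zero => simp
    | add x x' hx hx' => simp only [TensorProduct.add_tmul, map_add, hx, hx']
    | tmul m a =>
      induction y with
      | zero => simp
      | add y y' hy hy' => simp only [TensorProduct.tmul_add, map_add, hy, hy']
      | tmul n b =>
        simp only [tensorTensorTensorComm_tmul, LinearMap.lTensor_tmul, LinearMap.comp_apply,
          LinearEquiv.coe_coe, h.twist]
  refine TensorProduct.ext' fun m n => ?_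
  have h1 := LinearMap.congr_fun hM.coassoc m
  have h2 := LinearMap.congr_fun hN.coassoc n
  have k1 := key1 (δM m) (δN n)
  have k2 := key2 (δM m) (δN n)
  simp only [LinearMap.comp_apply, LinearEquiv.coe_coe] at h1 h2
  rw [h1, h2] at k1 k2
  exact (k1.trans (key3 (δM m) (δN n))).trans k2.symm

/-! ### The monoidal structure of the comparison functor -/

variable (h : IsCocycleTwist χ e p)

/-- The `G`-grading of an `A`-comodule. -/
theorem isCoaction_degree (h : IsCocycleTwist χ e p) (M : ComodCat.{v, w} A) :
    IsCoaction (p.lTensor M.carrier ∘ₗ M.coact) :=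
  M.isCoaction.lTensor_comp h.degree_coalgMap

/-- The tensor structure `m ⊗ n ↦ χ(|m|, |n|) m ⊗ n`. -/
def tensorIso (M N : ComodCat.{v, w} A) :
    MonoidalCategory.tensorObj ((comodFunctor h.coalgMap).obj M) ((comodFunctor h.coalgMap).obj N) ≅
      (comodFunctor h.coalgMap).obj (MonoidalCategory.tensorObj M N) :=
  ComodCat.mkIso (gradedTwistEquiv χ (h.isCoaction_degree M) (h.isCoaction_degree N))
    (h.gradedTwist_colinear M.isCoaction N.isCoaction)

/-- The unit isomorphism. -/
def unitIso : MonoidalCategory.tensorUnit (ComodCat.{v, w} B) ≅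
    (comodFunctor h.coalgMap).obj (MonoidalCategory.tensorUnit (ComodCat.{v, w} A)) :=
  ComodCat.mkIso (LinearEquiv.refl ℂ (ULift.{w} ℂ)) (by
    refine LinearMap.ext fun c => ?_
    change c ⊗ₜ[ℂ] e 1 = c ⊗ₜ[ℂ] (1 : B)
    rw [h.map_one])

theorem tensorIso_natural_left {X Y : ComodCat.{v, w} A} (f : X ⟶ Y) (Z : ComodCat.{v, w} A) :
    (comodFunctor h.coalgMap).map f ▷ (comodFunctor h.coalgMap).obj Z ≫ (h.tensorIso Y Z).hom =
      (h.tensorIso X Z).hom ≫ (comodFunctor h.coalgMap).map (f ▷ Z) :=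
  ComodCat.hom_ext (gradedTwist_natural χ (h.isCoaction_degree X) (h.isCoaction_degree Z)
    (ComodCat.Hom.lin (M := X) (N := Y) f) LinearMap.id
    (lTensor_comp_natural p (ComodCat.Hom.comm (M := X) (N := Y) f))
    (by rw [LinearMap.rTensor_id, LinearMap.comp_id, LinearMap.id_comp]))

theorem tensorIso_natural_right {X Y : ComodCat.{v, w} A} (Z : ComodCat.{v, w} A) (f : X ⟶ Y) :
    (comodFunctor h.coalgMap).obj Z ◁ (comodFunctor h.coalgMap).map f ≫ (h.tensorIso Z Y).hom =
      (h.tensorIso Z X).hom ≫ (comodFunctor h.coalgMap).map (Z ◁ f) :=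
  ComodCat.hom_ext (gradedTwist_natural χ (h.isCoaction_degree Z) (h.isCoaction_degree X)
    LinearMap.id (ComodCat.Hom.lin (M := X) (N := Y) f)
    (by rw [LinearMap.rTensor_id, LinearMap.comp_id, LinearMap.id_comp])
    (lTensor_comp_natural p (ComodCat.Hom.comm (M := X) (N := Y) f)))

theorem tensorIso_assoc (X Y Z : ComodCat.{v, w} A) :
    (h.tensorIso X Y).hom ▷ (comodFunctor h.coalgMap).obj Z ≫ (h.tensorIso (X ⊗ Y) Z).hom ≫
        (comodFunctor h.coalgMap).map (α_ X Y Z).hom =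
      (α_ ((comodFunctor h.coalgMap).obj X) ((comodFunctor h.coalgMap).obj Y)
        ((comodFunctor h.coalgMap).obj Z)).hom ≫
        (comodFunctor h.coalgMap).obj X ◁ (h.tensorIso Y Z).hom ≫ (h.tensorIso X (Y ⊗ Z)).hom := by
  have h1 := gradedTwist_assoc χ (h.isCoaction_degree X) (h.isCoaction_degree Y)
    (h.isCoaction_degree Z)
  -- The cocycle identity uses the product gradings on `X ⊗ Y` and `Y ⊗ Z`, whereas `tensorIso` uses
  -- the gradings induced from the `A`-coactions. They agree because `p` is multiplicative.
  rw [← tensorCoaction_lTensor _ _ h.degree_mul, ← tensorCoaction_lTensor _ _ h.degree_mul] at h1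
  exact ComodCat.hom_ext h1

theorem left_unit (X : ComodCat.{v, w} A) :
    (λ_ ((comodFunctor h.coalgMap).obj X)).hom =
      h.unitIso.hom ▷ (comodFunctor h.coalgMap).obj X ≫
        (h.tensorIso (𝟙_ (ComodCat.{v, w} A)) X).hom ≫
          (comodFunctor h.coalgMap).map (λ_ X).hom := by
  refine ComodCat.hom_ext (TensorProduct.ext' fun c m => ?_)
  refine (congrArg (ComodCat.lidEquiv X.carrier)
    (gradedTwist_one_left χ (h.isCoaction_degree X) (m := c) ?_ m)).symm
  -- The unit comodule lies in degree `1` because `p 1 = 1`, so no rescaling occurs.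
  exact congrArg (fun k : GroupAlg G => c ⊗ₜ[ℂ] k) h.degree_one

theorem right_unit (X : ComodCat.{v, w} A) :
    (ρ_ ((comodFunctor h.coalgMap).obj X)).hom =
      (comodFunctor h.coalgMap).obj X ◁ h.unitIso.hom ≫
        (h.tensorIso X (𝟙_ (ComodCat.{v, w} A))).hom ≫
          (comodFunctor h.coalgMap).map (ρ_ X).hom := by
  refine ComodCat.hom_ext (TensorProduct.ext' fun m c => ?_)
  refine (congrArg (ComodCat.ridEquiv X.carrier)
    (gradedTwist_one_right χ (h.isCoaction_degree X) (n := c) ?_ m)).symm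
  exact congrArg (fun k : GroupAlg G => c ⊗ₜ[ℂ] k) h.degree_one

/-- A cocycle twist induces a monoidal equivalence between the categories of comodules. -/
theorem exists_monoidal_equivalence (h : IsCocycleTwist χ e p) :
    ∃ F : ComodCat.{v, w} A ≌ ComodCat.{v, w} B,
      F.functor.Additive ∧ F.functor.Linear ℂ ∧ Nonempty F.functor.Monoidal :=
  ⟨(comodFunctor h.coalgMap).asEquivalence,
    inferInstanceAs (comodFunctor.{v, w} h.coalgMap).Additive,
    inferInstanceAs ((comodFunctor.{v, w} h.coalgMap).Linear ℂ),
    ⟨Functor.CoreMonoidal.toMonoidal (F := comodFunctor.{v, w} h.coalgMap)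
      { εIso := h.unitIso
        μIso := h.tensorIso
        μIso_hom_natural_left := h.tensorIso_natural_left
        μIso_hom_natural_right := h.tensorIso_natural_right
        associativity := h.tensorIso_assoc
        left_unitality := h.left_unit
        right_unitality := h.right_unit }⟩⟩

end IsCocycleTwist

end CocycleTwist

/-! ### The grading of the bosonization -/

section BosonizationDegree

variable {Γ Γ₀ : Type u} [CommGroup Γ] [CommGroup Γ₀] {H : Type v} [Ring H] [HopfAlgebra ℂ H]
  {π : H →ₐc[ℂ] GroupAlg Γ} {i : Γ₀ →* Γ} {β : Γ →* Γ →* Circle}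

/-- Apply `ι ⊗ ε` to `(π ⊗ ι) Δ(x) = a ⊗ x`. Together with `IsBihom.counit_eq`, it shows that `π`
vanishes on `H_{a,b}` for `a ≠ b`. -/
theorem IsBihom.map_eq {a b : Γ} {x : H} (hx : IsBihom π a b x) :
    π x = counit (R := ℂ) x • el a := by
  have key : ∀ z : H ⊗[ℂ] H, TensorProduct.rid ℂ _ (counit.lTensor _
      ((π : H →ₗ[ℂ] GroupAlg Γ).rTensor H z)) = π (TensorProduct.rid ℂ _ (counit.lTensor _ z)) := by
    intro z
    induction z with
    | zero => simp
    | add x y hx hy => simp only [map_add, hx, hy]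
    | tmul u v => simp
  have k := key (comul x)
  rw [hx.1] at k
  simpa using k.symm

/-- The bicharacter `((k, a), (l, b)) ↦ β(a, i(l)⁻¹ b)` of `Γ₀ × Γ`. -/
def twistBichar (i : Γ₀ →* Γ) (β : Γ →* Γ →* Circle) : Γ₀ × Γ →* Γ₀ × Γ →* Circle :=
  (β.comp (MonoidHom.snd Γ₀ Γ)).compl₂ ((i.comp (MonoidHom.fst Γ₀ Γ))⁻¹ * MonoidHom.snd Γ₀ Γ)

theorem twistBichar_apply (i : Γ₀ →* Γ) (β : Γ →* Γ →* Circle) (k l : Γ₀) (a b : Γ) :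
    twistBichar i β (k, a) (l, b) = β a ((i l)⁻¹ * b) := rfl

variable {β₀ β₁ : Γ₀ →* Γ₀ →* Circle} {A : BraidedBialgebra.{u, v} (GroupAlg Γ₀) (bicharForm β₀)}
  {B : BraidedBialgebra.{u, v} (GroupAlg Γ₀) (bicharForm β₁)}
  {e : H ≃ₗ[ℂ] A.carrier} {f : H ≃ₗ[ℂ] B.carrier}

/-- The map `k # x ↦ (k, π(x))` from `ℂΓ₀ # A` to `ℂ(Γ₀ × Γ)`. -/
def bosDegree (π : H →ₐc[ℂ] GroupAlg Γ) (e : H ≃ₗ[ℂ] A.carrier) :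
    GroupAlg Γ₀ ⊗[ℂ] A.carrier →ₗ[ℂ] GroupAlg (Γ₀ × Γ) :=
  LinearMap.mul' ℂ (GroupAlg (Γ₀ × Γ)) ∘ₗ TensorProduct.map
    (MonoidAlgebra.mapDomainBialgHom ℂ (MonoidHom.inl Γ₀ Γ) : GroupAlg Γ₀ →ₗ[ℂ] GroupAlg (Γ₀ × Γ))
    ((MonoidAlgebra.mapDomainBialgHom ℂ (MonoidHom.inr Γ₀ Γ) : GroupAlg Γ →ₗ[ℂ] GroupAlg (Γ₀ × Γ))
      ∘ₗ (π : H →ₗ[ℂ] GroupAlg Γ) ∘ₗ e.symm.toLinearMap)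

theorem bosDegree_tmul (k : Γ₀) {a b : Γ} {x : H} (hx : IsBihom π a b x) :
    bosDegree π e (el k ⊗ₜ e x) = counit (R := ℂ) x • el (k, a) := by
  simp [bosDegree, hx.map_eq]

/-- The scalar has two sources: `β₀(g, l)` from moving `x` past `l` in the smash product, and `β(a⁻¹
b, c⁻¹)` from the transmuted product of `x` and `y`. -/
theorem smashMul_bihom (hA : IsTransmuted π i β e A.coact) (k l : Γ₀) {a b c d : Γ} {g : Γ₀}
    {x y : H} (hx : IsBihom π a b x) (hg : i g = a⁻¹ * b) (hy : IsBihom π c d y) :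
    smashMul A ((el k ⊗ₜ e x) ⊗ₜ (el l ⊗ₜ e y)) =
      ((β₀ g l : ℂ) * (β (a⁻¹ * b) c⁻¹ : ℂ)) • (el (k * l) ⊗ₜ e (x * y)) := by
  rw [Bosonization.smashMul_tmul (hA.coact _ _ _ _ hx hg), hA.mul _ _ _ _ _ _ hx hy,
    TensorProduct.tmul_smul, smul_smul]

theorem bos_induction (hA : IsTransmuted π i β e A.coact) {P : GroupAlg Γ₀ ⊗[ℂ] A.carrier → Prop}
    (add : ∀ x y, P x → P y → P (x + y))
    (hom : ∀ (k : Γ₀) (a b : Γ) (g : Γ₀) (x : H), IsBihom π a b x → i g = a⁻¹ * b →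
      P (el k ⊗ₜ e x)) (z : GroupAlg Γ₀ ⊗[ℂ] A.carrier) : P z := by
  have hom' : ∀ (k : Γ₀) (y : A.carrier), P (el k ⊗ₜ y) := by
    intro k y
    induction y using hA.induction with
    | add x y hx hy => rw [TensorProduct.tmul_add]; exact add _ _ hx hy
    | hom a b g x hx hg => exact hom k a b g x hx hg
  exact Bosonization.induction add (fun k _ y _ => hom' k y) z

/-- The coproduct of `k # x` is a sum of terms `(k # u) ⊗ (k g # v)` with `u ∈ H_{a,c}` and `i(g) =
a⁻¹ c`. Since `p(k # u) = ε(u) (k, a)` vanishes unless `c = a`, only terms with `g = 1` survive, and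
the counit axiom reassembles `x`. -/
theorem bosDegree_left (hA : IsTransmuted π i β e A.coact) (k : Γ₀) {a b : Γ} {x : H}
    (hx : IsBihom π a b x) :
    (bosDegree π e).rTensor _ (smashComul A (el k ⊗ₜ e x)) = el (k, a) ⊗ₜ (el k ⊗ₜ e x) := by
  -- The counit is kept on the right-hand side so that both sides are linear in the coproduct of `x`
  -- and can be compared term by term.
  have key : (bosDegree π e).rTensor _ (Bosonization.comulAux A k
      (TensorProduct.map e.toLinearMap e.toLinearMap (comul x))) =
      el (k, a) ⊗ₜ (el k ⊗ₜ e (TensorProduct.lid ℂ H (counit.rTensor H (comul x)))) := by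
    refine hA.deg.comul_induction hx (P := fun z => (bosDegree π e).rTensor _
      (Bosonization.comulAux A k (TensorProduct.map e.toLinearMap e.toLinearMap z)) =
      el (k, a) ⊗ₜ (el k ⊗ₜ e (TensorProduct.lid ℂ H (counit.rTensor H z))))
      (fun z w hz hw => ?_) (fun c u v g _ hu _ hg _ => ?_) (by simp)
    · simp only [map_add, hz, hw, TensorProduct.tmul_add]
    · rw [TensorProduct.map_tmul, LinearEquiv.coe_coe,
        Bosonization.comulAux_tmul k (hA.coact _ _ _ _ hu hg), LinearMap.rTensor_tmul,
        bosDegree_tmul k hu, LinearMap.rTensor_tmul, TensorProduct.lid_tmul, map_smul]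
      by_cases h0 : counit (R := ℂ) u = 0
      · simp [h0]
      · have h1 : g = 1 := hA.inj (by rw [hg, hu.counit_eq h0]; simp)
        rw [h1, mul_one, TensorProduct.tmul_smul, TensorProduct.tmul_smul,
          TensorProduct.smul_tmul']
  rw [Bosonization.smashComul_tmul, hA.comul, key, Coalgebra.rTensor_counit_comul,
    TensorProduct.lid_tmul, one_smul]

/-- In a term `(k # u) ⊗ (k l # v)` with `v ∈ H_{c,b}`, the map `p` gives `ε(v) (k l, c)`. It
vanishes unless `c = b`, and then `l = g` by injectivity of `i`. The shift `k ↦ k g` is the effect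
of the smash coproduct. -/
theorem bosDegree_right (hA : IsTransmuted π i β e A.coact) (k : Γ₀) {a b : Γ} {g : Γ₀} {x : H}
    (hx : IsBihom π a b x) (hg : i g = a⁻¹ * b) :
    (bosDegree π e).lTensor _ (smashComul A (el k ⊗ₜ e x)) = (el k ⊗ₜ e x) ⊗ₜ el (k * g, b) := by
  have key : (bosDegree π e).lTensor _ (Bosonization.comulAux A k
      (TensorProduct.map e.toLinearMap e.toLinearMap (comul x))) =
      (el k ⊗ₜ e (TensorProduct.rid ℂ H (counit.lTensor H (comul x)))) ⊗ₜ el (k * g, b) := by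
    refine hA.deg.comul_induction hx (P := fun z => (bosDegree π e).lTensor _
      (Bosonization.comulAux A k (TensorProduct.map e.toLinearMap e.toLinearMap z)) =
      (el k ⊗ₜ e (TensorProduct.rid ℂ H (counit.lTensor H z))) ⊗ₜ el (k * g, b))
      (fun z w hz hw => ?_) (fun c u v l _ hu hv hl _ => ?_) (by simp)
    · simp only [map_add, hz, hw, TensorProduct.tmul_add, TensorProduct.add_tmul]
    · rw [TensorProduct.map_tmul, LinearEquiv.coe_coe,
        Bosonization.comulAux_tmul k (hA.coact _ _ _ _ hu hl), LinearMap.lTensor_tmul,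
        bosDegree_tmul _ hv, LinearMap.lTensor_tmul, TensorProduct.rid_tmul, map_smul]
      by_cases h0 : counit (R := ℂ) v = 0
      · simp [h0]
      · have h2 : c = b := hv.counit_eq h0
        have h1 : l = g := hA.inj (by rw [hl, hg, h2])
        rw [h1, h2, TensorProduct.tmul_smul, TensorProduct.tmul_smul, TensorProduct.smul_tmul']
  rw [Bosonization.smashComul_tmul, hA.comul, key, Coalgebra.lTensor_counit_comul,
    TensorProduct.rid_tmul, one_smul]

/-- On `k # x` the right-hand side is `ε(x) (k, a) ⊗ (k g, b)`. If `ε(x) ≠ 0`, then `a = b` and `g =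
1`, so the two legs agree as group-likes require. -/
theorem bosDegree_comul (hA : IsTransmuted π i β e A.coact) (z : GroupAlg Γ₀ ⊗[ℂ] A.carrier) :
    comul (R := ℂ) (bosDegree π e z) =
      TensorProduct.map (bosDegree π e) (bosDegree π e) (smashComul A z) := by
  induction z using bos_induction hA with
  | add x y hx hy => simp only [map_add, hx, hy]
  | hom k a b g x hx hg =>
    rw [← LinearMap.rTensor_comp_lTensor, LinearMap.comp_apply, bosDegree_right hA k hx hg,
      LinearMap.rTensor_tmul, bosDegree_tmul k hx, map_smul]
    by_cases h0 : counit (R := ℂ) x = 0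
    · simp [h0]
    · have h2 : a = b := hx.counit_eq h0
      have h1 : g = 1 := hA.inj (by rw [hg, h2]; simp)
      simp [h1, h2, TensorProduct.smul_tmul']

theorem bosDegree_counit (hA : IsTransmuted π i β e A.coact) (z : GroupAlg Γ₀ ⊗[ℂ] A.carrier) :
    counit (R := ℂ) (bosDegree π e z) = smashCounit A z := by
  induction z using bos_induction hA with
  | add x y hx hy => simp only [map_add, hx, hy]
  | hom k a b g x hx hg =>
    rw [Bosonization.smashCounit_tmul, bosDegree_tmul k hx, hA.counit]
    simp

/-- Both scalars in the twisted product are characters of the degree `a⁻¹ b` of the left factor `x`,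
which is trivial whenever `ε(x) ≠ 0`. Where `p` does not vanish, the twist is therefore invisible.
-/
theorem bosDegree_mul (hA : IsTransmuted π i β e A.coact) (z w : GroupAlg Γ₀ ⊗[ℂ] A.carrier) :
    bosDegree π e (smashMul A (z ⊗ₜ w)) = bosDegree π e z * bosDegree π e w := by
  induction z using bos_induction hA with
  | add x y hx hy => simp only [TensorProduct.add_tmul, map_add, hx, hy, add_mul]
  | hom k a b g x hx hg =>
  induction w using bos_induction hA with
  | add x y hx hy => simp only [TensorProduct.tmul_add, map_add, hx, hy, mul_add]
  | hom l c d m y hy hm =>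
  rw [smashMul_bihom hA k l hx hg hy, map_smul, bosDegree_tmul _ hx, bosDegree_tmul _ hy,
    bosDegree_tmul _ (hx.mul hy), Bialgebra.counit_mul, smul_mul_smul_comm, el_mul, Prod.mk_mul_mk]
  by_cases h0 : counit (R := ℂ) x = 0
  · simp [h0]
  · have h2 : a = b := hx.counit_eq h0
    have h1 : g = 1 := hA.inj (by rw [hg, h2]; simp)
    simp [h1, h2]

/-! ### Comparison of the two bosonizations -/

/-- The isomorphism between the vector spaces of two bosonizations. -/
def bosEquiv (e : H ≃ₗ[ℂ] A.carrier) (f : H ≃ₗ[ℂ] B.carrier) :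
    (GroupAlg Γ₀ ⊗[ℂ] A.carrier) ≃ₗ[ℂ] (GroupAlg Γ₀ ⊗[ℂ] B.carrier) :=
  TensorProduct.congr (LinearEquiv.refl ℂ _) (e.symm.trans f)

theorem bosEquiv_tmul (k : GroupAlg Γ₀) (x : H) :
    bosEquiv e f (k ⊗ₜ e x) = k ⊗ₜ f x := by
  simp [bosEquiv]

/-- The smash coproduct is built from the coproduct of `H` and the restricted adjoint coaction
alone; no bicharacter enters. -/
theorem bosEquiv_comul (hA : IsTransmuted π i β e A.coact) {β' : Γ →* Γ →* Circle}
    (hB : IsTransmuted π i β' f B.coact) (z : GroupAlg Γ₀ ⊗[ℂ] A.carrier) :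
    smashComul B (bosEquiv e f z) =
      TensorProduct.map (bosEquiv e f).toLinearMap (bosEquiv e f).toLinearMap (smashComul A z) := by
  induction z using bos_induction hA with
  | add x y hx hy => simp only [map_add, hx, hy]
  | hom k a b g x hx hg =>
    rw [bosEquiv_tmul, Bosonization.smashComul_tmul, Bosonization.smashComul_tmul, hA.comul,
      hB.comul]
    refine hA.deg.comul_induction hx (P := fun z => Bosonization.comulAux B k
      (TensorProduct.map f.toLinearMap f.toLinearMap z) = TensorProduct.map
      (bosEquiv e f).toLinearMap (bosEquiv e f).toLinearMap (Bosonization.comulAux A k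
        (TensorProduct.map e.toLinearMap e.toLinearMap z)))
      (fun z w hz hw => ?_) (fun c u v l _ hu hv hl _ => ?_) (by simp)
    · simp only [map_add, hz, hw]
    · simp only [TensorProduct.map_tmul, LinearEquiv.coe_coe]
      rw [Bosonization.comulAux_tmul k (hA.coact _ _ _ _ hu hl),
        Bosonization.comulAux_tmul k (hB.coact _ _ _ _ hu hl), TensorProduct.map_tmul,
        LinearEquiv.coe_coe, bosEquiv_tmul, bosEquiv_tmul]

theorem bosEquiv_counit (hA : IsTransmuted π i β e A.coact) {β' : Γ →* Γ →* Circle}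
    (hB : IsTransmuted π i β' f B.coact) (z : GroupAlg Γ₀ ⊗[ℂ] A.carrier) :
    smashCounit B (bosEquiv e f z) = smashCounit A z := by
  induction z using bos_induction hA with
  | add x y hx hy => simp only [map_add, hx, hy]
  | hom k a b g x hx hg =>
    rw [bosEquiv_tmul, Bosonization.smashCounit_tmul, Bosonization.smashCounit_tmul, hA.counit,
      hB.counit]

/-- The computation at the core of the proof: `χ` at the right degrees on the left-hand side, `χ` at
the left degrees on the other. The second argument of `β` is `i(l)⁻¹ c` in both values of `χ`, so
only the passage from `b` to `a` counts, and it is compensated by the scalar `β(a⁻¹ b, i(l) c⁻¹)` of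
the product in `A`. -/
theorem bosEquiv_mul (hA : IsTransmuted π i β e A.coact) (hB : IsTransmuted π i 1 f B.coact)
    (hβ₀ : ∀ g k, β₀ g k = β (i g) (i k)) (hβ₁ : β₁ = 1) (k l : Γ₀) {a b c d : Γ} {g m : Γ₀}
    {x y : H} (hx : IsBihom π a b x) (hg : i g = a⁻¹ * b) (hy : IsBihom π c d y)
    (hm : i m = c⁻¹ * d) :
    (twistBichar i β (k * g, b) (l * m, d) : ℂ) •
        bosEquiv e f (smashMul A ((el k ⊗ₜ e x) ⊗ₜ (el l ⊗ₜ e y))) =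
      (twistBichar i β (k, a) (l, c) : ℂ) •
        smashMul B (bosEquiv e f (el k ⊗ₜ e x) ⊗ₜ bosEquiv e f (el l ⊗ₜ e y)) := by
  subst hβ₁
  rw [bosEquiv_tmul, bosEquiv_tmul, smashMul_bihom hA k l hx hg hy, smashMul_bihom hB k l hx hg hy,
    map_smul, bosEquiv_tmul, smul_smul, smul_smul, twistBichar_apply, twistBichar_apply, hβ₀, hg]
  congr 1
  -- This invariance is the reason for the factor `i(l)⁻¹` in `twistBichar`: passing from left to
  -- right degree multiplies both `i(l)` and `c` by `i(m) = c⁻¹ d`.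
  have h1 : (i (l * m))⁻¹ * d = (i l)⁻¹ * c := by
    rw [map_mul, hm, mul_inv, mul_inv, inv_inv, mul_assoc, mul_assoc, inv_mul_cancel, mul_one]
  -- Split `β(b, ·) = β(a⁻¹ b, ·) β(a, ·)`. The first factor cancels because `i(l) c⁻¹` is the
  -- inverse of `i(l)⁻¹ c`.
  have h2 : β b ((i l)⁻¹ * c) * (β (a⁻¹ * b) (i l) * β (a⁻¹ * b) c⁻¹) = β a ((i l)⁻¹ * c) := by
    rw [← map_mul]
    have h3 : i l * c⁻¹ = ((i l)⁻¹ * c)⁻¹ := by rw [mul_inv, inv_inv]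
    have h4 : β b = β (a⁻¹ * b) * β a := by rw [← map_mul, mul_right_comm, inv_mul_cancel, one_mul]
    rw [h3, map_inv, h4, MonoidHom.mul_apply, mul_right_comm, mul_inv_cancel, one_mul]
  rw [h1, ← Circle.coe_mul, ← Circle.coe_mul, h2]
  simp

/-- The bosonization of the transmutation of `H` is a cocycle twist of the bosonization of `H`. -/
theorem isCocycleTwist_bos (hA : IsTransmuted π i β e A.coact) (hB : IsTransmuted π i 1 f B.coact)
    (hβ₀ : ∀ g k, β₀ g k = β (i g) (i k)) (hβ₁ : β₁ = 1) :
    IsCocycleTwist (A := Bosonization A) (B := Bosonization B) (twistBichar i β)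
      (bosEquiv e f) (bosDegree π e) where
  coalgMap := ⟨bosEquiv_comul hA hB, bosEquiv_counit hA hB⟩
  map_one := by
    change bosEquiv e f (1 ⊗ₜ 1) = 1 ⊗ₜ 1
    rw [← hA.one, bosEquiv_tmul, hB.one]
  degree_coalgMap := ⟨bosDegree_comul hA, bosDegree_counit hA⟩
  degree_one := by
    change bosDegree π e (el 1 ⊗ₜ 1) = 1
    rw [← hA.one, bosDegree_tmul 1 isBihom_one, Bialgebra.counit_one, one_smul]
    rfl
  degree_mul := bosDegree_mul hA
  twist := twist_of_homogeneous (A := Bosonization A) (B := Bosonization B)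
    -- The homogeneous elements are the `k # x` with `x ∈ H_{a,b}`, of left degree `(k, a)` and
    -- right degree `(k g, b)`.
    (fun z s t => ∃ (k : Γ₀) (a b : Γ) (g : Γ₀) (x : H), IsBihom π a b x ∧ i g = a⁻¹ * b ∧
      z = el k ⊗ₜ[ℂ] e x ∧ s = (k, a) ∧ t = (k * g, b))
    (fun add hom => bos_induction hA add fun k a b g x hx hg =>
      hom _ _ _ ⟨k, a, b, g, x, hx, hg, rfl, rfl, rfl⟩)
    (by
      rintro _ _ _ ⟨k, a, b, g, x, hx, hg, rfl, rfl, rfl⟩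
      exact bosDegree_left hA k hx)
    (by
      rintro _ _ _ ⟨k, a, b, g, x, hx, hg, rfl, rfl, rfl⟩
      exact bosDegree_right hA k hx hg)
    (by
      rintro _ _ _ _ _ _ ⟨k, a, b, g, x, hx, hg, rfl, rfl, rfl⟩
        ⟨l, c, d, m, y, hy, hm, rfl, rfl, rfl⟩
      exact bosEquiv_mul hA hB hβ₀ hβ₁ k l hx hg hy hm)

end BosonizationDegree

end

end Transmutation

/-! ### The monoidal equivalence -/

theorem mainTheorem4 {T : Type u} [CommGroup T] [TopologicalSpace T] [IsTopologicalGroup T]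
    [CompactSpace T] [T2Space T]
    {H : Type v} [Ring H] [HopfAlgebra ℂ H] [StarRing H] [StarModule ℂ H] [IsHopfStarAlgebra H]
    (π : H →ₐc[ℂ] FunAlg T) (hπ : ∀ x, π (star x) = groupAlgStar (π x))
    (β : PontryaginDual T →* PontryaginDual T →* Circle)
    (T₀ : Subgroup T) (hT₀ : IsClosed (T₀ : Set T)) (hc : IsCocentral π T₀) :
    ∃ F : ComodCat.{max u v, w} (TwistedBosonization π β T₀ hc) ≌
        ComodCat.{max u v, w} (UntwistedBosonization π T₀ hc),
      F.functor.Additive ∧ F.functor.Linear ℂ ∧ Nonempty F.functor.Monoidal :=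
  -- Both `H_β` and `H` are transmutations of `H`, for `β` and for the trivial bicharacter, with the
  -- identity of `H` as identification. The bicharacters on the dual of `T/T₀` are the pullback of
  -- `β` and `1`, which is what the two `rfl` proofs verify.
  (isCocycleTwist_bos (A := transmutation π β T₀ hc) (B := untwisted π T₀ hc)
    (isTransmuted_transm π β (dualInfl_injective T₀) hc.degreesIn)
    (isTransmuted_self π (dualInfl_injective T₀) hc.degreesIn)
    (fun _ _ => rfl) rfl).exists_monoidal_equivalence
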